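/- Graphs are finite and simple. For a tree $T$, the weight of a vertex $v$ is the number of vertices in a largest component of $T-v$, and the centroid of $T$ is the set of vertices of minimum weight; $T$ is bicentroidal if its centroid consists of two vertices $a,b$ (which are then adjacent), and the two components of $T-ab$, $G$ containing $a$ and $H$ containing $b$, are called its centroidal components. A pseudopath is a tree isomorphic to a path $P_k$ on $k\ge 1$ vertices, or to $S_{1,1,2}$, or to $S_{1,2,3}$, where $S_{p,q,r}$ is the tree consisting of three paths with $p$, $q$ and $r$ edges that share one end-vertex and are otherwise disjoint. The edge-reconstruction number $\mathrm{ern}(X)$ of a graph $X$ is the least $k$ for which there are $k$ distinct edges $e_1,\dots,e_k$ of $X$ such that every graph $Y$ that has $k$ distinct edges $f_1,\dots,f_k$ with $Y-f_i\cong X-e_i$ for all $i$ is isomorphic to $X$. Theorem. Let $T$ be a bicentroidal tree with centroidal vertices $a$ and $b$. Suppose that $\deg_T(a)=\deg_T(b)=2$ and that neither of the two centroidal components $G$, $H$ of $T$ is a pseudopath. Then $\mathrm{ern}(T)=2$. -/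

import Mathlib

namespace EdgeReconstruction

universe u

/-- The edge-card `G - e`: delete the edge `e`, keep all vertices. -/
def edgeCard {V : Type u} (G : SimpleGraph V) (e : Sym2 V) : SimpleGraph V :=
  G.deleteEdges {e}

/-- The edge-deck of `X` contains the edge-cards `G - e`, `e ∈ S`, counted with multiplicity:
distinct edges of `S` are matched with distinct edges of `X` giving isomorphic edge-cards. -/
def HasCards {V W : Type u} (G : SimpleGraph V) (S : Finset (Sym2 V)) (X : SimpleGraph W) : Prop :=
  ∃ f : {e // e ∈ S} → Sym2 W, Function.Injective f ∧
    ∀ e : {e // e ∈ S}, f e ∈ X.edgeSet ∧ Nonempty (edgeCard G e.1 ≃g edgeCard X (f e))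

/-- The edge-cards `G - e`, `e ∈ S`, where `S` is a set of edges of `G`, determine `G` up to
isomorphism among all finite graphs. -/
def Reconstructs {V : Type u} (G : SimpleGraph V) (S : Finset (Sym2 V)) : Prop :=
  (∀ e ∈ S, e ∈ G.edgeSet) ∧
    ∀ (W : Type u) [Finite W] (X : SimpleGraph W), HasCards G S X → Nonempty (X ≃g G)

/-- The edge-reconstruction number: the least number of edge-cards of `G` that determine `G` up to
isomorphism. (It is `0` by convention if no set of edge-cards does; a graph with at least one edge
is never determined by zero cards, so no other value is affected.) -/
noncomputable def ern {V : Type u} (G : SimpleGraph V) : ℕ :=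
  sInf {k | ∃ S : Finset (Sym2 V), S.card = k ∧ Reconstructs G S}

/-- The weight of a vertex `v` of a finite tree `T`: the number of vertices in a largest component
of `T - v` (and `0` if `v` is the only vertex). -/
noncomputable def weight {V : Type u} (T : SimpleGraph V) (v : V) : ℕ :=
  ⨆ C : (T.induce ({v}ᶜ : Set V)).ConnectedComponent, C.supp.ncard

/-- The centroid: the set of all vertices of minimum weight. -/
def centroid {V : Type u} (T : SimpleGraph V) : Set V :=
  {v | ∀ w, weight T v ≤ weight T w}

/-- `T` is a bicentroidal tree, with (distinct) centroidal vertices `a` and `b`. -/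
def IsBicentroidal {V : Type u} (T : SimpleGraph V) (a b : V) : Prop :=
  T.IsTree ∧ a ≠ b ∧ centroid T = {a, b}

/-- The component of `T - ab` that contains `a`, as a graph on its own vertex set. -/
def centroidalComponent {V : Type u} (T : SimpleGraph V) (a b : V) :
    SimpleGraph ((edgeCard T s(a, b)).connectedComponentMk a) :=
  ((edgeCard T s(a, b)).connectedComponentMk a).toSimpleGraph

/-- The tree `S₁ = S_{1,1,2}`: paths with 1, 1 and 2 edges emerging from the vertex `0`. -/
def S₁ : SimpleGraph (Fin 5) :=
  SimpleGraph.fromEdgeSet {s(0, 1), s(0, 2), s(0, 3), s(3, 4)}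

/-- The tree `S₂ = S_{1,2,3}`: paths with 1, 2 and 3 edges emerging from the vertex `0`. -/
def S₂ : SimpleGraph (Fin 7) :=
  SimpleGraph.fromEdgeSet {s(0, 1), s(0, 2), s(2, 3), s(0, 4), s(4, 5), s(5, 6)}

/-- A pseudopath is a graph isomorphic to a path on `k ≥ 1` vertices, or to `S₁`, or to `S₂`. -/
def IsPseudopath {W : Type u} (G : SimpleGraph W) : Prop :=
  (∃ k : ℕ, 1 ≤ k ∧ Nonempty (G ≃g SimpleGraph.pathGraph k)) ∨
    Nonempty (G ≃g S₁) ∨ Nonempty (G ≃g S₂)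

end EdgeReconstruction

/-! Let N be the common order of G and H; minimality of the two weights forces the sides of ab to be
equal. Let c and d be the second neighbours of a and b, and put C = G - a, rooted at c, and D = H -
b, rooted at d. Since G and H are not paths, the path that enters either of them from ab eventually
branches; the number of steps until then is its leg.

One card never suffices. T has a vertex of degree at least three, so after any edge is deleted two
of its neighbours are still joined to it, and the edge between them gives a disconnected graph with
the same card.

For two cards, a competitor X is the first card with one edge added, and the second card restricts
that edge. Two choices of cards are needed.

Cards T - ab and T - ac. The component sizes N, N and N + 1, N - 1 force the new edge to join the
two components at some p and q, where p is a leaf of its component, and the second deleted edge is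
the old edge at p: the leaf p is moved from one half to the other. In T - ac the leaf a of G has
been moved to b. If p lies in G, then p is equivalent to a and q to b by the principle on attached
leaves (`cls_eq_of_cls_addEdge_eq`): if attaching a leaf at y and at z yields isomorphic trees, then
y and z are equivalent. The isomorphism induces a self-map of the tree that never tears an edge, so
it fixes a vertex or reverses an edge, and for rooted trees the principle follows by cancelling
branches. If p lies in H, then X is still T or else H has as many leaves as G, or one more; the
equality is impossible if every leaf of H hangs at a vertex of degree at least three (`IsThin`). So
this pair, or its mirror image T - ab, T - bd, works as soon as one half is thin, and this pair
works whenever G and H are equivalent as rooted trees.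

Otherwise both halves have a leaf l₀ whose neighbour u₀ has degree two. Let the leg of C be at least
that of D. The cards are T - u₀w₀, with u₀ in G and w₀ its second neighbour, and T - my for a leaf m
of H. A competitor is T with m moved to some z. In the large component of T - u₀w₀ the edge bd is
the only one with halves of N - 1 vertices; one half is D and the other has a longer leg than C.
Locating this halving edge in X leads, for each position of z and of the cut edge, to a
contradiction or to X ≅ T (`MovedLeaf.nonempty_iso`). This needs m to be chosen so that H - m is a
copy of C, or, if there is no such leaf, so that deleting m does not change the leg of H.

All graphs live on one vertex type: vertices are isolated instead of deleted, leaves are attached by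
joining an isolated vertex, and components are compared through the isomorphism type `cls F v` of
the component rooted at v. -/

namespace EdgeReconstruction

open SimpleGraph

universe u

variable {V : Type u}

set_option linter.unusedSectionVars false

/-! ### Components and sides of edges in forests -/

section Components

/-- The graph obtained from `F` by removing all edges at `p`. -/
def isolate (F : SimpleGraph V) (p : V) : SimpleGraph V where
  Adj x y := F.Adj x y ∧ x ≠ p ∧ y ≠ p
  symm := ⟨fun _ _ h => ⟨h.1.symm, h.2.2, h.2.1⟩⟩
  loopless := ⟨fun _ h => h.1.ne rfl⟩

/-- The vertex set of the component of `v` in `F`. -/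
def comp (F : SimpleGraph V) (v : V) : Set V := {w | F.Reachable v w}

/-- The vertex set of the component of `q` in `F - p`. -/
def side (F : SimpleGraph V) (p q : V) : Set V := comp (isolate F p) q

variable {F F' : SimpleGraph V} {p q r s t u v w x y z : V} {S : Set V}

theorem isolate_adj : (isolate F p).Adj x y ↔ F.Adj x y ∧ x ≠ p ∧ y ≠ p := Iff.rfl

theorem not_isolate_adj : ∀ x, ¬ (isolate F p).Adj p x := fun _ h => h.2.1 rfl

theorem isolate_le : isolate F p ≤ F := fun _ _ h => h.1

theorem isolate_mono (h : F ≤ F') : isolate F p ≤ isolate F' p :=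
  fun _ _ h' => ⟨h h'.1, h'.2⟩

theorem isolate_comm : isolate (isolate F p) q = isolate (isolate F q) p := by
  ext x y; simp only [isolate_adj]; tauto

theorem isolate_isolated (h : ∀ y, ¬ F.Adj p y) : isolate F p = F := by
  ext x y
  simp only [isolate_adj]
  refine ⟨fun h => h.1, fun h' => ⟨h', ?_, ?_⟩⟩
  · rintro rfl; exact h _ h'
  · rintro rfl; exact h _ h'.symm

theorem mem_comp_self : v ∈ comp F v := Reachable.refl v

theorem mem_comp : w ∈ comp F v ↔ F.Reachable v w := Iff.rfl

theorem mem_comp_comm : w ∈ comp F v ↔ v ∈ comp F w := ⟨Reachable.symm, Reachable.symm⟩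

theorem comp_eq (h : w ∈ comp F v) : comp F w = comp F v := by
  ext x
  exact ⟨fun hx => Reachable.trans h hx, fun hx => Reachable.trans (Reachable.symm h) hx⟩

theorem mem_comp_of_adj (h : F.Adj v w) : w ∈ comp F v := h.reachable

theorem comp_adj (hx : x ∈ comp F v) (h : F.Adj x y) : y ∈ comp F v :=
  Reachable.trans hx h.reachable

theorem comp_mono (h : F ≤ F') : comp F v ⊆ comp F' v := fun _ hx => Reachable.mono h hx

theorem comp_subset (hv : v ∈ S) (h : ∀ x ∈ S, ∀ y, F.Adj x y → y ∈ S) : comp F v ⊆ S := by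
  intro w hw
  rw [mem_comp, reachable_iff_reflTransGen] at hw
  induction hw with
  | refl => exact hv
  | tail _ hadj ih => exact h _ ih _ hadj

/-- The component of `v` only depends on the adjacencies inside a closed set containing it. -/
theorem comp_congr_of_closed (hv : v ∈ S) (h : ∀ x ∈ S, ∀ y, F.Adj x y → y ∈ S)
    (h' : ∀ x ∈ S, ∀ y ∈ S, F'.Adj x y ↔ F.Adj x y) (h'' : ∀ x ∈ S, ∀ y, F'.Adj x y → y ∈ S) :
    comp F' v = comp F v := by
  have h1 := comp_subset hv h
  have h2 := comp_subset hv h''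
  apply Set.Subset.antisymm
  · refine comp_subset (S := comp F v) mem_comp_self fun x hx y hxy => ?_
    exact comp_adj hx ((h' x (h1 hx) y (h'' x (h1 hx) y hxy)).1 hxy)
  · refine comp_subset (S := comp F' v) mem_comp_self fun x hx y hxy => ?_
    exact comp_adj hx ((h' x (h2 hx) y (h x (h2 hx) y hxy)).2 hxy)

theorem comp_congr (h : ∀ x ∈ comp F v, ∀ y, F'.Adj x y ↔ F.Adj x y) :
    comp F' v = comp F v :=
  comp_congr_of_closed (S := comp F v) mem_comp_self (fun _ hx _ => comp_adj hx)
    (fun x hx y _ => h x hx y) (fun x hx y hxy => comp_adj hx ((h x hx y).1 hxy))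

theorem exists_adj_of_mem_comp (h : w ∈ comp F v) (hne : w ≠ v) :
    ∃ u, F.Adj v u ∧ w ∈ side F v u := by
  have : comp F v ⊆ {w | w = v ∨ ∃ u, F.Adj v u ∧ w ∈ side F v u} := by
    refine comp_subset (Or.inl rfl) ?_
    rintro x hx y hxy
    by_cases hy : y = v
    · exact Or.inl hy
    rcases hx with rfl | ⟨u, hu, hx⟩
    · exact Or.inr ⟨y, hxy, mem_comp_self⟩
    · by_cases hxv : x = v
      · subst hxv; exact Or.inr ⟨y, hxy, mem_comp_self⟩
      · exact Or.inr ⟨u, hu, comp_adj hx ⟨hxy, hxv, hy⟩⟩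
  exact (this h).resolve_left hne

theorem side_subset_comp (h : F.Adj v u) : side F v u ⊆ comp F v := fun _ hw =>
  Reachable.trans h.reachable (Reachable.mono isolate_le hw)

theorem not_mem_side (h : q ≠ p) : p ∉ side F p q := by
  have : comp (isolate F p) q ⊆ {x | x ≠ p} := comp_subset h (fun _ _ _ h => h.2.2)
  exact fun hp => this hp rfl

theorem comp_isolate_self : comp (isolate F p) p = {p} := by
  apply Set.Subset.antisymm
  · refine comp_subset rfl ?_
    rintro x rfl y hxy
    exact absurd rfl hxy.2.1
  · rintro _ rfl; exact mem_comp_self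

theorem comp_eq_insert : comp F v = insert v (⋃ u ∈ {u | F.Adj v u}, side F v u) := by
  ext w
  simp only [Set.mem_insert_iff, Set.mem_iUnion, Set.mem_ofPred_eq, exists_prop]
  constructor
  · intro h
    by_cases hw : w = v
    · exact Or.inl hw
    · exact Or.inr (exists_adj_of_mem_comp h hw)
  · rintro (rfl | ⟨u, hu, hw⟩)
    · exact mem_comp_self
    · exact side_subset_comp hu hw

/-- Deleting a vertex with at most one neighbour leaves the other vertices connected as before. -/
theorem comp_isolate_of_leaf (h : ∀ y z, F.Adj p y → F.Adj p z → y = z) (hu : u ≠ p) :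
    comp (isolate F p) u = comp F u \ {p} := by
  apply Set.Subset.antisymm
  · intro w hw
    refine ⟨comp_mono isolate_le hw, ?_⟩
    rintro rfl
    exact not_mem_side hu hw
  · have : comp F u ⊆ {w | (w ≠ p → w ∈ comp (isolate F p) u) ∧
        (w = p → ∀ y, F.Adj p y → y ∈ comp (isolate F p) u)} := by
      refine comp_subset ⟨fun _ => mem_comp_self, fun h => absurd h hu⟩ ?_
      rintro x ⟨h1, h2⟩ y hxy
      constructor
      · intro hy
        by_cases hx : x = p
        · exact h2 hx y (hx ▸ hxy)
        · exact comp_adj (h1 hx) ⟨hxy, hx, hy⟩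
      · rintro rfl z hz
        have := h _ _ hz hxy.symm
        subst this
        exact h1 hxy.ne
    rintro w ⟨hw, hwp⟩
    exact (this hw).1 hwp

theorem isAcyclic_isolate (h : F.IsAcyclic) : (isolate F p).IsAcyclic := h.anti isolate_le

theorem not_reachable_of_isAcyclic (hF : F.IsAcyclic) (h : F.Adj s t) :
    ¬ (F.deleteEdges {s(s, t)}).Reachable s t := by
  have := (isAcyclic_iff_forall_adj_isBridge.1 hF) h
  simpa [isBridge_iff] using this

/-- A path from u to w that avoids v, closed up through v, would show that vu is not a bridge. -/
theorem eq_of_reachable_isolate (hF : F.IsAcyclic) (hu : F.Adj v u) (hw : F.Adj v w)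
    (h : w ∈ side F v u) : u = w := by
  by_contra hne
  apply not_reachable_of_isAcyclic hF hu
  have h1 : (F.deleteEdges {s(v, u)}).Reachable u w := by
    refine Reachable.mono ?_ h
    intro x y hxy
    rw [deleteEdges_adj]
    refine ⟨hxy.1, ?_⟩
    simp only [Set.mem_singleton_iff, Sym2.eq_iff]
    rintro (⟨rfl, -⟩ | ⟨-, rfl⟩)
    · exact hxy.2.1 rfl
    · exact hxy.2.2 rfl
  refine Reachable.trans (Adj.reachable (v := w) ?_) h1.symm
  rw [deleteEdges_adj]
  refine ⟨hw, ?_⟩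
  simp only [Set.mem_singleton_iff, Sym2.eq_iff]
  rintro (⟨-, h⟩ | ⟨h, -⟩)
  · exact hne h.symm
  · exact hu.ne h

theorem disjoint_side (hF : F.IsAcyclic) (h : F.Adj s t) : Disjoint (side F s t) (side F t s) := by
  rw [Set.disjoint_left]
  intro w h1 h2
  apply not_reachable_of_isAcyclic hF h
  have aux : ∀ p q, s(p, q) = s(s, t) → isolate F p ≤ F.deleteEdges {s(s, t)} := by
    intro p q hpq x y hxy
    rw [deleteEdges_adj, ← hpq]
    refine ⟨hxy.1, ?_⟩
    simp only [Set.mem_singleton_iff, Sym2.eq_iff]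
    rintro (⟨rfl, -⟩ | ⟨-, rfl⟩)
    · exact hxy.2.1 rfl
    · exact hxy.2.2 rfl
  exact Reachable.trans (Reachable.mono (aux t s Sym2.eq_swap) h2)
    (Reachable.symm (Reachable.mono (aux s t rfl) h1))

theorem disjoint_side_side (hF : F.IsAcyclic) (hu : F.Adj v u) (hw : F.Adj v w) (hne : u ≠ w) :
    Disjoint (side F v u) (side F v w) := by
  rw [Set.disjoint_left]
  intro x h1 h2
  exact hne (eq_of_reachable_isolate hF hu hw (Reachable.trans h1 (Reachable.symm h2)))

theorem comp_eq_union (h : F.Adj s t) : comp F s = side F t s ∪ side F s t := by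
  apply Set.Subset.antisymm
  · refine comp_subset (Or.inl mem_comp_self) ?_
    rintro x (hx | hx) y hxy
    · by_cases hy : y = t
      · subst hy; exact Or.inr mem_comp_self
      · by_cases hx' : x = t
        · subst hx'; exact absurd hx (not_mem_side h.ne)
        · exact Or.inl (comp_adj hx ⟨hxy, hx', hy⟩)
    · by_cases hy : y = s
      · subst hy; exact Or.inl mem_comp_self
      · by_cases hx' : x = s
        · subst hx'; exact absurd hx (not_mem_side h.ne')
        · exact Or.inr (comp_adj hx ⟨hxy, hx', hy⟩)
  · rintro x (hx | hx)
    · exact comp_mono isolate_le hx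
    · exact side_subset_comp h hx

theorem side_subset_side (hF : F.IsAcyclic) (hu : F.Adj v u) (hw : F.Adj u w) (hne : w ≠ v) :
    side F u w ⊆ side F v u := by
  have hv : v ∉ side F u w := fun h => hne (eq_of_reachable_isolate hF hw hu.symm h)
  have : side F u w ⊆ side F v u ∩ side F u w := by
    refine comp_subset ⟨mem_comp_of_adj ⟨hw, hu.ne', hne⟩, mem_comp_self⟩ ?_
    rintro x ⟨hx, hx'⟩ y hxy
    have hy : y ∈ side F u w := comp_adj hx' hxy
    exact ⟨comp_adj hx ⟨hxy.1, fun h => hv (h ▸ hx'), fun h => hv (h ▸ hy)⟩, hy⟩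
  exact fun x hx => (this hx).1

/-- For an edge `st`, every other vertex has a neighbour behind which one of the two sides of the
edge lies entirely. -/
theorem exists_side_subset (hF : F.IsAcyclic) (h : F.Adj s t) (hx : x ∈ comp F s) :
    ∃ u, F.Adj x u ∧ ((x ∈ side F t s ∧ side F s t ⊆ side F x u) ∨
      (x ∈ side F s t ∧ side F t s ⊆ side F x u)) := by
  have key : ∀ s t, F.Adj s t → x ∈ side F t s → ∃ u, F.Adj x u ∧ side F s t ⊆ side F x u := by
    intro s t h hx
    by_cases hxs : x = s
    · subst hxs; exact ⟨t, h, subset_rfl⟩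
    have hdis := Set.disjoint_left.1 (disjoint_side hF h)
    obtain ⟨u, hu, hsu⟩ := exists_adj_of_mem_comp (F := F) (v := x) (w := s)
      (mem_comp_comm.1 (comp_mono isolate_le hx)) (Ne.symm hxs)
    refine ⟨u, hu, ?_⟩
    have hxt : t ≠ x := by rintro rfl; exact not_mem_side h.ne hx
    have : side F s t ⊆ side F x u ∩ side F s t := by
      refine comp_subset ⟨comp_adj hsu ⟨h, Ne.symm hxs, hxt⟩, mem_comp_self⟩ ?_
      rintro y ⟨hy, hy'⟩ z hyz
      have hz : z ∈ side F s t := comp_adj hy' hyz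
      exact ⟨comp_adj hy ⟨hyz.1, fun e => hdis (e ▸ hy') hx, fun e => hdis (e ▸ hz) hx⟩, hz⟩
    exact fun y hy => (this hy).1
  rw [comp_eq_union h] at hx
  rcases hx with hx | hx
  · obtain ⟨u, hu, hs⟩ := key s t h hx
    exact ⟨u, hu, Or.inl ⟨hx, hs⟩⟩
  · obtain ⟨u, hu, hs⟩ := key t s h.symm hx
    exact ⟨u, hu, Or.inr ⟨hx, hs⟩⟩

theorem eq_of_side_eq (hF : F.IsAcyclic) (h : F.Adj s t) (hxu : F.Adj x u)
    (hx : x ∈ side F t s) (he : side F s t = side F x u) : x = s ∧ u = t := by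
  have h1 : u ∈ side F s t := he ▸ mem_comp_self
  have h2 : t ∈ side F x u := he ▸ mem_comp_self
  have hdis := Set.disjoint_left.1 (disjoint_side hF h)
  have hxs : x = s := by
    by_contra hne
    exact hdis (comp_adj (v := t) (x := u) (y := x) h1
      ⟨hxu.symm, fun e => not_mem_side h.ne' (e ▸ h1), hne⟩) hx
  subst hxs
  exact ⟨rfl, eq_of_reachable_isolate hF hxu h h2⟩

theorem isTree_comp (hF : F.IsTree) (v : V) : comp F v = Set.univ :=
  Set.eq_univ_of_forall fun w => hF.connected.preconnected v w

theorem isTree_of_comp (hF : F.IsAcyclic) (h : comp F v = Set.univ) : F.IsTree := by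
  refine ⟨?_, hF⟩
  have : Nonempty V := ⟨v⟩
  refine ⟨fun x y => ?_⟩
  have hx : x ∈ comp F v := h ▸ Set.mem_univ x
  have hy : y ∈ comp F v := h ▸ Set.mem_univ y
  exact Reachable.trans (Reachable.symm hx) hy

section Finite
variable [Finite V]

theorem ncard_comp_eq (hF : F.IsAcyclic) (h : F.Adj s t) :
    (comp F s).ncard = (side F t s).ncard + (side F s t).ncard := by
  rw [comp_eq_union h, Set.ncard_union_eq (disjoint_side hF h).symm]

theorem ncard_comp_pos : 0 < (comp F v).ncard := by
  rw [Set.ncard_pos]; exact ⟨v, mem_comp_self⟩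

theorem ncard_side_lt (h : F.Adj v u) : (side F v u).ncard < (comp F v).ncard := by
  refine Set.ncard_lt_ncard ?_ (Set.toFinite _)
  refine ⟨side_subset_comp h, fun hs => not_mem_side (F := F) h.ne' (hs mem_comp_self)⟩

/-- The sides seen along a walk that never turns back shrink strictly; this is the measure for
descents along the tree. -/
theorem ncard_side_lt_side (hF : F.IsAcyclic) (hu : F.Adj v u) (hw : F.Adj u w) (hne : w ≠ v) :
    (side F u w).ncard < (side F v u).ncard := by
  refine Set.ncard_lt_ncard ?_ (Set.toFinite _)
  exact ⟨side_subset_side hF hu hw hne, fun hs => not_mem_side (F := F) hw.ne' (hs mem_comp_self)⟩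

end Finite

end Components

/-! ### Isomorphism types of rooted components -/

section RootedIso

variable {F F' F'' L L' : SimpleGraph V} {m m' m'' : Set V} {p q r s t u v v' v'' w x y z : V}
  {S S' : Set V} {f g : V → V}

/-- `f` restricts to an isomorphism from the component of `v` in `F` onto the component of `v'` in
`F'` that maps `v` to `v'` and respects the marks `m`, `m'`. -/
structure RootedIso (F F' : SimpleGraph V) (m m' : Set V) (v v' : V) (f : V → V) : Prop where
  root : f v = v'
  bij : Set.BijOn f (comp F v) (comp F' v')
  adj : ∀ x ∈ comp F v, ∀ y ∈ comp F v, (F'.Adj (f x) (f y) ↔ F.Adj x y)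
  mark : ∀ x ∈ comp F v, (f x ∈ m' ↔ x ∈ m)

/-- It is enough to control f on unions of components: a path from v is carried to a path from f v
and back, so the component of v is mapped exactly onto that of f v. -/
theorem RootedIso.of_closed (hf : Set.BijOn f S S') (hS : ∀ x ∈ S, ∀ y, F.Adj x y → y ∈ S)
    (hS' : ∀ x ∈ S', ∀ y, F'.Adj x y → y ∈ S')
    (hadj : ∀ x ∈ S, ∀ y ∈ S, (F'.Adj (f x) (f y) ↔ F.Adj x y))
    (hm : ∀ x ∈ S, (f x ∈ m' ↔ x ∈ m)) (hv : v ∈ S) : RootedIso F F' m m' v (f v) f := by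
  have h1 : comp F v ⊆ S := comp_subset hv hS
  have h1' : comp F' (f v) ⊆ S' := comp_subset (hf.mapsTo hv) hS'
  refine ⟨rfl, ⟨?_, hf.injOn.mono h1, ?_⟩, fun x hx y hy => hadj x (h1 hx) y (h1 hy),
    fun x hx => hm x (h1 hx)⟩
  · have : comp F v ⊆ {x | x ∈ S ∧ f x ∈ comp F' (f v)} := by
      refine comp_subset ⟨hv, mem_comp_self⟩ ?_
      rintro x ⟨hx, hx'⟩ y hxy
      have hy := hS x hx y hxy
      exact ⟨hy, comp_adj hx' ((hadj x hx y hy).2 hxy)⟩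
    exact fun x hx => (this hx).2
  · have : comp F' (f v) ⊆ f '' comp F v := by
      refine comp_subset ⟨v, mem_comp_self, rfl⟩ ?_
      rintro _ ⟨x, hx, rfl⟩ y hxy
      obtain ⟨z, hz, rfl⟩ := hf.surjOn (hS' _ (hf.mapsTo (h1 hx)) _ hxy)
      exact ⟨z, comp_adj hx ((hadj x (h1 hx) z hz).1 hxy), rfl⟩
    exact this

theorem RootedIso.of_iso (φ : F ≃g F') (hm : ∀ x, φ x ∈ m' ↔ x ∈ m) (v : V) :
    RootedIso F F' m m' v (φ v) φ :=
  RootedIso.of_closed (S := Set.univ) (S' := Set.univ) (Set.bijOn_univ.2 φ.bijective)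
    (fun _ _ _ _ => trivial) (fun _ _ _ _ => trivial) (fun _ _ _ _ => φ.map_adj_iff)
    (fun x _ => hm x) trivial

theorem RootedIso.refl (F : SimpleGraph V) (m : Set V) (v : V) : RootedIso F F m m v v id :=
  ⟨rfl, Set.bijOn_id _, fun _ _ _ _ => Iff.rfl, fun _ _ => Iff.rfl⟩

theorem RootedIso.trans (h : RootedIso F F' m m' v v' f) (h' : RootedIso F' F'' m' m'' v' v'' g) :
    RootedIso F F'' m m'' v v'' (g ∘ f) :=
  ⟨by simp [h.root, h'.root], h'.bij.comp h.bij, fun x hx y hy =>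
    (h'.adj _ (h.bij.mapsTo hx) _ (h.bij.mapsTo hy)).trans (h.adj x hx y hy),
    fun x hx => (h'.mark _ (h.bij.mapsTo hx)).trans (h.mark x hx)⟩

theorem RootedIso.symm (h : RootedIso F F' m m' v v' f) :
    ∃ g, RootedIso F' F m' m v' v g ∧ Set.LeftInvOn g f (comp F v) ∧
      Set.RightInvOn g f (comp F' v') := by
  have : Nonempty V := ⟨v⟩
  have hi := h.bij.invOn_invFunOn
  have hb : Set.BijOn (Function.invFunOn f (comp F v)) (comp F' v') (comp F v) :=
    ⟨h.bij.surjOn.mapsTo_invFunOn, hi.2.injOn, hi.1.surjOn h.bij.mapsTo⟩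
  refine ⟨Function.invFunOn f (comp F v), ⟨?_, hb, ?_, ?_⟩, hi⟩
  · rw [← h.root]; exact hi.1 mem_comp_self
  · intro x hx y hy
    rw [← h.adj _ (hb.mapsTo hx) _ (hb.mapsTo hy), hi.2 hx, hi.2 hy]
  · intro x hx
    rw [← h.mark _ (hb.mapsTo hx), hi.2 hx]

theorem RootedIso.reroot (h : RootedIso F F' m m' v v' f) (hx : x ∈ comp F v) :
    RootedIso F F' m m' x (f x) f :=
  RootedIso.of_closed h.bij (fun _ hx _ => comp_adj hx) (fun _ hx _ => comp_adj hx) h.adj h.mark hx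

theorem RootedIso.isolate (h : RootedIso F F' m m' v v' f) (hp : p ∈ comp F v)
    (hx : x ∈ comp F v) :
    RootedIso (isolate F p) (isolate F' (f p)) m m' x (f x) f := by
  refine RootedIso.of_closed h.bij (fun _ hx _ h => comp_adj hx h.1)
    (fun _ hx _ h => comp_adj hx h.1) (fun x hx y hy => ?_) h.mark hx
  rw [isolate_adj, isolate_adj, h.adj x hx y hy, h.bij.injOn.ne_iff hx hp, h.bij.injOn.ne_iff hy hp]

theorem RootedIso.congr_mark (h : RootedIso F F' m m' v v' f) {n n' : Set V}
    (hm : ∀ x ∈ comp F v, (f x ∈ n' ↔ x ∈ n)) : RootedIso F F' n n' v v' f :=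
  ⟨h.root, h.bij, h.adj, hm⟩

/-- Rooted components of graphs on `V` with marked vertices, up to isomorphism. -/
def rootedSetoid (V : Type u) : Setoid (SimpleGraph V × Set V × V) where
  r P Q := ∃ f, RootedIso P.1 Q.1 P.2.1 Q.2.1 P.2.2 Q.2.2 f
  iseqv := ⟨fun _ => ⟨_, RootedIso.refl _ _ _⟩, fun ⟨_, h⟩ => ⟨_, h.symm.choose_spec.1⟩,
    fun ⟨_, h⟩ ⟨_, h'⟩ => ⟨_, h.trans h'⟩⟩

/-- The isomorphism types of rooted marked components. -/
def RootedClass (V : Type u) := Quotient (rootedSetoid V)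

/-- The isomorphism type of the component of `v` in `F`, rooted at `v`, with marks `m`. -/
def mcls (F : SimpleGraph V) (m : Set V) (v : V) : RootedClass V :=
  Quotient.mk (rootedSetoid V) (F, m, v)

theorem mcls_eq_iff : mcls F m v = mcls F' m' v' ↔ ∃ f, RootedIso F F' m m' v v' f :=
  Quotient.eq (r := rootedSetoid V)

theorem RootedIso.mcls_eq (h : RootedIso F F' m m' v v' f) : mcls F m v = mcls F' m' v' :=
  mcls_eq_iff.2 ⟨f, h⟩

/-- The isomorphism type of the component of `v` in `F`, rooted at `v`. -/
abbrev cls (F : SimpleGraph V) (v : V) : RootedClass V := mcls F ∅ v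

theorem mcls_congr_of_closed (hv : v ∈ S) (h : ∀ x ∈ S, ∀ y, F.Adj x y → y ∈ S)
    (h' : ∀ x ∈ S, ∀ y ∈ S, F'.Adj x y ↔ F.Adj x y) (h'' : ∀ x ∈ S, ∀ y, F'.Adj x y → y ∈ S)
    (hm : ∀ x ∈ S, (x ∈ m' ↔ x ∈ m)) :
    mcls F' m' v = mcls F m v :=
  (RootedIso.of_closed (f := id) (Set.bijOn_id S) h h'' h' hm hv).mcls_eq.symm

theorem mcls_congr (h : ∀ x ∈ comp F v, ∀ y, F'.Adj x y ↔ F.Adj x y)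
    (hm : ∀ x ∈ comp F v, (x ∈ m' ↔ x ∈ m)) : mcls F' m' v = mcls F m v :=
  mcls_congr_of_closed (S := comp F v) mem_comp_self (fun _ hx _ => comp_adj hx)
    (fun x hx y _ => h x hx y) (fun x hx y hxy => comp_adj hx ((h x hx y).1 hxy)) hm

theorem cls_congr (h : ∀ x ∈ comp F v, ∀ y, F'.Adj x y ↔ F.Adj x y) : cls F' v = cls F v :=
  mcls_congr h fun _ _ => Iff.rfl

theorem isolate_adj_of_not_mem (hp : p ∉ comp F v) (hx : x ∈ comp F v) :
    (isolate F p).Adj x y ↔ F.Adj x y :=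
  ⟨fun h => h.1, fun h => ⟨h, fun e => hp (e ▸ hx), fun e => hp (e ▸ comp_adj hx h)⟩⟩

theorem mcls_isolate (hp : p ∉ comp F v) : mcls (isolate F p) m v = mcls F m v :=
  mcls_congr (fun _ hx _ => isolate_adj_of_not_mem hp hx) fun _ _ => Iff.rfl

theorem cls_isolate (hp : p ∉ comp F v) : cls (isolate F p) v = cls F v := mcls_isolate hp

theorem comp_isolate (hp : p ∉ comp F v) : comp (isolate F p) v = comp F v :=
  comp_congr fun _ hx _ => isolate_adj_of_not_mem hp hx

/-- Behind a neighbour `u` of `v`, the subtree at a further vertex `w` does not see `v`. -/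
theorem cls_isolate_isolate (hF : F.IsAcyclic) (hu : F.Adj v u) (hw : F.Adj u w) (hne : w ≠ v) :
    cls (isolate (isolate F v) u) w = cls (isolate F u) w := by
  rw [isolate_comm]
  exact cls_isolate fun h => hne (eq_of_reachable_isolate hF hw hu.symm h)

section Finite
variable [Finite V]

theorem ncard_eq_of_mcls_eq (h : mcls F m v = mcls F' m' v') :
    (comp F v).ncard = (comp F' v').ncard := by
  obtain ⟨f, hf⟩ := mcls_eq_iff.1 h
  rw [← hf.bij.image_eq, hf.bij.injOn.ncard_image]

theorem nonempty_iso_of_cls_eq (h : cls F v = cls F' v') (hF : comp F v = Set.univ)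
    (hF' : comp F' v' = Set.univ) : Nonempty (F ≃g F') := by
  obtain ⟨f, hf⟩ := mcls_eq_iff.1 h
  have hb := hf.bij
  rw [hF, hF', Set.bijOn_univ] at hb
  exact ⟨⟨Equiv.ofBijective f hb, fun {x y} =>
    hf.adj x (hF ▸ Set.mem_univ x) y (hF ▸ Set.mem_univ y)⟩⟩

/-- The neighbours of `v`. -/
noncomputable def nbrs (F : SimpleGraph V) (v : V) : Finset V :=
  (Set.toFinite (F.neighborSet v)).toFinset

theorem mem_nbrs : w ∈ nbrs F v ↔ F.Adj v w := by
  simp [nbrs]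

/-- The isomorphism types of the subtrees at the neighbours of the root. -/
noncomputable def mkids (F : SimpleGraph V) (m : Set V) (v : V) : Multiset (RootedClass V) :=
  (nbrs F v).val.map fun u => mcls (isolate F v) m u

noncomputable abbrev kids (F : SimpleGraph V) (v : V) : Multiset (RootedClass V) := mkids F ∅ v

theorem nbrs_eq_image [DecidableEq V] (h : RootedIso F F' m m' v v' f) (hx : x ∈ comp F v) :
    nbrs F' (f x) = (nbrs F x).image f := by
  ext w
  simp only [mem_nbrs, Finset.mem_image]
  constructor
  · intro hw
    obtain ⟨u, hu, rfl⟩ := h.bij.surjOn (comp_adj (h.bij.mapsTo hx) hw)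
    exact ⟨u, (h.adj _ hx _ hu).1 hw, rfl⟩
  · rintro ⟨u, hu, rfl⟩
    exact (h.adj _ hx _ (comp_adj hx hu)).2 hu

theorem RootedIso.card_nbrs (h : RootedIso F F' m m' v v' f) (hx : x ∈ comp F v) :
    (nbrs F' (f x)).card = (nbrs F x).card := by
  classical
  rw [nbrs_eq_image h hx, Finset.card_image_of_injOn]
  refine h.bij.injOn.mono ?_
  intro y hy
  exact comp_adj hx (mem_nbrs.1 hy)

theorem mkids_eq_of_mcls_eq (h : mcls F m v = mcls F' m' v') :
    mkids F m v = mkids F' m' v' := by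
  classical
  obtain ⟨f, hf⟩ := mcls_eq_iff.1 h
  obtain rfl := hf.root
  rw [mkids, mkids, nbrs_eq_image hf mem_comp_self, Finset.image_val_of_injOn, Multiset.map_map]
  · refine Multiset.map_congr rfl fun u hu => ?_
    exact (hf.isolate mem_comp_self (mem_comp_of_adj (mem_nbrs.1 hu))).mcls_eq
  · refine hf.bij.injOn.mono ?_
    intro y hy
    exact mem_comp_of_adj (mem_nbrs.1 hy)

/-- Equal multisets of labels can be matched one element at a time. Here the labels are the types of
branches, and the matching pairs the neighbours of two roots. -/
theorem exists_bijOn_of_map_eq {α β : Type*} [DecidableEq α] {A B : Finset α} {k k' : α → β}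
    (h : A.val.map k = B.val.map k') :
    ∃ e : α → α, Set.BijOn e A B ∧ ∀ x ∈ A, k' (e x) = k x := by
  induction A using Finset.induction_on generalizing B with
  | empty =>
    have : B = ∅ := by simpa [eq_comm] using h
    subst this
    exact ⟨id, by simp, by simp⟩
  | insert a A ha ih =>
    rw [Finset.insert_val_of_notMem ha, Multiset.map_cons] at h
    have hmem : k a ∈ B.val.map k' := h ▸ Multiset.mem_cons_self _ _
    obtain ⟨b, hb, hbk⟩ := Multiset.mem_map.1 hmem
    have hB : B.val = b ::ₘ (B.erase b).val := by
      rw [Finset.erase_val, Multiset.cons_erase hb]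
    rw [hB, Multiset.map_cons, hbk, Multiset.cons_inj_right] at h
    obtain ⟨e, he, hek⟩ := ih h
    refine ⟨Function.update e a b, ?_, ?_⟩
    · have h1 : Set.BijOn (Function.update e a b) A (B.erase b) := by
        refine he.congr fun x hx => ?_
        rw [Function.update_of_ne]
        rintro rfl; exact ha hx
      have h2 := h1.insert (a := a) (by simp)
      rw [Finset.coe_insert]
      convert h2 using 1
      rw [Function.update_self, ← Finset.coe_insert, Finset.insert_erase hb]
    · intro x hx
      rcases Finset.mem_insert.1 hx with rfl | hx
      · simpa using hbk
      · have hxa : x ≠ a := fun e => ha (e ▸ hx)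
        rw [Function.update_of_ne hxa, hek x hx]

theorem adj_iff_eq_of_mem_side (hF : F.IsAcyclic) (hu : F.Adj v u) (hx : x ∈ side F v u) :
    F.Adj v x ↔ x = u :=
  ⟨fun h => (eq_of_reachable_isolate hF hu h hx).symm, fun h => h ▸ hu⟩

/-- A rooted tree is determined by its multiset of branches: equal branches are matched and their
isomorphisms glued at the root. Acyclicity makes the branches disjoint and lets the root see only
one vertex of each. -/
theorem mcls_eq_of_mkids_eq (hF : F.IsAcyclic) (hF' : F'.IsAcyclic) (hm : v' ∈ m' ↔ v ∈ m)
    (h : mkids F m v = mkids F' m' v') : mcls F m v = mcls F' m' v' := by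
  classical
  obtain ⟨e, he, hek⟩ := exists_bijOn_of_map_eq h
  have hek' : ∀ u, ∃ f, F.Adj v u → RootedIso (isolate F v) (isolate F' v') m m' u (e u) f := by
    intro u
    by_cases hu : F.Adj v u
    · obtain ⟨f, hf⟩ := mcls_eq_iff.1 (hek u (mem_nbrs.2 hu)).symm
      exact ⟨f, fun _ => hf⟩
    · exact ⟨id, fun h => absurd h hu⟩
  choose g hg using hek'
  have heu : ∀ u, F.Adj v u → F'.Adj v' (e u) := fun u hu =>
    mem_nbrs.1 (he.mapsTo (mem_nbrs.2 hu))
  let f : V → V := fun x => if h : ∃ u, F.Adj v u ∧ x ∈ side F v u then g h.choose x else v'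
  have hfv : f v = v' := by
    have : ¬ ∃ u, F.Adj v u ∧ v ∈ side F v u := by
      rintro ⟨u, hu, hv⟩; exact not_mem_side hu.ne' hv
    simp only [f, dif_neg this]
  have hfu : ∀ u, F.Adj v u → ∀ x ∈ side F v u, f x = g u x := by
    intro u hu x hx
    have hex : ∃ u, F.Adj v u ∧ x ∈ side F v u := ⟨u, hu, hx⟩
    have : hex.choose = u := by
      by_contra hne
      exact Set.disjoint_left.1 (disjoint_side_side hF hex.choose_spec.1 hu hne)
        hex.choose_spec.2 hx
    simp only [f, dif_pos hex, this]
  have hfs : ∀ u, F.Adj v u → ∀ x ∈ side F v u, f x ∈ side F' v' (e u) := by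
    intro u hu x hx
    rw [hfu u hu x hx]
    exact (hg u hu).bij.mapsTo hx
  have hcase : ∀ x ∈ comp F v, x = v ∨ ∃ u, F.Adj v u ∧ x ∈ side F v u := by
    intro x hx
    by_cases hxv : x = v
    · exact Or.inl hxv
    · exact Or.inr (exists_adj_of_mem_comp hx hxv)
  have hvadj : ∀ y ∈ comp F v, F'.Adj v' (f y) ↔ F.Adj v y := by
    intro y hy
    rcases hcase y hy with rfl | ⟨u, hu, hyu⟩
    · simp [hfv]
    · rw [adj_iff_eq_of_mem_side hF hu hyu, adj_iff_eq_of_mem_side hF' (heu u hu) (hfs u hu y hyu),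
        hfu u hu y hyu, ← (hg u hu).root]
      exact (hg u hu).bij.injOn.eq_iff hyu mem_comp_self
  refine mcls_eq_iff.2 ⟨f, hfv, ⟨?_, ?_, ?_⟩, ?_, ?_⟩
  · intro x hx
    rcases hcase x hx with rfl | ⟨u, hu, hxu⟩
    · rw [hfv]; exact mem_comp_self
    · exact side_subset_comp (heu u hu) (hfs u hu x hxu)
  · intro x hx y hy hxy
    rcases hcase x hx with rfl | ⟨u, hu, hxu⟩
    · rcases hcase y hy with rfl | ⟨w, hw, hyw⟩
      · rfl
      · rw [hfv] at hxy
        have := hfs w hw y hyw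
        rw [← hxy] at this
        exact absurd this (not_mem_side (heu w hw).ne')
    · rcases hcase y hy with rfl | ⟨w, hw, hyw⟩
      · rw [hfv] at hxy
        have := hfs u hu x hxu
        rw [hxy] at this
        exact absurd this (not_mem_side (heu u hu).ne')
      · have h1 := hfs u hu x hxu
        have h2 := hfs w hw y hyw
        rw [← hxy] at h2
        have huw : u = w := by
          apply he.injOn (mem_nbrs.2 hu) (mem_nbrs.2 hw)
          by_contra hne
          exact Set.disjoint_left.1 (disjoint_side_side hF' (heu u hu) (heu w hw) hne) h1 h2
        subst huw
        rw [hfu u hu x hxu, hfu u hu y hyw] at hxy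
        exact (hg u hu).bij.injOn hxu hyw hxy
  · intro x hx
    by_cases hxv : x = v'
    · exact ⟨v, mem_comp_self, by rw [hfv, hxv]⟩
    · obtain ⟨u', hu', hxu⟩ := exists_adj_of_mem_comp hx hxv
      obtain ⟨u, hu, rfl⟩ := he.surjOn (mem_nbrs.2 hu')
      have hu := mem_nbrs.1 hu
      obtain ⟨y, hy, rfl⟩ := (hg u hu).bij.surjOn hxu
      exact ⟨y, side_subset_comp hu hy, hfu u hu y hy⟩
  · intro x hx y hy
    rcases hcase x hx with rfl | ⟨u, hu, hxu⟩
    · rw [hfv]; exact hvadj y hy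
    · rcases hcase y hy with rfl | ⟨w, hw, hyw⟩
      · rw [hfv, F'.adj_comm, F.adj_comm]; exact hvadj x hx
      · have hxv : x ≠ v := fun h => not_mem_side hu.ne' (h ▸ hxu)
        have hyv : y ≠ v := fun h => not_mem_side hw.ne' (h ▸ hyw)
        have hxv' : f x ≠ v' := fun h => not_mem_side (heu u hu).ne' (h ▸ hfs u hu x hxu)
        have hyv' : f y ≠ v' := fun h => not_mem_side (heu w hw).ne' (h ▸ hfs w hw y hyw)
        have e1 : F.Adj x y ↔ (isolate F v).Adj x y := by simp [isolate_adj, hxv, hyv]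
        have e2 : F'.Adj (f x) (f y) ↔ (isolate F' v').Adj (f x) (f y) := by
          simp [isolate_adj, hxv', hyv']
        rw [e1, e2]
        by_cases huw : u = w
        · subst huw
          rw [hfu u hu x hxu, hfu u hu y hyw]
          exact (hg u hu).adj x hxu y hyw
        · have hd := Set.disjoint_left.1 (disjoint_side_side hF hu hw huw)
          have hd' := Set.disjoint_left.1 (disjoint_side_side hF' (heu u hu) (heu w hw)
            fun h => huw (he.injOn (mem_nbrs.2 hu) (mem_nbrs.2 hw) h))
          refine iff_of_false (fun h => ?_) (fun h => ?_)
          · exact hd' (comp_adj (hfs u hu x hxu) h) (hfs w hw y hyw)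
          · exact hd (comp_adj hxu h) hyw
  · intro x hx
    rcases hcase x hx with rfl | ⟨u, hu, hxu⟩
    · rw [hfv]; exact hm
    · rw [hfu u hu x hxu]; exact (hg u hu).mark x hxu

theorem mem_iff_of_mcls_eq (h : mcls F m v = mcls F' m' v') : v' ∈ m' ↔ v ∈ m := by
  obtain ⟨f, hf⟩ := mcls_eq_iff.1 h
  rw [← hf.root]; exact hf.mark v mem_comp_self

theorem cls_eq_iff_kids (hF : F.IsAcyclic) (hF' : F'.IsAcyclic) :
    cls F v = cls F' v' ↔ kids F v = kids F' v' :=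
  ⟨mkids_eq_of_mcls_eq, mcls_eq_of_mkids_eq hF hF' (by simp)⟩

end Finite

end RootedIso

/-! ### The first branching on the path from the root -/

section Leg

variable {F F' : SimpleGraph V} {m m' : Set V} {l p q r s t u v v' w x y z : V} {f g : V → V}

/-- The path leaving the root `v` first branches after `n` steps. -/
def Leg (F : SimpleGraph V) (v : V) : ℕ → Prop
  | 0 => ∃ x y, x ≠ y ∧ F.Adj v x ∧ F.Adj v y
  | n + 1 => ∃ w, F.Adj v w ∧ (∀ y, F.Adj v y → y = w) ∧ Leg (isolate F v) w n

theorem Leg.unique {i j : ℕ} (h : Leg F v i) (h' : Leg F v j) : i = j := by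
  induction i generalizing F v j with
  | zero =>
    cases j with
    | zero => rfl
    | succ j =>
      obtain ⟨x, y, hne, hx, hy⟩ := h
      obtain ⟨w, -, hw, -⟩ := h'
      exact absurd ((hw x hx).trans (hw y hy).symm) hne
  | succ i ih =>
    cases j with
    | zero =>
      obtain ⟨x, y, hne, hx, hy⟩ := h'
      obtain ⟨w, -, hw, -⟩ := h
      exact absurd ((hw x hx).trans (hw y hy).symm) hne
    | succ j =>
      obtain ⟨w, -, hw, hl⟩ := h
      obtain ⟨w', hw', -, hl'⟩ := h'
      obtain rfl := hw w' hw'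
      rw [ih hl hl']

theorem Leg.map {i : ℕ} (h : Leg F v i) (hf : RootedIso F F' m m' v v' f) : Leg F' v' i := by
  induction i generalizing F F' v v' with
  | zero =>
    obtain ⟨x, y, hne, hx, hy⟩ := h
    obtain rfl := hf.root
    have hx' := mem_comp_of_adj hx
    have hy' := mem_comp_of_adj hy
    exact ⟨f x, f y, fun e => hne (hf.bij.injOn hx' hy' e),
      (hf.adj _ mem_comp_self _ hx').2 hx, (hf.adj _ mem_comp_self _ hy').2 hy⟩
  | succ i ih =>
    obtain ⟨w, hw, hu, hl⟩ := h
    obtain rfl := hf.root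
    have hw' := mem_comp_of_adj hw
    refine ⟨f w, (hf.adj _ mem_comp_self _ hw').2 hw, ?_, ih hl (hf.isolate mem_comp_self hw')⟩
    intro y hy
    obtain ⟨x, hx, rfl⟩ := hf.bij.surjOn (mem_comp_of_adj hy)
    rw [hu x ((hf.adj _ mem_comp_self _ hx).1 hy)]

theorem Leg.of_mcls_eq {i : ℕ} (h : Leg F v i) (he : mcls F m v = mcls F' m' v') : Leg F' v' i := by
  obtain ⟨f, hf⟩ := mcls_eq_iff.1 he
  exact h.map hf

/-- Extra edges can only bring the first branching forward. This is the source of the leg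
inequalities for subtrees. -/
theorem Leg.exists_of_le {j : ℕ} (h : Leg F' v j) (hle : F' ≤ F) : ∃ i ≤ j, Leg F v i := by
  induction j generalizing F F' v with
  | zero =>
    obtain ⟨x, y, hne, hx, hy⟩ := h
    exact ⟨0, le_rfl, x, y, hne, hle hx, hle hy⟩
  | succ j ih =>
    obtain ⟨w, hw, -, hl⟩ := h
    by_cases hy : ∀ y, F.Adj v y → y = w
    · obtain ⟨i, hi, hl⟩ := ih hl (isolate_mono hle)
      exact ⟨i + 1, by omega, w, hle hw, hy, hl⟩
    · push Not at hy
      obtain ⟨y, hy, hne⟩ := hy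
      exact ⟨0, by omega, y, w, hne, hy, hle hw⟩

/-- A leaf beside a vertex of degree at most two takes no part in the first branching, so its
removal keeps the leg. -/
theorem Leg.isolate_leaf {i : ℕ} (h : Leg F v i) (hlv : l ≠ v)
    (hl : ∀ y z, F.Adj l y → F.Adj l z → y = z)
    (hv : F.Adj l v → ∀ x, F.Adj v x → x = l)
    (hy : ∀ y, F.Adj l y → ∀ x₁ x₂ , F.Adj y x₁ → F.Adj y x₂ → x₁ = x₂ ∨ x₁ = l ∨ x₂ = l) :
    Leg (isolate F l) v i := by
  induction i generalizing F v with
  | zero =>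
    obtain ⟨x, y, hne, hx, hy'⟩ := h
    have : ¬ F.Adj l v := fun h => hne ((hv h x hx).trans (hv h y hy').symm)
    refine ⟨x, y, hne, ⟨hx, hlv.symm, ?_⟩, hy', hlv.symm, ?_⟩
    · rintro rfl; exact this hx.symm
    · rintro rfl; exact this hy'.symm
  | succ i ih =>
    obtain ⟨w, hw, hu, hleg⟩ := h
    -- A path that ran into the leaf l would stop there without branching.
    have hwl : l ≠ w := by
      rintro rfl
      have hiso : ∀ y, ¬ (isolate F v).Adj l y := fun y hy =>
        hy.2.2 (hl _ _ hw.symm hy.1).symm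
      cases i with
      | zero => obtain ⟨x, -, -, hx, -⟩ := hleg; exact hiso x hx
      | succ i => obtain ⟨x, hx, -⟩ := hleg; exact hiso x hx
    refine ⟨w, ⟨hw, hlv.symm, hwl.symm⟩, fun y hy => hu y hy.1, ?_⟩
    rw [isolate_comm]
    refine ih hleg hwl (fun y z hy hz => hl y z hy.1 hz.1) (fun h x hx => ?_)
      (fun y hy' x₁ x₂ h₁ h₂ => hy y hy'.1 x₁ x₂ h₁.1 h₂.1)
    rcases hy w h.1 x v hx.1 hw.symm with h | h | h
    · exact absurd h hx.2.2
    · exact h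
    · exact absurd h.symm hlv

section Finite
variable [Finite V]

theorem comp_eq_singleton (h : ∀ y, ¬ F.Adj v y) : comp F v = {v} :=
  Set.Subset.antisymm (comp_subset rfl (by rintro x rfl y hy; exact absurd hy (h y)))
    (by rintro _ rfl; exact mem_comp_self)

theorem comp_eq_insert_side (hw : F.Adj v w) (hu : ∀ y, F.Adj v y → y = w) :
    comp F v = insert v (side F v w) := by
  rw [comp_eq_insert]
  congr 1
  ext x
  simp only [Set.mem_ofPred_eq, Set.mem_iUnion, exists_prop]
  exact ⟨fun ⟨y, hy, hx⟩ => hu y hy ▸ hx, fun h => ⟨w, hw, h⟩⟩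

theorem ncard_comp_of_unique (hw : F.Adj v w) (hu : ∀ y, F.Adj v y → y = w) :
    (comp F v).ncard = (side F v w).ncard + 1 := by
  rw [comp_eq_insert_side hw hu, Set.ncard_insert_of_notMem (not_mem_side hw.ne')]

theorem unique_of_not_leg (h : ¬ Leg F v 0) (hw : F.Adj v w) : ∀ y, F.Adj v y → y = w := by
  intro y hy
  by_contra hne
  exact h ⟨y, w, hne, hy, hw⟩

theorem not_leg_isolate (h : ∀ i, ¬ Leg F v i) (hw : F.Adj v w) :
    ∀ i, ¬ Leg (isolate F v) w i :=
  fun i hi => h (i + 1) ⟨w, hw, unique_of_not_leg (h 0) hw, hi⟩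

theorem nbrs_eq_singleton (hw : F.Adj v w) (hu : ∀ y, F.Adj v y → y = w) : nbrs F v = {w} := by
  ext y
  rw [mem_nbrs, Finset.mem_singleton]
  exact ⟨hu y, fun h => h ▸ hw⟩

theorem kids_of_unique (hw : F.Adj v w) (hu : ∀ y, F.Adj v y → y = w) :
    mkids F m v = {mcls (isolate F v) m w} := by
  rw [mkids, nbrs_eq_singleton hw hu]; simp

theorem kids_of_isolated (h : ∀ y, ¬ F.Adj v y) : mkids F m v = 0 := by
  have : nbrs F v = ∅ := by
    ext y; simp [mem_nbrs, h y]
  rw [mkids, this]; simp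

/-- Without a branching the component is a path with the root at one end, and its size determines
it. -/
theorem cls_eq_of_not_leg (hF : F.IsAcyclic) (hF' : F'.IsAcyclic) (h : ∀ i, ¬ Leg F v i)
    (h' : ∀ i, ¬ Leg F' v' i) (hc : (comp F v).ncard = (comp F' v').ncard) :
    cls F v = cls F' v' := by
  induction hn : (comp F v).ncard using Nat.strong_induction_on generalizing F F' v v' with
  | _ n ih =>
  by_cases hw : ∃ w, F.Adj v w <;> by_cases hw' : ∃ w, F'.Adj v' w
  · obtain ⟨w, hw⟩ := hw
    obtain ⟨w', hw'⟩ := hw'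
    have hu := unique_of_not_leg (h 0) hw
    have hu' := unique_of_not_leg (h' 0) hw'
    have e := ncard_comp_of_unique hw hu
    have e' := ncard_comp_of_unique hw' hu'
    rw [cls_eq_iff_kids hF hF', kids, kids, kids_of_unique hw hu, kids_of_unique hw' hu']
    congr 1
    exact ih _ (by rw [← hn]; exact ncard_side_lt hw) (isAcyclic_isolate hF)
      (isAcyclic_isolate hF') (not_leg_isolate h hw) (not_leg_isolate h' hw')
      (by change (side F v w).ncard = (side F' v' w').ncard; omega) rfl
  · push Not at hw'
    obtain ⟨w, hw⟩ := hw
    have e := ncard_comp_of_unique hw (unique_of_not_leg (h 0) hw)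
    have := ncard_comp_pos (F := isolate F v) (v := w)
    rw [hc, comp_eq_singleton hw', Set.ncard_singleton] at e
    change 0 < (side F v w).ncard at this
    omega
  · push Not at hw
    obtain ⟨w, hw'⟩ := hw'
    have e := ncard_comp_of_unique hw' (unique_of_not_leg (h' 0) hw')
    have := ncard_comp_pos (F := isolate F' v') (v := w)
    rw [← hc, comp_eq_singleton hw, Set.ncard_singleton] at e
    change 0 < (side F' v' w).ncard at this
    omega
  · push Not at hw hw'
    rw [cls_eq_iff_kids hF hF', kids, kids, kids_of_isolated hw, kids_of_isolated hw']

theorem exists_chain_of_not_leg (h : ∀ i, ¬ Leg F v i) :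
    ∃ g : ℕ → V, g 0 = v ∧ Set.BijOn g (Set.Iio (comp F v).ncard) (comp F v) ∧
      ∀ i < (comp F v).ncard, ∀ j < (comp F v).ncard,
        F.Adj (g i) (g j) ↔ i + 1 = j ∨ j + 1 = i := by
  induction hn : (comp F v).ncard generalizing F v with
  | zero => exact absurd hn ncard_comp_pos.ne'
  | succ n ih =>
  by_cases hw : ∃ w, F.Adj v w
  · obtain ⟨w, hw⟩ := hw
    have hu := unique_of_not_leg (h 0) hw
    have e := ncard_comp_of_unique hw hu
    have e' : (comp (isolate F v) w).ncard = n := by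
      change (side F v w).ncard = n; omega
    obtain ⟨g, hg0, hgb, hga⟩ := ih (not_leg_isolate h hw) e'
    have hgv : ∀ i < n, g i ≠ v := fun i hi he => by
      have := hgb.mapsTo hi
      rw [he] at this
      exact not_mem_side hw.ne' this
    have hnpos : 0 < n := e' ▸ ncard_comp_pos
    have hvadj : ∀ j < n, F.Adj v (g j) ↔ j = 0 := by
      intro j hj
      constructor
      · intro hj'
        exact hgb.injOn hj hnpos ((hu _ hj').trans hg0.symm)
      · rintro rfl
        rw [hg0]; exact hw
    refine ⟨fun i => Nat.casesOn i v g, rfl, ⟨?_, ?_, ?_⟩, ?_⟩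
    · rintro (_ | i) hi
      · exact mem_comp_self
      · rw [comp_eq_insert_side hw hu]
        exact Or.inr (hgb.mapsTo (Nat.lt_of_succ_lt_succ hi))
    · rintro (_ | i) hi (_ | j) hj hij
      · rfl
      · exact absurd hij.symm (hgv j (Nat.lt_of_succ_lt_succ hj))
      · exact absurd hij (hgv i (Nat.lt_of_succ_lt_succ hi))
      · rw [hgb.injOn (Nat.lt_of_succ_lt_succ hi) (Nat.lt_of_succ_lt_succ hj) hij]
    · intro x hx
      rw [comp_eq_insert_side hw hu] at hx
      rcases hx with rfl | hx
      · exact ⟨0, Nat.succ_pos _, rfl⟩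
      · obtain ⟨i, hi, rfl⟩ := hgb.surjOn hx
        exact ⟨i + 1, Nat.succ_lt_succ hi, rfl⟩
    · rintro (_ | i) hi (_ | j) hj
      · simp
      · have := hvadj j (by omega)
        refine this.trans ?_; omega
      · have := hvadj i (by omega)
        rw [F.adj_comm]
        refine this.trans ?_; omega
      · have := hga i (by omega) j (by omega)
        rw [isolate_adj] at this
        have h1 := hgv i (by omega)
        have h2 := hgv j (by omega)
        simp only [h1, h2, ne_eq, not_false_eq_true, and_true] at this
        refine this.trans ?_; omega
  · push Not at hw
    have e := comp_eq_singleton hw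
    rw [e, Set.ncard_singleton] at hn
    obtain rfl : n = 0 := by omega
    refine ⟨fun _ => v, rfl, ⟨fun _ _ => mem_comp_self, ?_, ?_⟩, ?_⟩
    · intro i hi j hj _
      simp only [Set.mem_Iio] at hi hj; omega
    · intro x hx
      rw [e] at hx
      exact ⟨0, by simp, hx.symm⟩
    · intro i hi j hj
      refine iff_of_false (fun h => F.irrefl h) (by omega)

/-- A component without a branching on the path leaving the root is a path. -/
theorem exists_leg (h : ¬ ∃ k : ℕ, 1 ≤ k ∧
    Nonempty ((F.connectedComponentMk v).toSimpleGraph ≃g SimpleGraph.pathGraph k)) :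
    ∃ i, Leg F v i := by
  by_contra! hl
  obtain ⟨g, -, hgb, hga⟩ := exists_chain_of_not_leg hl
  have hmem : ∀ x, x ∈ (F.connectedComponentMk v).supp ↔ x ∈ comp F v := by
    intro x
    rw [ConnectedComponent.mem_supp_iff, ConnectedComponent.eq, mem_comp, reachable_comm]
  refine h ⟨(comp F v).ncard, ncard_comp_pos, ⟨RelIso.symm ⟨Equiv.ofBijective (fun i =>
    ⟨g i.1, (hmem _).2 (hgb.mapsTo i.2)⟩) ⟨?_, ?_⟩, ?_⟩⟩⟩
  · intro i j hij
    exact Fin.ext (hgb.injOn i.2 j.2 (congrArg Subtype.val hij))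
  · rintro ⟨x, hx⟩
    obtain ⟨i, hi, rfl⟩ := hgb.surjOn ((hmem x).1 hx)
    exact ⟨⟨i, hi⟩, rfl⟩
  · intro i j
    rw [SimpleGraph.pathGraph_adj]
    exact hga i.1 i.2 j.1 j.2

end Finite

end Leg

/-! ### Attaching a leaf at two vertices of a tree -/

section Leaves

variable {F F' : SimpleGraph V} {m m' : Set V} {l p q r s s' t u v v' w w' x y z : V} {f g : V → V}
  {S : Set V}

/-- A self-map of a finite tree that maps adjacent vertices to adjacent or equal vertices fixes a
vertex or exchanges two adjacent vertices. -/
theorem exists_fixed_or_flipped [Finite V] (hF : F.IsAcyclic)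
    (hg : Set.MapsTo g (comp F v) (comp F v))
    (hadj : ∀ x ∈ comp F v, ∀ y, F.Adj x y → g x = g y ∨ F.Adj (g x) (g y)) :
    (∃ x ∈ comp F v, g x = x) ∨ ∃ x ∈ comp F v, ∃ y, F.Adj x y ∧ g x = y ∧ g y = x := by
  by_contra! hcon
  obtain ⟨hfix, hflip⟩ := hcon
  have hex : ∀ x ∈ comp F v, ∃ y, F.Adj x y ∧ g x ∈ side F x y := by
    intro x hx
    refine exists_adj_of_mem_comp ?_ (hfix x hx)
    rw [comp_eq hx]; exact hg hx
  -- Walk from x towards its image. The sides ahead shrink, so the walk turns back at some edge; the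
  -- images of its ends lie across it in opposite directions, and being equal or adjacent they must
  -- be the ends interchanged.
  have key : ∀ n, ∀ x ∈ comp F v, ∀ y, F.Adj x y → g x ∈ side F x y →
      (side F x y).ncard ≠ n := by
    intro n
    induction n using Nat.strong_induction_on with
    | _ n ih =>
    intro x hx y hxy hgx hn
    have hy := comp_adj hx hxy
    obtain ⟨w, hyw, hgy⟩ := hex y hy
    by_cases hwx : w = x
    · subst hwx
      have hdis := Set.disjoint_left.1 (disjoint_side hF hxy)
      have hgadj : F.Adj (g w) (g y) := (hadj w hx y hxy).resolve_left
        fun h => hdis hgx (h ▸ hgy)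
      have h1 : g w = y := by
        by_contra hne
        exact hdis hgx (comp_adj hgy ⟨hgadj.symm, fun h => not_mem_side hyw.ne' (h ▸ hgy), hne⟩)
      have h2 : g y = w := by
        by_contra hne
        exact hdis (comp_adj hgx ⟨hgadj, fun h => not_mem_side hxy.ne' (h ▸ hgx), hne⟩) hgy
      exact hflip w hx y hxy h1 h2
    · exact ih _ (hn ▸ ncard_side_lt_side hF hxy hyw hwx) y hy w hyw hgy rfl
  obtain ⟨y, hy, hgy⟩ := hex v mem_comp_self
  exact key _ v mem_comp_self y hy hgy rfl

/-- `F` with the edge `st` added. -/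
def addEdge (F : SimpleGraph V) (s t : V) : SimpleGraph V := F ⊔ edge s t

theorem addEdge_adj : (addEdge F s t).Adj x y ↔
    F.Adj x y ∨ (s ≠ t ∧ ((x = s ∧ y = t) ∨ (x = t ∧ y = s))) := by
  rw [addEdge, sup_adj, edge_adj]
  constructor
  · rintro (h | ⟨h | h, hne⟩)
    · exact Or.inl h
    · obtain ⟨rfl, rfl⟩ := h
      exact Or.inr ⟨hne, Or.inl ⟨rfl, rfl⟩⟩
    · obtain ⟨rfl, rfl⟩ := h
      exact Or.inr ⟨hne.symm, Or.inr ⟨rfl, rfl⟩⟩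
  · rintro (h | ⟨hne, h | h⟩)
    · exact Or.inl h
    · obtain ⟨rfl, rfl⟩ := h
      exact Or.inr ⟨Or.inl ⟨rfl, rfl⟩, hne⟩
    · obtain ⟨rfl, rfl⟩ := h
      exact Or.inr ⟨Or.inr ⟨rfl, rfl⟩, hne.symm⟩

theorem addEdge_comm : addEdge F s t = addEdge F t s := by
  rw [addEdge, addEdge, edge_comm]

theorem le_addEdge : F ≤ addEdge F s t := le_sup_left

theorem addEdge_adj_self (h : s ≠ t) : (addEdge F s t).Adj s t :=
  addEdge_adj.2 (Or.inr ⟨h, Or.inl ⟨rfl, rfl⟩⟩)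

theorem isAcyclic_addEdge (hF : F.IsAcyclic) (h : t ∉ comp F s) : (addEdge F s t).IsAcyclic :=
  hF.sup_edge_of_not_reachable h

theorem addEdge_adj_of_ne (hs : x ≠ s) (ht : x ≠ t) : (addEdge F s t).Adj x y ↔ F.Adj x y := by
  rw [addEdge_adj]; simp [hs, ht]

theorem comp_addEdge (hy : t ∈ comp F w) : comp (addEdge F s t) w = comp F w ∪ comp F s := by
  apply Set.Subset.antisymm
  · refine comp_subset (Or.inl mem_comp_self) ?_
    rintro x hx y hxy
    rcases addEdge_adj.1 hxy with h | ⟨hne, ⟨rfl, rfl⟩ | ⟨rfl, rfl⟩⟩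
    · exact hx.imp (fun hx => comp_adj hx h) (fun hx => comp_adj hx h)
    · exact Or.inl hy
    · exact Or.inr mem_comp_self
  · rintro x (hx | hx)
    · exact comp_mono le_addEdge hx
    · by_cases hst : s = t
      · subst hst
        rw [comp_eq hy] at hx
        exact comp_mono le_addEdge hx
      · exact Reachable.trans (Reachable.trans (comp_mono le_addEdge hy)
          (addEdge_adj_self hst).symm.reachable) (comp_mono le_addEdge hx)

theorem addEdge_adj_of_not_mem (hs : s ∉ comp F w) (ht : t ∉ comp F w) (hx : x ∈ comp F w) :
    (addEdge F s t).Adj x y ↔ F.Adj x y :=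
  addEdge_adj_of_ne (fun e => hs (e ▸ hx)) (fun e => ht (e ▸ hx))

theorem comp_addEdge_of_not_mem (hs : s ∉ comp F w) (ht : t ∉ comp F w) :
    comp (addEdge F s t) w = comp F w :=
  comp_congr fun _ hx _ => addEdge_adj_of_not_mem hs ht hx

theorem cls_addEdge_of_not_mem (hs : s ∉ comp F w) (ht : t ∉ comp F w) :
    cls (addEdge F s t) w = cls F w :=
  cls_congr fun _ hx _ => addEdge_adj_of_not_mem hs ht hx

theorem isolate_addEdge (hs : s ≠ p) (ht : t ≠ p) :
    isolate (addEdge F s t) p = addEdge (isolate F p) s t := by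
  ext x y
  simp only [isolate_adj, addEdge_adj]
  constructor
  · tauto
  · rintro (h | ⟨h, ⟨rfl, rfl⟩ | ⟨rfl, rfl⟩⟩) <;> tauto

theorem isolate_addEdge_self : isolate (addEdge F s t) s = isolate F s := by
  ext x y
  simp only [isolate_adj, addEdge_adj]
  constructor
  · rintro ⟨h | ⟨h, ⟨rfl, rfl⟩ | ⟨rfl, rfl⟩⟩, h1, h2⟩ <;> tauto
  · tauto

section Finite
variable [Finite V]

theorem mkids_eq_cons [DecidableEq V] (hu : F.Adj v u) :
    mkids F m v = mcls (isolate F v) m u ::ₘ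
      ((nbrs F v).erase u).val.map fun u => mcls (isolate F v) m u := by
  rw [mkids, ← Multiset.map_cons, Finset.erase_val, Multiset.cons_erase (mem_nbrs.2 hu)]

/-- Marking equivalent vertices in equivalent components: two components that are equivalent both
before and after attaching a leaf at `y` and `z`, respectively, are equivalent with `y` and `z`
marked. -/
theorem mcls_singleton_eq (hF : F.IsAcyclic) (hF' : F'.IsAcyclic)
    (hs : ∀ x, ¬ F.Adj s x) (hs' : ∀ x, ¬ F'.Adj s' x) (hsw : s ≠ w) (hsw' : s' ≠ w')
    (hy : y ∈ comp F w) (hz : z ∈ comp F' w') (h : cls F w = cls F' w')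
    (h' : cls (addEdge F s y) w = cls (addEdge F' s' z) w') :
    mcls F {y} w = mcls F' {z} w' := by
  classical
  induction hn : (comp F w).ncard using Nat.strong_induction_on generalizing F F' w w' with
  | _ n ih =>
  have hsc : s ∉ comp F w := by
    rw [mem_comp_comm, comp_eq_singleton hs]; exact fun h => hsw h.symm
  have hsc' : s' ∉ comp F' w' := by
    rw [mem_comp_comm, comp_eq_singleton hs']; exact fun h => hsw' h.symm
  have hsy : s ≠ y := fun e => hsc (e ▸ hy)
  have hsz : s' ≠ z := fun e => hsc' (e ▸ hz)
  obtain ⟨f, hf⟩ := mcls_eq_iff.1 h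
  obtain ⟨g, hg⟩ := mcls_eq_iff.1 h'
  have hcard := hf.card_nbrs mem_comp_self
  have hcard' := hg.card_nbrs mem_comp_self
  rw [hf.root] at hcard
  rw [hg.root] at hcard'
  have nb : ∀ {F : SimpleGraph V} {s w y : V}, s ≠ w → y ≠ w →
      nbrs (addEdge F s y) w = nbrs F w := by
    intro F s w y h1 h2
    ext x
    rw [mem_nbrs, mem_nbrs, addEdge_adj_of_ne h1.symm h2.symm]
  have nb' : ∀ {F : SimpleGraph V} {s w : V}, s ≠ w → (∀ x, ¬ F.Adj s x) →
      (nbrs (addEdge F s w) w).card = (nbrs F w).card + 1 := by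
    intro F s w h1 h2
    have : nbrs (addEdge F s w) w = insert s (nbrs F w) := by
      ext x
      rw [Finset.mem_insert, mem_nbrs, mem_nbrs, addEdge_adj]
      simp only [h1, h1.symm, true_and, false_and, false_or, ne_eq, not_false_eq_true]
      tauto
    rw [this, Finset.card_insert_of_notMem]
    rw [mem_nbrs]; exact fun h => h2 _ h.symm
  by_cases hyw : y = w
  · by_cases hzw : z = w'
    · subst hyw hzw
      refine (hf.congr_mark fun x hx => ?_).mcls_eq
      rw [Set.mem_singleton_iff, Set.mem_singleton_iff, ← hf.bij.injOn.eq_iff hx mem_comp_self,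
        hf.root]
    · subst hyw
      rw [nb hsw' hzw, nb' hsw hs] at hcard'
      omega
  by_cases hzw : z = w'
  · subst hzw
    rw [nb hsw hyw, nb' hsw' hs'] at hcard'
    omega
  obtain ⟨u, hu, hyu⟩ := exists_adj_of_mem_comp hy hyw
  obtain ⟨u', hu', hzu⟩ := exists_adj_of_mem_comp hz hzw
  have hE := isAcyclic_addEdge hF (s := s) (t := y) (by
    rw [comp_eq_singleton hs]; exact fun h => hsy (Eq.symm h))
  have hE' := isAcyclic_addEdge hF' (s := s') (t := z) (by
    rw [comp_eq_singleton hs']; exact fun h => hsz (Eq.symm h))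
  -- the split of the children into the one containing the leaf and the others
  have split : ∀ {F : SimpleGraph V} {s w y u : V}, F.IsAcyclic → (∀ x, ¬ F.Adj s x) → s ≠ w →
      s ∉ comp F w → y ≠ w → F.Adj w u → y ∈ side F w u →
      kids (addEdge F s y) w = cls (addEdge (isolate F w) s y) u ::ₘ
        ((nbrs F w).erase u).val.map (fun u => cls (isolate F w) u) ∧
      mkids F {y} w = mcls (isolate F w) {y} u ::ₘ
        ((nbrs F w).erase u).val.map (fun u => cls (isolate F w) u) ∧
      (comp (addEdge (isolate F w) s y) u).ncard = (comp (isolate F w) u).ncard + 1 := by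
    intro F s w y u hF hs hsw hsc hyw hu hyu
    have hmem : ∀ x ∈ ((nbrs F w).erase u).val, s ∉ comp (isolate F w) x ∧
        y ∉ comp (isolate F w) x := by
      intro x hx
      have hx := Finset.mem_erase.1 (show x ∈ Finset.erase _ _ from hx)
      have hwx := mem_nbrs.1 hx.2
      refine ⟨fun h => hsc (side_subset_comp hwx h), fun h => ?_⟩
      exact Set.disjoint_left.1 (disjoint_side_side hF hu hwx hx.1.symm) hyu h
    refine ⟨?_, ?_, ?_⟩
    · rw [kids, mkids_eq_cons (u := u) (le_addEdge hu), isolate_addEdge hsw hyw, nb hsw hyw]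
      congr 1
      refine Multiset.map_congr rfl fun x hx => ?_
      exact cls_addEdge_of_not_mem (hmem x hx).1 (hmem x hx).2
    · rw [mkids_eq_cons hu]
      congr 1
      refine Multiset.map_congr rfl fun x hx => ?_
      refine mcls_congr (fun _ _ _ => Iff.rfl) fun v hv => ?_
      simp only [Set.mem_singleton_iff, Set.mem_empty_iff_false, iff_false]
      rintro rfl
      exact (hmem x hx).2 hv
    · rw [comp_addEdge hyu, comp_eq_singleton (F := isolate F w) (fun x h => hs x h.1),
        Set.union_singleton, Set.ncard_insert_of_notMem]
      exact fun h => hsc (side_subset_comp hu h)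
  obtain ⟨k1, k2, k3⟩ := split hF hs hsw hsc hyw hu hyu
  obtain ⟨k1', k2', k3'⟩ := split hF' hs' hsw' hsc' hzw hu' hzu
  have e1 := mkids_eq_of_mcls_eq h'
  rw [show mkids (addEdge F s y) ∅ w = _ from k1, show mkids (addEdge F' s' z) ∅ w' = _ from k1']
    at e1
  have e2 := mkids_eq_of_mcls_eq h
  rw [mkids_eq_cons hu, mkids_eq_cons hu'] at e2
  -- Add the equation after the attachment crosswise to the one before it and cancel all other
  -- branches. Only the branches at u and u' remain, with and without the leaf; their sizes then
  -- decide which equals which.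
  have e3 : cls (addEdge (isolate F w) s y) u ::ₘ cls (isolate F' w') u' ::ₘ 0 =
      cls (addEdge (isolate F' w') s' z) u' ::ₘ cls (isolate F w) u ::ₘ 0 := by
    have := congrArg₂ (· + ·) e1 e2.symm
    simp only [← Multiset.singleton_add] at this ⊢
    apply add_right_cancel (b := Multiset.map (fun u => cls (isolate F w) u)
      ((nbrs F w).erase u).val + Multiset.map (fun u => cls (isolate F' w') u)
      ((nbrs F' w').erase u').val)
    calc _ = _ := by abel
      _ = _ := this
      _ = _ := by abel
  have m1 : cls (addEdge (isolate F w) s y) u = cls (addEdge (isolate F' w') s' z) u' := by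
    have := e3 ▸ Multiset.mem_cons_self (cls (addEdge (isolate F w) s y) u) _
    simp only [Multiset.mem_cons, Multiset.notMem_zero, or_false] at this
    refine this.resolve_right fun e => ?_
    have := ncard_eq_of_mcls_eq e
    omega
  have m2 : cls (isolate F w) u = cls (isolate F' w') u' := by
    have : cls (isolate F' w') u' ∈ cls (addEdge (isolate F w) s y) u ::ₘ
      cls (isolate F' w') u' ::ₘ 0 := by simp
    rw [e3] at this
    simp only [Multiset.mem_cons, Multiset.notMem_zero, or_false] at this
    refine (this.resolve_left fun e => ?_).symm
    have := ncard_eq_of_mcls_eq e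
    omega
  have m3 := ih _ (hn ▸ ncard_side_lt hu) (isAcyclic_isolate hF) (isAcyclic_isolate hF')
    (fun x h => hs x h.1) (fun x h => hs' x h.1) (fun e => hsc (e ▸ mem_comp_of_adj hu))
    (fun e => hsc' (e ▸ mem_comp_of_adj hu')) hyu hzu m2 m1 rfl
  apply mcls_eq_of_mkids_eq hF hF'
  · simp only [Set.mem_singleton_iff]
    exact iff_of_false (Ne.symm hzw) (Ne.symm hyw)
  · rw [show mcls (isolate F w) ∅ u = mcls (isolate F' w') ∅ u' from m2,
      Multiset.cons_inj_right] at e2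
    rw [k2, k2', m3, e2]

/-- A branching reached after at least one step has the incoming edge besides two outgoing ones. -/
theorem exists_three_of_leg {i : ℕ} (h : Leg F v (i + 1)) : ∃ x ∈ comp F v, ∃ y₁ y₂ y₃,
    F.Adj x y₁ ∧ F.Adj x y₂ ∧ F.Adj x y₃ ∧ y₁ ≠ y₂ ∧ y₁ ≠ y₃ ∧ y₂ ≠ y₃ := by
  induction i generalizing F v with
  | zero =>
    obtain ⟨w, hw, -, x, y, hne, hx, hy⟩ := h
    exact ⟨w, mem_comp_of_adj hw, v, x, y, hw.symm, hx.1, hy.1, hx.2.2.symm, hy.2.2.symm, hne⟩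
  | succ i ih =>
    obtain ⟨w, hw, -, hl⟩ := h
    obtain ⟨x, hx, y₁, y₂, y₃, h₁, h₂, h₃, hne⟩ := ih hl
    exact ⟨x, side_subset_comp hw hx, y₁, y₂, y₃, h₁.1, h₂.1, h₃.1, hne⟩

theorem eq_of_not_leg {y₁ y₂ y₃ : V} (h : ∀ i, ¬ Leg F v i) (hx : x ∈ comp F v)
    (h₁ : F.Adj x y₁) (h₂ : F.Adj x y₂) (h₃ : F.Adj x y₃) : y₁ = y₂ ∨ y₁ = y₃ ∨ y₂ = y₃ := by
  obtain ⟨g, -, hgb, hga⟩ := exists_chain_of_not_leg h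
  obtain ⟨i, hi, rfl⟩ := hgb.surjOn hx
  obtain ⟨j₁, hj₁, rfl⟩ := hgb.surjOn (comp_adj hx h₁)
  obtain ⟨j₂, hj₂, rfl⟩ := hgb.surjOn (comp_adj hx h₂)
  obtain ⟨j₃, hj₃, rfl⟩ := hgb.surjOn (comp_adj hx h₃)
  rw [hga i hi _ hj₁] at h₁
  rw [hga i hi _ hj₂] at h₂
  rw [hga i hi _ hj₃] at h₃
  rw [hgb.injOn.eq_iff hj₁ hj₂, hgb.injOn.eq_iff hj₁ hj₃, hgb.injOn.eq_iff hj₂ hj₃]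
  omega

theorem cls_eq_of_mcls_singleton_eq (h : mcls F {y} w = mcls F' {z} w') (hy : y ∈ comp F w) :
    cls F y = cls F' z := by
  obtain ⟨f, hf⟩ := mcls_eq_iff.1 h
  have : f y = z := (hf.mark y hy).2 rfl
  rw [← this]
  exact ((hf.reroot hy).congr_mark (n := ∅) (n' := ∅) (fun _ _ => Iff.rfl)).mcls_eq

/-- Splitting the component at the edge `ww'`. -/
theorem mcls_eq_of_split (hF : F.IsAcyclic) (hF' : F'.IsAcyclic) (hw : F.Adj w v)
    (hw' : F'.Adj w' v') (h : mcls (isolate F v) m w = mcls (isolate F' v') m' w')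
    (h' : mcls (isolate F w) m v = mcls (isolate F' w') m' v') : mcls F m w = mcls F' m' w' := by
  classical
  have key : ∀ {F : SimpleGraph V} {m : Set V} {v w : V}, F.IsAcyclic → F.Adj w v →
      mkids F m w = mcls (isolate F w) m v ::ₘ mkids (isolate F v) m w := by
    intro F m v w hF hw
    rw [mkids_eq_cons hw, mkids]
    congr 1
    have : nbrs (isolate F v) w = (nbrs F w).erase v := by
      ext x
      rw [mem_nbrs, Finset.mem_erase, mem_nbrs, isolate_adj]
      exact ⟨fun h => ⟨h.2.2, h.1⟩, fun h => ⟨h.2, hw.ne, h.1⟩⟩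
    rw [this]
    refine Multiset.map_congr rfl fun x hx => ?_
    have hx := Finset.mem_erase.1 (show x ∈ Finset.erase _ _ from hx)
    have hwx := mem_nbrs.1 hx.2
    rw [isolate_comm]
    exact (mcls_isolate fun h => hx.1 (eq_of_reachable_isolate hF hwx hw h)).symm
  refine mcls_eq_of_mkids_eq hF hF' (mem_iff_of_mcls_eq h) ?_
  rw [key hF hw, key hF' hw', h', mkids_eq_of_mcls_eq h]

/-- The isomorphism interchanges the halves W and W' of the tree at the edge ww', where z is in W.
If y is in W too, then W with a leaf at z and W with a leaf at y are both copies of W'. If y is in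
W', then W ≅ W' both without leaves and with leaves at z and y. In either case `mcls_singleton_eq`
matches the marked halves and `mcls_eq_of_split` glues. -/
theorem cls_eq_of_flipped (hF : F.IsAcyclic) (hs : ∀ x, ¬ F.Adj s x) (hw : F.Adj w w')
    (hz : z ∈ side F w' w) (hy : y ∈ comp F w) (hsw : s ∉ comp F w)
    (h : cls (isolate (addEdge F s z) w') w = cls (isolate (addEdge F s y) w) w')
    (h' : cls (isolate (addEdge F s z) w) w' = cls (isolate (addEdge F s y) w') w) :
    cls F z = cls F y := by
  have hdis := Set.disjoint_left.1 (disjoint_side hF hw)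
  have hne : ∀ {x}, x ∈ comp F w → s ≠ x := fun hx e => hsw (e ▸ hx)
  have hw'c := mem_comp_of_adj hw
  have hsub1 : side F w' w ⊆ comp F w := comp_mono isolate_le
  have hsub2 : side F w w' ⊆ comp F w := side_subset_comp hw
  have hzw' : z ≠ w' := fun e => not_mem_side hw.ne (e ▸ hz)
  have hiso : ∀ p x, ¬ (isolate F p).Adj s x := fun p x h => hs x h.1
  rw [isolate_addEdge (hne hw'c) hzw'] at h
  have hleft : ∀ t ∈ side F w' w, cls (isolate (addEdge F s t) w) w' = cls (isolate F w) w' := by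
    intro t ht
    by_cases htw : t = w
    · subst htw; rw [addEdge_comm, isolate_addEdge_self]
    · rw [isolate_addEdge (hne mem_comp_self) htw]
      exact cls_addEdge_of_not_mem (fun h => hsw (hsub2 h)) fun h => hdis h ht
  have hright : ∀ t ∈ side F w w', cls (isolate (addEdge F s t) w') w = cls (isolate F w') w := by
    intro t ht
    by_cases htw : t = w'
    · subst htw; rw [addEdge_comm, isolate_addEdge_self]
    · rw [isolate_addEdge (hne hw'c) htw]
      exact cls_addEdge_of_not_mem (fun h => hsw (hsub1 h)) fun h => hdis ht h
  have hunmark : ∀ {t p q}, t ∉ side F p q → mcls (isolate F p) {t} q = cls (isolate F p) q := by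
    intro t p q ht
    refine mcls_congr (fun _ _ _ => Iff.rfl) fun v hv => ?_
    simp only [Set.mem_singleton_iff, Set.mem_empty_iff_false, iff_false]
    rintro rfl
    exact ht hv
  rw [hleft z hz] at h'
  rw [comp_eq_union hw] at hy
  rcases hy with hy | hy
  · have hyw' : y ≠ w' := fun e => not_mem_side hw.ne (e ▸ hy)
    rw [isolate_addEdge (hne hw'c) hyw'] at h'
    rw [hleft y hy] at h
    have h1 := mcls_singleton_eq (isAcyclic_isolate hF) (isAcyclic_isolate hF) (hiso w') (hiso w')
      (hne mem_comp_self) (hne mem_comp_self) hz hy rfl (h.trans h')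
    refine cls_eq_of_mcls_singleton_eq (mcls_eq_of_split hF hF hw hw h1 ?_) (hsub1 hz)
    rw [hunmark fun h => hdis h hz, hunmark fun h => hdis h hy]
  · have hyw : y ≠ w := fun e => not_mem_side hw.ne' (e ▸ hy)
    rw [isolate_addEdge (hne mem_comp_self) hyw] at h
    rw [hright y hy] at h'
    have h1 := mcls_singleton_eq (isAcyclic_isolate hF) (isAcyclic_isolate hF) (hiso w') (hiso w)
      (hne mem_comp_self) (hne hw'c) hz hy h'.symm h
    refine cls_eq_of_mcls_singleton_eq (mcls_eq_of_split hF hF hw hw.symm h1 ?_) (hsub1 hz)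
    rw [hunmark fun h => hdis h hz, hunmark fun h => hdis hy h]
    exact h'

/-- Attaching a leaf `s` at two vertices `y`, `z` of a tree gives isomorphic trees only if `y` and
`z` are equivalent in the tree, provided that the root `s` is mapped to a vertex of the tree. -/
theorem cls_eq_of_cls_addEdge_eq (hF : F.IsAcyclic) (hs : ∀ x, ¬ F.Adj s x) (hys : y ≠ s)
    (hz : z ∈ comp F y) (hr : r ∈ comp (addEdge F s y) s)
    (h : cls (addEdge F s z) s = cls (addEdge F s y) r) : cls F z = cls F y := by
  have hsc : s ∉ comp F y := by
    rw [mem_comp_comm, comp_eq_singleton hs]; exact fun h => hys h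
  have hzs : z ≠ s := fun e => hsc (e ▸ hz)
  have hcomp : ∀ t ∈ comp F y, comp (addEdge F s t) s = insert s (comp F y) := by
    intro t ht
    rw [addEdge_comm, comp_addEdge mem_comp_self, comp_eq_singleton hs, comp_eq ht,
      Set.singleton_union]
  obtain ⟨f, hf⟩ := mcls_eq_iff.1 h
  have hb := hf.bij
  rw [comp_eq hr, hcomp z hz, hcomp y mem_comp_self] at hb
  have hfadj := hf.adj
  rw [hcomp z hz] at hfadj
  have hsadj : ∀ x, (addEdge F s y).Adj s x ↔ x = y := by
    intro x
    rw [addEdge_adj]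
    simp only [hs x, false_or, true_and, hys.symm, ne_eq, not_false_eq_true, false_and, or_false]
  -- If y goes to s, the tree is a path with end y: a branching i steps from y would be i + 1 steps
  -- from s in F + sy, whereas F + sz has one at most i steps from y. Then F + sz is a path as well,
  -- so z is also an end of F.
  by_cases hfy : f y = s
  · have hy1 : y ∈ comp (addEdge F s z) s := by rw [hcomp z hz]; exact Or.inr mem_comp_self
    have hc : cls (addEdge F s z) y = cls (addEdge F s y) s := by
      have := (hf.reroot hy1).mcls_eq
      rwa [hfy] at this
    have hstep : ∀ i, Leg F y i → Leg (addEdge F s y) s (i + 1) := by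
      intro i hi
      refine ⟨y, (hsadj y).2 rfl, fun x hx => (hsadj x).1 hx, ?_⟩
      rw [isolate_addEdge_self]
      exact hi.of_mcls_eq (cls_isolate hsc).symm
    have hno : ∀ i, ¬ Leg F y i := by
      intro i hi
      obtain ⟨j, hj, hl⟩ := hi.exists_of_le (F := addEdge F s z) le_addEdge
      have := hl.unique ((hstep i hi).of_mcls_eq hc.symm)
      omega
    have hno' : ∀ i, ¬ Leg (addEdge F s z) y i := by
      intro i hi
      have := hi.of_mcls_eq hc
      cases i with
      | zero =>
        obtain ⟨x, x', hne, hx, hx'⟩ := this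
        rw [hsadj] at hx hx'
        exact hne (hx.trans hx'.symm)
      | succ i =>
        obtain ⟨x, hx, -, hl⟩ := this
        rw [hsadj] at hx
        subst hx
        rw [isolate_addEdge_self] at hl
        exact hno i (hl.of_mcls_eq (cls_isolate hsc))
    refine cls_eq_of_not_leg hF hF (fun i hi => ?_) hno (by rw [comp_eq hz])
    have hl : Leg (addEdge F s z) s (i + 1) := by
      refine ⟨z, addEdge_adj_self hzs.symm, fun x hx => ?_, ?_⟩
      · rw [addEdge_adj] at hx
        simpa only [hs x, false_or, true_and, hzs.symm, ne_eq, not_false_eq_true, false_and,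
          or_false] using hx
      · rw [isolate_addEdge_self]
        refine hi.of_mcls_eq (cls_isolate ?_).symm
        rwa [comp_eq hz]
    obtain ⟨x, hx, y₁, y₂, y₃, h₁, h₂, h₃, n₁, n₂, n₃⟩ := exists_three_of_leg hl
    rw [← comp_eq hy1] at hx
    rcases eq_of_not_leg hno' hx h₁ h₂ h₃ with h | h | h <;> contradiction
  classical
  -- Retracting s to y, its only neighbour in F + sy, turns f into a self-map of F under which
  -- adjacent vertices stay adjacent or coincide.
  let g : V → V := fun w => if f w = s then y else f w
  have hmaps : Set.MapsTo g (comp F y) (comp F y) := by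
    intro x hx
    by_cases hfx : f x = s
    · simp only [g, if_pos hfx]; exact mem_comp_self
    · simp only [g, if_neg hfx]
      exact (hb.mapsTo (Or.inr hx)).resolve_left hfx
  have hstep : ∀ x ∈ comp F y, ∀ x', F.Adj x x' → g x = g x' ∨ F.Adj (g x) (g x') := by
    intro x hx x' hxx'
    have hx' := comp_adj hx hxx'
    have hadj := (hfadj x (Or.inr hx) x' (Or.inr hx')).2 (le_addEdge hxx')
    by_cases hfx : f x = s
    · rw [hfx, hsadj] at hadj
      have : f x' ≠ s := by rw [hadj]; exact hys
      left
      simp only [g, if_pos hfx, if_neg this, hadj]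
    · by_cases hfx' : f x' = s
      · rw [hfx', (addEdge F s y).adj_comm, hsadj] at hadj
        left
        simp only [g, if_pos hfx', if_neg hfx, hadj]
      · right
        simp only [g, if_neg hfx, if_neg hfx']
        refine (addEdge_adj.1 hadj).resolve_right ?_
        rintro ⟨-, ⟨h, -⟩ | ⟨-, h⟩⟩
        · exact hfx h
        · exact hfx' h
  have hfix : ∀ x ∈ comp F y, f x ≠ s → g x = f x := fun x _ h => by simp only [g, if_neg h]
  have hmemE : ∀ x ∈ comp F y, x ∈ comp (addEdge F s z) s := fun x hx => by
    rw [hcomp z hz]; exact Or.inr hx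
  rcases exists_fixed_or_flipped hF hmaps hstep with ⟨x, hx, hgx⟩ | ⟨x, hx, x', hxx', hgx, hgx'⟩
  · have hfx : f x = x := by
      by_cases hfx : f x = s
      · simp only [g, if_pos hfx] at hgx
        exact absurd (hgx ▸ hfx) hfy
      · rwa [hfix x hx hfx] at hgx
    have h1 := (hf.reroot (hmemE x hx)).mcls_eq
    rw [hfx] at h1
    have hsx : s ≠ x := fun e => hsc (e ▸ hx)
    have h2 := mcls_singleton_eq hF hF hs hs hsx hsx (by rwa [comp_eq hx])
      (by rw [comp_eq hx]; exact mem_comp_self) rfl h1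
    exact cls_eq_of_mcls_singleton_eq h2 (by rwa [comp_eq hx])
  · have hx' := comp_adj hx hxx'
    have hadj := (hfadj x (Or.inr hx) x' (Or.inr hx')).2 (le_addEdge hxx')
    have hfx : f x ≠ s := by
      intro hfx
      simp only [g, if_pos hfx] at hgx
      subst hgx
      rw [hfix _ hx' hfy] at hgx'
      rw [hfx, hsadj, hgx'] at hadj
      exact hxx'.ne hadj
    have hfx' : f x' ≠ s := by
      intro hfx'
      simp only [g, if_pos hfx'] at hgx'
      subst hgx'
      rw [hfix _ hx hfx] at hgx
      rw [hfx', (addEdge F s y).adj_comm, hsadj, hgx] at hadj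
      exact hxx'.ne hadj.symm
    rw [hfix x hx hfx] at hgx
    rw [hfix x' hx' hfx'] at hgx'
    have h1 := (hf.isolate (hmemE x' hx') (hmemE x hx)).mcls_eq
    have h2 := (hf.isolate (hmemE x hx) (hmemE x' hx')).mcls_eq
    rw [hgx, hgx'] at h1 h2
    have hzx : z ∈ comp F x := by rwa [comp_eq hx]
    have hyx : y ∈ comp F x := by rw [comp_eq hx]; exact mem_comp_self
    have hsx : s ∉ comp F x := by rwa [comp_eq hx]
    rw [comp_eq_union hxx'] at hzx
    rcases hzx with hzx | hzx
    · exact cls_eq_of_flipped hF hs hxx' hzx hyx hsx h1 h2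
    · refine cls_eq_of_flipped hF hs hxx'.symm hzx ?_ ?_ h2 h1
      · rwa [comp_eq (mem_comp_of_adj hxx')]
      · rwa [comp_eq (mem_comp_of_adj hxx')]

end Finite

end Leaves

/-! ### Edge-cards and the lower bound -/

section Cards

variable {F F' T X : SimpleGraph V} {m m' : Set V} {a b c d l p q r s s' t u v v' w w' x y z : V}

theorem edgeCard_adj : (edgeCard T s(p, q)).Adj x y ↔ T.Adj x y ∧ s(x, y) ≠ s(p, q) := by
  rw [edgeCard, deleteEdges_adj, Set.mem_singleton_iff]

theorem edgeCard_adj_iff : (edgeCard T s(p, q)).Adj x y ↔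
    T.Adj x y ∧ ¬ (x = p ∧ y = q) ∧ ¬ (x = q ∧ y = p) := by
  rw [edgeCard_adj, Ne, Sym2.eq_iff, not_or]

theorem edgeCard_le {e : Sym2 V} : edgeCard T e ≤ T := deleteEdges_le _

theorem edgeCard_addEdge (hne : s ≠ t) (h : ¬ F.Adj s t) : edgeCard (addEdge F s t) s(s, t) = F := by
  ext x y
  rw [edgeCard_adj_iff, addEdge_adj]
  constructor
  · tauto
  · intro hxy
    refine ⟨Or.inl hxy, ?_, ?_⟩
    · rintro ⟨rfl, rfl⟩; exact h hxy
    · rintro ⟨rfl, rfl⟩; exact h hxy.symm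

theorem addEdge_edgeCard (h : T.Adj s t) : addEdge (edgeCard T s(s, t)) s t = T := by
  ext x y
  rw [addEdge_adj, edgeCard_adj_iff]
  constructor
  · rintro (h' | ⟨-, ⟨rfl, rfl⟩ | ⟨rfl, rfl⟩⟩)
    · exact h'.1
    · exact h
    · exact h.symm
  · have := h.ne
    tauto

theorem edgeCard_adj_isolate (hT : T.IsAcyclic) (h : T.Adj p q) (hx : x ∈ comp (isolate T q) p) :
    (edgeCard T s(p, q)).Adj x y ↔ (isolate T q).Adj x y := by
  rw [edgeCard_adj_iff, isolate_adj]
  have hxq : x ≠ q := fun e => not_mem_side h.ne (e ▸ hx)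
  constructor
  · rintro ⟨h1, h2, h3⟩
    refine ⟨h1, hxq, ?_⟩
    rintro rfl
    exact h2 ⟨(eq_of_reachable_isolate hT h.symm h1.symm hx).symm, rfl⟩
  · rintro ⟨h1, h2, h3⟩
    exact ⟨h1, fun e => h3 e.2, fun e => h2 e.1⟩

theorem comp_edgeCard (hT : T.IsAcyclic) (h : T.Adj p q) :
    comp (edgeCard T s(p, q)) p = side T q p :=
  comp_congr fun _ hx _ => edgeCard_adj_isolate hT h hx

theorem cls_edgeCard (hT : T.IsAcyclic) (h : T.Adj p q) :
    cls (edgeCard T s(p, q)) p = cls (isolate T q) p :=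
  cls_congr fun _ hx _ => edgeCard_adj_isolate hT h hx

theorem comp_edgeCard' (hT : T.IsAcyclic) (h : T.Adj p q) :
    comp (edgeCard T s(p, q)) q = side T p q := by
  rw [Sym2.eq_swap]; exact comp_edgeCard hT h.symm

theorem cls_edgeCard' (hT : T.IsAcyclic) (h : T.Adj p q) :
    cls (edgeCard T s(p, q)) q = cls (isolate T p) q := by
  rw [Sym2.eq_swap]; exact cls_edgeCard hT h.symm

theorem isAcyclic_edgeCard {e : Sym2 V} (hT : T.IsAcyclic) : (edgeCard T e).IsAcyclic :=
  hT.anti edgeCard_le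

theorem not_reconstructs_empty [Finite V] (h : T.Adj p q) : ¬ Reconstructs T ∅ := by
  rintro ⟨-, hr⟩
  obtain ⟨φ⟩ := hr V ⊥ ⟨fun e => (Finset.notMem_empty _ e.2).elim,
    fun e => (Finset.notMem_empty _ e.2).elim, fun e => (Finset.notMem_empty _ e.2).elim⟩
  have : (⊥ : SimpleGraph V).Adj (φ.symm p) (φ.symm q) := φ.symm.map_adj_iff.2 h
  exact this

/-- Two of the three edges at x survive the deletion of e. Joining their other ends creates a
triangle inside one component of T - e, so the result has the card T - e but is disconnected. -/
theorem not_reconstructs_singleton [Finite V] (hT : T.IsTree) {y₁ y₂ y₃ : V} (h₁ : T.Adj x y₁)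
    (h₂ : T.Adj x y₂) (h₃ : T.Adj x y₃) (h₁₂ : y₁ ≠ y₂) (h₁₃ : y₁ ≠ y₃) (h₂₃ : y₂ ≠ y₃)
    (e : Sym2 V) : ¬ Reconstructs T {e} := by
  rintro ⟨he, hr⟩
  replace he := he e (by simp)
  induction e using Sym2.ind with | _ p q
  rw [mem_edgeSet] at he
  obtain ⟨z₁, z₂, hne, hz₁, hz₂⟩ : ∃ z₁ z₂, z₁ ≠ z₂ ∧ (edgeCard T s(p, q)).Adj x z₁ ∧
      (edgeCard T s(p, q)).Adj x z₂ := by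
    have inj : ∀ {y y'}, s(x, y) = s(p, q) → s(x, y') = s(p, q) → y = y' := by
      intro y y' h h'
      have := h.trans h'.symm
      rwa [Sym2.congr_right] at this
    simp only [edgeCard_adj]
    by_cases e₁ : s(x, y₁) = s(p, q)
    · exact ⟨y₂, y₃, h₂₃, ⟨h₂, fun e₂ => h₁₂ (inj e₁ e₂)⟩, ⟨h₃, fun e₂ => h₁₃ (inj e₁ e₂)⟩⟩
    · by_cases e₂ : s(x, y₂) = s(p, q)
      · exact ⟨y₁, y₃, h₁₃, ⟨h₁, e₁⟩, ⟨h₃, fun e₃ => h₂₃ (inj e₂ e₃)⟩⟩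
      · exact ⟨y₁, y₂, h₁₂, ⟨h₁, e₁⟩, ⟨h₂, e₂⟩⟩
  set F := edgeCard T s(p, q) with hF
  have hnadj : ¬ F.Adj z₁ z₂ := by
    intro h
    exact hne (eq_of_reachable_isolate (isAcyclic_edgeCard hT.isAcyclic) hz₁ hz₂
      (mem_comp_of_adj (F := isolate F x) ⟨h, hz₁.ne', hz₂.ne'⟩))
  obtain ⟨φ⟩ := hr V (addEdge F z₁ z₂) ⟨fun _ => s(z₁, z₂), fun e e' _ => Subtype.ext (by
    have h1 := e.2; have h2 := e'.2
    simp only [Finset.mem_singleton] at h1 h2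
    rw [h1, h2]), fun e => ⟨addEdge_adj_self hne, ⟨by
      have h1 := e.2
      simp only [Finset.mem_singleton] at h1
      rw [h1, edgeCard_addEdge hne hnadj]⟩⟩⟩
  have hconn : (addEdge F z₁ z₂).Reachable p q := by
    have := hT.connected.preconnected (φ p) (φ q)
    exact φ.reachable_iff.1 this
  have hsame : comp (addEdge F z₁ z₂) p = comp F p := by
    have hz : z₁ ∈ comp F x := mem_comp_of_adj hz₁
    have hz' : z₂ ∈ comp F x := mem_comp_of_adj hz₂
    by_cases hx : x ∈ comp F p
    · rw [comp_addEdge (comp_adj hx hz₂), comp_eq (comp_adj hx hz₁), Set.union_self]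
    · refine comp_addEdge_of_not_mem (fun h => hx ?_) (fun h => hx ?_)
      · exact comp_adj h hz₁.symm
      · exact comp_adj h hz₂.symm
  have hq : q ∈ comp F p := hsame ▸ hconn
  rw [hF, comp_edgeCard hT.isAcyclic he] at hq
  exact not_mem_side he.ne hq

/-- To show that two cards determine `T`, it suffices to treat the graphs on the vertices of `T`
that have the first card itself as a card. -/
theorem reconstructs_pair [DecidableEq V] {e e' : Sym2 V} (he : e ∈ T.edgeSet)
    (he' : e' ∈ T.edgeSet) (hne : e ≠ e')
    (h : ∀ u v : V, ∀ f ∈ T.edgeSet, f ≠ e → u ≠ v → ¬ (edgeCard T e).Adj u v →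
      Nonempty (edgeCard (addEdge (edgeCard T e) u v) f ≃g edgeCard T e') →
      Nonempty (addEdge (edgeCard T e) u v ≃g T)) :
    Reconstructs T {e, e'} := by
  refine ⟨by simp [he, he'], ?_⟩
  rintro W _ X ⟨f, hf, hX⟩
  obtain ⟨h1, ⟨ψ⟩⟩ := hX ⟨e, by simp⟩
  obtain ⟨h2, ⟨φ⟩⟩ := hX ⟨e', by simp⟩
  have hff : f ⟨e, by simp⟩ ≠ f ⟨e', by simp⟩ := fun h => hne (congrArg Subtype.val (hf h))
  revert h1 ψ h2 φ hff
  generalize f ⟨e, _⟩ = g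
  generalize f ⟨e', _⟩ = g'
  intro h1 ψ' h2 φ hff
  induction g using Sym2.ind with | _ g₁ g₂
  rw [mem_edgeSet] at h1
  -- Renaming the vertices of X along the isomorphism of the first card turns X into (T - e) + uv on
  -- the vertices of T.
  obtain ⟨ψ, hψ⟩ : ∃ ψ : V ≃ W, ∀ x y, (edgeCard X s(g₁, g₂)).Adj (ψ x) (ψ y) ↔
      (edgeCard T e).Adj x y :=
    ⟨ψ'.toEquiv, fun x y => ψ'.map_adj_iff⟩
  clear ψ'
  obtain ⟨u, rfl⟩ := ψ.surjective g₁
  obtain ⟨v, rfl⟩ := ψ.surjective g₂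
  have huv : u ≠ v := fun e => h1.ne (congrArg ψ e)
  have hadj : ∀ x y, X.Adj (ψ x) (ψ y) ↔ (addEdge (edgeCard T e) u v).Adj x y := by
    intro x y
    rw [addEdge_adj, ← hψ, edgeCard_adj_iff, ψ.injective.eq_iff, ψ.injective.eq_iff,
      ψ.injective.eq_iff, ψ.injective.eq_iff]
    constructor
    · tauto
    · rintro (h | ⟨-, ⟨rfl, rfl⟩ | ⟨rfl, rfl⟩⟩)
      · exact h.1
      · exact h1
      · exact h1.symm
  have hnadj : ¬ (edgeCard T e).Adj u v := by
    rw [← hψ, edgeCard_adj_iff]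
    simp
  induction g' using Sym2.ind with | _ g₁ g₂
  rw [mem_edgeSet] at h2
  obtain ⟨f₁, rfl⟩ := ψ.surjective g₁
  obtain ⟨f₂, rfl⟩ := ψ.surjective g₂
  have hff' : s(u, v) ≠ s(f₁, f₂) := by
    intro h
    apply hff
    rw [← Sym2.map_mk, h, Sym2.map_mk]
  have hcard : (edgeCard T e).Adj f₁ f₂ := by
    rw [hadj, addEdge_adj] at h2
    refine h2.resolve_right ?_
    rintro ⟨-, ⟨rfl, rfl⟩ | ⟨rfl, rfl⟩⟩
    · exact hff' rfl
    · exact hff' Sym2.eq_swap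
  obtain ⟨χ⟩ := h u v s(f₁, f₂) (edgeCard_le hcard) (by
    rintro rfl
    rw [edgeCard_adj] at hcard
    exact hcard.2 rfl) huv hnadj ⟨by
      refine RelIso.trans ⟨ψ, ?_⟩ φ.symm
      intro x y
      rw [edgeCard_adj_iff, edgeCard_adj_iff, hadj, ψ.injective.eq_iff, ψ.injective.eq_iff,
        ψ.injective.eq_iff, ψ.injective.eq_iff]⟩
  exact ⟨RelIso.trans (RelIso.symm ⟨ψ, fun {x y} => hadj x y⟩) χ⟩

theorem ern_eq_two [Finite V] (hT : T.IsTree) {y₁ y₂ y₃ : V} (h₁ : T.Adj x y₁)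
    (h₂ : T.Adj x y₂) (h₃ : T.Adj x y₃) (h₁₂ : y₁ ≠ y₂) (h₁₃ : y₁ ≠ y₃) (h₂₃ : y₂ ≠ y₃)
    (h : ∃ S : Finset (Sym2 V), S.card = 2 ∧ Reconstructs T S) : ern T = 2 := by
  have hle : ern T ≤ 2 := Nat.sInf_le h
  obtain ⟨S, hS, hr⟩ : ern T ∈ {k | ∃ S : Finset (Sym2 V), S.card = k ∧ Reconstructs T S} :=
    Nat.sInf_mem ⟨2, h⟩
  have h0 : ern T ≠ 0 := by
    intro h
    rw [h, Finset.card_eq_zero] at hS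
    subst hS
    exact not_reconstructs_empty h₁ hr
  have h1 : ern T ≠ 1 := by
    intro h
    rw [h, Finset.card_eq_one] at hS
    obtain ⟨e, rfl⟩ := hS
    exact not_reconstructs_singleton hT h₁ h₂ h₃ h₁₂ h₁₃ h₂₃ e hr
  omega

/-! ### The two centroidal vertices: adjacency and equal halves -/

section Weight

/-- Translates the components of the induced subgraph, in which weights are defined, into sides. -/
theorem supp_image (hx : x ≠ v) :
    Subtype.val '' ((T.induce ({v}ᶜ : Set V)).connectedComponentMk ⟨x, hx⟩).supp =
      comp (isolate T v) x := by
  ext y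
  constructor
  · rintro ⟨⟨y, hy⟩, h, rfl⟩
    rw [ConnectedComponent.mem_supp_iff, ConnectedComponent.eq] at h
    have := h.symm.map (⟨Subtype.val, fun {p q} h => ⟨h, p.2, q.2⟩⟩ :
      T.induce ({v}ᶜ : Set V) →g isolate T v)
    exact this
  · intro hy
    have : comp (isolate T v) x ⊆ {y | ∃ h : y ≠ v,
        (T.induce ({v}ᶜ : Set V)).Reachable ⟨x, hx⟩ ⟨y, h⟩} := by
      refine comp_subset ⟨hx, Reachable.refl _⟩ ?_
      rintro y ⟨hy, hr⟩ z hyz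
      refine ⟨hyz.2.2, hr.trans (Adj.reachable ?_)⟩
      exact hyz.1
    obtain ⟨h, hr⟩ := this hy
    refine ⟨⟨y, h⟩, ?_, rfl⟩
    rw [ConnectedComponent.mem_supp_iff, ConnectedComponent.eq]
    exact hr.symm

variable [Finite V]

theorem ncard_le_weight (hx : x ≠ v) : (comp (isolate T v) x).ncard ≤ weight T v := by
  rw [← supp_image hx, Set.ncard_image_of_injective _ Subtype.val_injective]
  exact le_ciSup (f := fun C : (T.induce ({v}ᶜ : Set V)).ConnectedComponent => C.supp.ncard)
    (Set.toFinite _).bddAbove _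

theorem exists_weight_eq (hT : T.IsTree) (hx : x ≠ v) :
    ∃ u, T.Adj v u ∧ weight T v = (side T v u).ncard := by
  have : Nonempty (T.induce ({v}ᶜ : Set V)).ConnectedComponent :=
    ⟨(T.induce ({v}ᶜ : Set V)).connectedComponentMk ⟨x, hx⟩⟩
  obtain ⟨C, hC⟩ := exists_eq_ciSup_of_finite
    (f := fun C : (T.induce ({v}ᶜ : Set V)).ConnectedComponent => C.supp.ncard)
  induction C using ConnectedComponent.ind with
  | h y =>
  obtain ⟨y, hy⟩ := y
  obtain ⟨u, hu, hyu⟩ := exists_adj_of_mem_comp (F := T) (v := v) (w := y)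
    (hT.connected.preconnected v y) hy
  refine ⟨u, hu, ?_⟩
  rw [weight, ← hC, ← Set.ncard_image_of_injective _ Subtype.val_injective, supp_image hy, side,
    comp_eq hyu]

/-- Otherwise the neighbour b₁ of b towards a lies outside the centroid and is heavier than b. But a
component of T - b₁ either contains b, and then lies inside a component of T - a, or lies inside the
component of T - b that contains b₁; neither exceeds the minimum weight. -/
theorem adj_of_isBicentroidal (h : IsBicentroidal T a b) : T.Adj a b := by
  obtain ⟨hT, hne, hc⟩ := h
  have ha : a ∈ centroid T := hc ▸ Or.inl rfl
  have hb : b ∈ centroid T := hc ▸ Or.inr rfl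
  by_contra hadj
  obtain ⟨a₁, ha₁, hba⟩ := exists_adj_of_mem_comp (F := T) (v := a) (w := b)
    (hT.connected.preconnected a b) hne.symm
  obtain ⟨b₁, hb₁, hab⟩ := exists_adj_of_mem_comp (F := T) (v := b) (w := a)
    (hT.connected.preconnected b a) hne
  have hb₁c : b₁ ∉ centroid T := by
    rw [hc]
    rintro (rfl | rfl)
    · exact hadj hb₁.symm
    · exact hb₁.ne rfl
  have hlt : weight T b < weight T b₁ := by
    by_contra hle
    exact hb₁c fun w => (not_lt.1 hle).trans (hb w)
  obtain ⟨u, hu, hw⟩ := exists_weight_eq hT hb₁.ne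
  rw [hw] at hlt
  by_cases hub : u = b
  · subst hub
    have hsub : side T b₁ u ⊆ side T a a₁ := by
      have hmem : ∀ x ∈ side T b₁ u, x ≠ a := by
        rintro x hx rfl
        exact Set.disjoint_left.1 (disjoint_side hT.isAcyclic hb₁) hab hx
      have : side T b₁ u ⊆ side T a a₁ ∩ side T b₁ u := by
        refine comp_subset ⟨hba, mem_comp_self⟩ ?_
        rintro x ⟨hx, hx'⟩ y hxy
        have hy : y ∈ side T b₁ u := comp_adj hx' hxy
        exact ⟨comp_adj hx ⟨hxy.1, hmem x hx', hmem y hy⟩, hy⟩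
      exact fun x hx => (this hx).1
    have h1 := Set.ncard_le_ncard hsub
    have h2 : (side T a a₁).ncard ≤ weight T a := ncard_le_weight ha₁.ne'
    have h3 := ha u
    omega
  · have h1 := ncard_side_lt_side hT.isAcyclic hb₁ hu hub
    have h2 : (side T b b₁).ncard ≤ weight T b := ncard_le_weight hb₁.ne'
    omega

/-- A largest component of T - a must be the one containing b: any other lies strictly inside a
component of T - b, while the two weights are equal. The same holds for b, so the two sides have the
common weight as their size. -/
theorem ncard_side_eq_of_isBicentroidal (h : IsBicentroidal T a b) :
    (side T b a).ncard = (side T a b).ncard := by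
  have hadj := adj_of_isBicentroidal h
  obtain ⟨hT, hne, hc⟩ := h
  have ha : a ∈ centroid T := hc ▸ Or.inl rfl
  have hb : b ∈ centroid T := hc ▸ Or.inr rfl
  have hab := ha b
  have hba := hb a
  have key : ∀ {a b}, T.Adj a b → weight T a = weight T b →
      weight T a = (side T a b).ncard := by
    intro a b hadj hw
    obtain ⟨u, hu, hwu⟩ := exists_weight_eq hT hadj.ne'
    by_cases hub : u = b
    · rw [hwu, hub]
    · have h1 := ncard_side_lt_side hT.isAcyclic hadj.symm hu hub
      have h2 : (side T b a).ncard ≤ weight T b := ncard_le_weight hadj.ne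
      omega
  have h1 := key hadj (le_antisymm hab hba)
  have h2 := key hadj.symm (le_antisymm hba hab)
  omega

end Weight

theorem exists_leg_of_not_isPseudopath [Finite V] (hT : T.IsAcyclic) (hab : T.Adj a b)
    (h : ¬ IsPseudopath (centroidalComponent T a b)) : ∃ i, Leg (isolate T b) a i := by
  obtain ⟨i, hi⟩ := exists_leg fun h' => h (Or.inl h')
  exact ⟨i, hi.of_mcls_eq (cls_edgeCard hT hab)⟩

end Cards

/-! ### Trees with an edge that halves them -/

section Balanced

variable {F F' T X Y : SimpleGraph V} {m m' : Set V}
  {a a' b b' c d l n n' p q r r' s s' t u v v' w w' x y z : V} {S : Set V}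

section Finite
variable [Finite V]

theorem cls_eq_of_unique (hF : F.IsAcyclic) (hF' : F'.IsAcyclic) (hw : F.Adj v w)
    (hu : ∀ y, F.Adj v y → y = w) (hw' : F'.Adj v' w') (hu' : ∀ y, F'.Adj v' y → y = w') :
    cls F v = cls F' v' ↔ cls (isolate F v) w = cls (isolate F' v') w' := by
  rw [cls_eq_iff_kids hF hF', kids, kids, kids_of_unique hw hu, kids_of_unique hw' hu',
    Multiset.singleton_inj]

theorem not_mem_comp_of_isolated (hs : ∀ x, ¬ F.Adj s x) (h : t ≠ s) : s ∉ comp F t := by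
  rw [mem_comp_comm, comp_eq_singleton hs]; exact h

omit [Finite V] in
theorem addEdge_adj_isolated (hs : ∀ x, ¬ F.Adj s x) (h : s ≠ t) :
    (addEdge F s t).Adj s x ↔ x = t := by
  rw [addEdge_adj]
  simp only [hs x, h, ne_eq, not_false_eq_true, true_and, false_and, or_false, false_or]

/-- Variant of `cls_eq_of_cls_addEdge_eq`, where the tree with the additional leaf is described by
a vertex `r'` of degree one. -/
theorem cls_eq_of_cls_eq_of_unique (hF : F.IsAcyclic) (hs : ∀ x, ¬ F.Adj s x) (hys : y ≠ s)
    (hz : z ∈ comp F y) (hr : r ∈ comp (addEdge F s y) s) (hF' : F'.IsAcyclic) (hn : F'.Adj r' n)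
    (hu : ∀ x, F'.Adj r' x → x = n) (h : cls F z = cls (isolate F' r') n)
    (h' : cls F' r' = cls (addEdge F s y) r) : cls F z = cls F y := by
  have hsc : s ∉ comp F y := not_mem_comp_of_isolated hs hys
  have hsz : s ≠ z := fun e => hsc (e ▸ hz)
  refine cls_eq_of_cls_addEdge_eq hF hs hys hz hr (Eq.trans ?_ h')
  rw [cls_eq_of_unique (isAcyclic_addEdge hF (by
      rw [comp_eq_singleton hs]; exact fun h => hsz (Eq.symm h))) hF' (addEdge_adj_self hsz)
    (fun x hx => (addEdge_adj_isolated hs hsz).1 hx) hn hu, isolate_addEdge_self, ← h]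
  exact cls_isolate (not_mem_comp_of_isolated hs hsz.symm)

theorem cls_addEdge (hF : F.IsAcyclic) (hF' : F'.IsAcyclic) (hpq : q ∉ comp F p)
    (hpq' : q' ∉ comp F' p') (hp : cls F p = cls F' p') (hq : cls F q = cls F' q') :
    cls (addEdge F p q) p = cls (addEdge F' p' q') p' := by
  have hne : p ≠ q := fun e => hpq (e ▸ mem_comp_self)
  have hne' : p' ≠ q' := fun e => hpq' (e ▸ mem_comp_self)
  refine mcls_eq_of_split (isAcyclic_addEdge hF hpq) (isAcyclic_addEdge hF' hpq')
    (addEdge_adj_self hne) (addEdge_adj_self hne') ?_ ?_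
  · rw [addEdge_comm, isolate_addEdge_self, addEdge_comm, isolate_addEdge_self, mcls_isolate hpq,
      mcls_isolate hpq']
    exact hp
  · rw [isolate_addEdge_self, isolate_addEdge_self, mcls_isolate fun h => hpq (mem_comp_comm.1 h),
      mcls_isolate fun h => hpq' (mem_comp_comm.1 h)]
    exact hq

/-- The number of vertices in `S` that have degree one in `F`. -/
noncomputable def numLeaves (F : SimpleGraph V) (S : Set V) : ℕ :=
  {w ∈ S | (nbrs F w).card = 1}.ncard

theorem numLeaves_eq (h : cls F v = cls F' v') :
    numLeaves F (comp F v) = numLeaves F' (comp F' v') := by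
  obtain ⟨f, hf⟩ := mcls_eq_iff.1 h
  have : f '' {w ∈ comp F v | (nbrs F w).card = 1} = {w ∈ comp F' v' | (nbrs F' w).card = 1} := by
    ext x
    constructor
    · rintro ⟨x, hx, rfl⟩
      exact ⟨hf.bij.mapsTo hx.1, (hf.card_nbrs hx.1).trans hx.2⟩
    · rintro ⟨hx, hx'⟩
      obtain ⟨y, hy, rfl⟩ := hf.bij.surjOn hx
      exact ⟨y, ⟨hy, (hf.card_nbrs hy).symm.trans hx'⟩, rfl⟩
  rw [numLeaves, numLeaves, ← this, Set.InjOn.ncard_image]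
  exact hf.bij.injOn.mono fun x hx => hx.1

theorem card_nbrs_eq_one_iff : (nbrs F v).card = 1 ↔ ∃ w, F.Adj v w ∧ ∀ y, F.Adj v y → y = w := by
  rw [Finset.card_eq_one]
  constructor
  · rintro ⟨w, hw⟩
    refine ⟨w, mem_nbrs.1 (by rw [hw]; exact Finset.mem_singleton_self _), fun y hy => ?_⟩
    have := mem_nbrs.2 hy
    rw [hw] at this
    exact Finset.mem_singleton.1 this
  · rintro ⟨w, hw, hu⟩
    exact ⟨w, nbrs_eq_singleton hw hu⟩

theorem nbrs_congr (h : ∀ y, F.Adj v y ↔ F'.Adj v y) : nbrs F v = nbrs F' v := by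
  ext y; rw [mem_nbrs, mem_nbrs, h]

/-- If joining two components by an edge `pq` and deleting an edge of the component of `p` gives
components whose sizes differ by at most one from that of `q`, then `p` is a leaf and the deleted
edge is its edge. -/
theorem exists_leaf_of_ncard {N : ℕ} (hF : F.IsAcyclic) (hpq : q ∉ comp F p)
    (hq : (comp F q).ncard = N) (hxy : F.Adj x y) (hx : x ∈ comp F p)
    (hN : ∀ v, (comp (edgeCard (addEdge F p q) s(x, y)) v).ncard ≤ N + 1) :
    ∃ n, s(x, y) = s(p, n) ∧ F.Adj p n ∧ ∀ w, F.Adj p w → w = n := by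
  have key : ∀ x y, F.Adj x y → p ∈ side F y x → y ∈ comp F p →
      (∀ v, (comp (edgeCard (addEdge F p q) s(x, y)) v).ncard ≤ N + 1) →
      x = p ∧ ∀ w, F.Adj p w → w = y := by
    intro x y hxy hp hyp hN
    have hxp : x ∈ comp F p := comp_adj hyp hxy.symm
    have e1 : comp (edgeCard F s(x, y)) p = side F y x := by
      rw [← comp_edgeCard hF hxy] at hp ⊢
      exact comp_eq hp
    have e2 : comp (edgeCard F s(x, y)) q = comp F q := by
      refine comp_congr fun w hw z => ?_
      rw [edgeCard_adj_iff]
      refine ⟨fun h => h.1, fun h => ⟨h, ?_, ?_⟩⟩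
      · rintro ⟨rfl, -⟩
        exact hpq (Reachable.trans hxp (Reachable.symm hw))
      · rintro ⟨rfl, -⟩
        exact hpq (Reachable.trans hyp (Reachable.symm hw))
    have hsub : side F y x ∪ comp F q ⊆ comp (edgeCard (addEdge F p q) s(x, y)) p := by
      have hle : addEdge (edgeCard F s(x, y)) p q ≤ edgeCard (addEdge F p q) s(x, y) := by
        intro v w h
        rw [edgeCard_adj_iff, addEdge_adj]
        rw [addEdge_adj, edgeCard_adj_iff] at h
        rcases h with h | ⟨hne, h⟩
        · exact ⟨Or.inl h.1, h.2⟩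
        · refine ⟨Or.inr ⟨hne, h⟩, ?_⟩
          have h1 : q ≠ x := fun e => hpq (e ▸ hxp)
          have h2 : q ≠ y := fun e => hpq (e ▸ hyp)
          rcases h with ⟨rfl, rfl⟩ | ⟨rfl, rfl⟩
          · exact ⟨fun h => h2 h.2, fun h => h1 h.2⟩
          · exact ⟨fun h => h1 h.1, fun h => h2 h.1⟩
      refine subset_trans ?_ (comp_mono hle)
      rw [addEdge_comm, comp_addEdge mem_comp_self, e1, e2]
    -- The piece of p now hangs together with all N vertices of the component of q, and the bound N
    -- + 1 leaves room for p alone.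
    have h1 := (Set.ncard_le_ncard hsub).trans (hN p)
    have hdisj : Disjoint (side F y x) (comp F q) := by
      rw [Set.disjoint_left]
      intro w hw hw'
      exact hpq (Reachable.trans (Reachable.trans hxp (comp_mono isolate_le hw))
        (Reachable.symm hw'))
    rw [Set.ncard_union_eq hdisj, hq] at h1
    have h2 : (side F y x).ncard ≤ 1 := by omega
    rw [Set.ncard_le_one_iff] at h2
    refine ⟨h2 mem_comp_self hp, fun w hw => ?_⟩
    by_contra hwy
    have hpy : p ≠ y := fun e => not_mem_side hxy.ne (e ▸ hp)
    exact hw.ne (h2 hp (comp_adj hp ⟨hw, hpy, hwy⟩))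
  have hp : p ∈ comp F x := mem_comp_comm.1 hx
  rw [comp_eq_union hxy] at hp
  rcases hp with hp | hp
  · obtain ⟨rfl, hu⟩ := key x y hxy hp (comp_adj hx hxy) hN
    exact ⟨y, rfl, hxy, hu⟩
  · rw [Sym2.eq_swap] at hN
    obtain ⟨rfl, hu⟩ := key y x hxy.symm hp hx hN
    exact ⟨x, Sym2.eq_swap, hxy.symm, hu⟩

end Finite

/-- Each of the two cards at a is T - a with a attached as a leaf at one of its neighbours. In this
form they can be compared by the principle on attached leaves. -/
theorem edgeCard_eq_addEdge (ha : ∀ x, T.Adj a x ↔ x = b ∨ x = c) (hbc : b ≠ c) :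
    edgeCard T s(a, b) = addEdge (isolate T a) a c := by
  have hac : a ≠ c := ((ha c).2 (Or.inr rfl)).ne
  have hab : a ≠ b := ((ha b).2 (Or.inl rfl)).ne
  ext x y
  rw [edgeCard_adj_iff, addEdge_adj, isolate_adj]
  by_cases hx : x = a
  · subst hx
    simp only [ha, true_and, ne_eq, not_true_eq_false, false_and, and_false, hac, false_or,
      not_false_eq_true, hab, or_false, and_true]
    constructor
    · tauto
    · rintro rfl; exact ⟨Or.inr rfl, hbc.symm⟩
  · by_cases hy : y = a
    · subst hy
      simp only [T.adj_comm x, ha, hx, false_and, not_false_eq_true, true_and, and_true,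
        ne_eq, not_true_eq_false, and_false, false_or, hac]
      constructor
      · tauto
      · rintro rfl; exact ⟨Or.inr rfl, hbc.symm⟩
    · simp only [hx, hy, false_and, and_false, not_false_eq_true, and_true, ne_eq, or_false]

/-- A tree `T` with an edge `ab` whose two sides have the same size, where `a` and `b` have degree
two, with further neighbours `c` and `d`, and neither side is a path starting at `ab`. -/
structure Balanced (T : SimpleGraph V) (a b c d : V) : Prop where
  isTree : T.IsTree
  adj : T.Adj a b
  adj_a : ∀ x, T.Adj a x ↔ x = b ∨ x = c
  adj_b : ∀ x, T.Adj b x ↔ x = a ∨ x = d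
  c_ne : c ≠ b
  d_ne : d ≠ a
  size : (side T b a).ncard = (side T a b).ncard
  leg_a : ∃ i, Leg (isolate T b) a i
  leg_b : ∃ i, Leg (isolate T a) b i

namespace Balanced

theorem symm (h : Balanced T a b c d) : Balanced T b a d c :=
  ⟨h.isTree, h.adj.symm, h.adj_b, h.adj_a, h.d_ne, h.c_ne, h.size.symm, h.leg_b, h.leg_a⟩

variable (h : Balanced T a b c d)
include h

theorem acyc : T.IsAcyclic := h.isTree.isAcyclic

theorem adj_ac : T.Adj a c := (h.adj_a c).2 (Or.inr rfl)

theorem adj_bd : T.Adj b d := (h.adj_b d).2 (Or.inr rfl)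

theorem edgeCard_ab : edgeCard T s(a, b) = addEdge (isolate T a) a c :=
  edgeCard_eq_addEdge h.adj_a h.c_ne.symm

theorem edgeCard_ac : edgeCard T s(a, c) = addEdge (isolate T a) a b :=
  edgeCard_eq_addEdge (fun x => (h.adj_a x).trans or_comm) h.c_ne

theorem a_adj_F : (edgeCard T s(a, b)).Adj a x ↔ x = c := by
  rw [h.edgeCard_ab, addEdge_adj_isolated (fun x (hx : (isolate T a).Adj a x) => hx.2.1 rfl) h.adj_ac.ne]

theorem isolate_F : isolate (edgeCard T s(a, b)) a = isolate T a := by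
  rw [h.edgeCard_ab, isolate_addEdge_self, isolate_isolated]
  exact fun y hy => hy.2.1 rfl

theorem mem_side_or (x : V) : x ∈ side T b a ∨ x ∈ side T a b := by
  have := isTree_comp h.isTree a
  rw [comp_eq_union h.adj] at this
  exact (Set.ext_iff.1 this x).2 trivial

theorem disj : Disjoint (side T b a) (side T a b) := disjoint_side h.acyc h.adj.symm

theorem side_ac_adj : (isolate T b).Adj a x ↔ x = c := by
  rw [isolate_adj, h.adj_a]
  have h4 := h.adj_ac.ne
  have h5 := h.adj.ne
  have h6 := h.c_ne
  constructor
  · tauto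
  · rintro rfl; tauto

theorem not_mem_side_ac : b ∉ side T a c := fun hb =>
  h.c_ne (eq_of_reachable_isolate h.acyc h.adj_ac h.adj hb)

theorem cls_isolate_c : cls (isolate (isolate T b) a) c = cls (isolate T a) c := by
  rw [isolate_comm]; exact cls_isolate h.not_mem_side_ac

theorem comp_isolate_c : comp (isolate (isolate T b) a) c = side T a c := by
  rw [isolate_comm]; exact comp_isolate h.not_mem_side_ac

theorem ncard_c [Finite V] : (side T a c).ncard + 1 = (side T b a).ncard := by
  rw [← h.comp_isolate_c]
  exact (ncard_comp_of_unique (F := isolate T b) (v := a) (w := c) (h.side_ac_adj.2 rfl)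
    fun y hy => h.side_ac_adj.1 hy).symm

theorem side_ac_subset : side T a c ⊆ side T b a :=
  side_subset_side h.acyc h.adj.symm h.adj_ac h.c_ne

theorem ncard_ca [Finite V] : (side T c a).ncard = (side T b a).ncard + 1 := by
  have h1 := ncard_comp_eq h.acyc h.adj
  have h2 := ncard_comp_eq h.acyc h.adj_ac
  have h3 := h.ncard_c
  have h4 := h.size
  omega

end Balanced

end Balanced

/-! ### The cards of two adjacent edges -/

section AdjacentCards

variable {F F' T X Y : SimpleGraph V} {m m' : Set V}
  {a a' b b' c d l n n' p q r r' s s' t u v v' w w' x y z : V} {S : Set V}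

theorem cls_iso (φ : F ≃g F') (v : V) : cls F v = cls F' (φ v) :=
  (RootedIso.of_iso φ (m := ∅) (m' := ∅) (fun _ => Iff.rfl) v).mcls_eq

/-- Every leaf in `S` is attached to a vertex of degree at least three. -/
def IsThin [Finite V] (T : SimpleGraph V) (S : Set V) : Prop :=
  ∀ m ∈ S, (nbrs T m).card = 1 → ∀ y, T.Adj m y → 3 ≤ (nbrs T y).card

namespace Balanced
variable [Finite V]

theorem nonempty_iso (h : Balanced T a b c d) (hpq : q ∉ comp (edgeCard T s(a, b)) p)
    (hun : ∀ x, x ∈ comp (edgeCard T s(a, b)) p ∨ x ∈ comp (edgeCard T s(a, b)) q)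
    (hp : cls (edgeCard T s(a, b)) p = cls (edgeCard T s(a, b)) a)
    (hq : cls (edgeCard T s(a, b)) q = cls (edgeCard T s(a, b)) b) :
    Nonempty (addEdge (edgeCard T s(a, b)) p q ≃g T) := by
  have hF := isAcyclic_edgeCard (e := s(a, b)) h.acyc
  have hab : b ∉ comp (edgeCard T s(a, b)) a := by
    rw [comp_edgeCard h.acyc h.adj]; exact not_mem_side h.adj.ne
  have := cls_addEdge hF hF hpq hab hp hq
  rw [addEdge_edgeCard h.adj] at this
  refine nonempty_iso_of_cls_eq this ?_ (isTree_comp h.isTree a)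
  have hne : p ≠ q := fun e => hpq (e ▸ mem_comp_self)
  refine Set.eq_univ_of_forall fun x => ?_
  rcases hun x with hx | hx
  · exact comp_mono le_addEdge hx
  · exact Reachable.trans (addEdge_adj_self hne).reachable (comp_mono le_addEdge hx)

/-- The data of a tree that arises from `T - ab` by adding an edge `pq`, where `p` is a leaf, so
that removing the other edge at `p` gives `T - ac`. -/
structure LeafMove (T : SimpleGraph V) (a b c p q n : V)
    (ψ : addEdge (isolate (edgeCard T s(a, b)) p) p q ≃g edgeCard T s(a, c)) : Prop where
  not_mem : q ∉ comp (edgeCard T s(a, b)) p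
  ncard_p : (comp (edgeCard T s(a, b)) p).ncard = (side T b a).ncard
  ncard_q : (comp (edgeCard T s(a, b)) q).ncard = (side T b a).ncard
  adj : (edgeCard T s(a, b)).Adj p n
  unique : ∀ x, (edgeCard T s(a, b)).Adj p x → x = n

namespace LeafMove
variable {ψ : addEdge (isolate (edgeCard T s(a, b)) p) p q ≃g edgeCard T s(a, c)}

theorem ne (k : LeafMove T a b c p q n ψ) : p ≠ q :=
  fun e => k.not_mem (e ▸ mem_comp_self)

theorem adj_iff (k : LeafMove T a b c p q n ψ) :
    (addEdge (isolate (edgeCard T s(a, b)) p) p q).Adj p x ↔ x = q :=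
  addEdge_adj_isolated not_isolate_adj k.ne

theorem acyc (h : Balanced T a b c d) (k : LeafMove T a b c p q n ψ) :
    (addEdge (isolate (edgeCard T s(a, b)) p) p q).IsAcyclic := by
  refine isAcyclic_addEdge (isAcyclic_isolate (isAcyclic_edgeCard h.acyc)) ?_
  rw [comp_isolate_self]; exact fun h => k.ne (Eq.symm h)

/-- Sizes decide: p now hangs on a component of N + 1 vertices in all, and in T - ac that is the
component of a. -/
theorem mem_p (h : Balanced T a b c d) (k : LeafMove T a b c p q n ψ) :
    ψ p ∈ side T c a := by
  have hpc : p ∉ comp (edgeCard T s(a, b)) q := fun h => k.not_mem (mem_comp_comm.1 h)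
  have h1 : (comp (addEdge (isolate (edgeCard T s(a, b)) p) p q) p).ncard =
      (side T b a).ncard + 1 := by
    rw [addEdge_comm, comp_addEdge mem_comp_self, comp_isolate_self, comp_isolate hpc,
      Set.singleton_union, Set.ncard_insert_of_notMem hpc, k.ncard_q]
  rw [ncard_eq_of_mcls_eq (cls_iso ψ p)]
    at h1
  have h2 : ψ p ∈ comp T a := by rw [isTree_comp h.isTree]; trivial
  rw [comp_eq_union h.adj_ac] at h2
  refine h2.resolve_right fun h3 => ?_
  have h4 := h.ncard_c
  rw [← comp_edgeCard' h.acyc h.adj_ac] at h3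
  rw [comp_eq h3, comp_edgeCard' h.acyc h.adj_ac] at h1
  omega

theorem not_mem_n (k : LeafMove T a b c p q n ψ) :
    p ∉ comp (isolate (edgeCard T s(a, b)) p) n ∧ q ∉ comp (isolate (edgeCard T s(a, b)) p) n :=
  ⟨not_mem_side k.adj.ne', fun h => k.not_mem (side_subset_comp k.adj h)⟩

theorem mem_n (h : Balanced T a b c d) (k : LeafMove T a b c p q n ψ) : ψ n ∈ side T a c := by
  have h1 := ncard_comp_of_unique k.adj k.unique
  rw [k.ncard_p, show side (edgeCard T s(a, b)) p n = comp (isolate _ _) _ from rfl, ← comp_addEdge_of_not_mem k.not_mem_n.1 k.not_mem_n.2,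
    ncard_eq_of_mcls_eq (cls_iso ψ n)]
    at h1
  have h2 : ψ n ∈ comp T a := by rw [isTree_comp h.isTree]; trivial
  rw [comp_eq_union h.adj_ac] at h2
  refine h2.resolve_left fun h3 => ?_
  have h4 := h.ncard_ca
  rw [← comp_edgeCard h.acyc h.adj_ac] at h3
  rw [comp_eq h3, comp_edgeCard h.acyc h.adj_ac] at h1
  omega

theorem cls_n (h : Balanced T a b c d) (k : LeafMove T a b c p q n ψ) :
    cls (isolate T a) (ψ n) = cls (isolate (edgeCard T s(a, b)) p) n := by
  rw [← cls_addEdge_of_not_mem k.not_mem_n.1 k.not_mem_n.2, cls_iso ψ n]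
  have h1 := k.mem_n h
  generalize ψ n = z at h1
  rw [h.edgeCard_ac]
  symm
  have ha : a ∉ side T a c := not_mem_side h.adj_ac.ne'
  refine cls_addEdge_of_not_mem (fun h2 => ha ?_) (fun h2 => h.not_mem_side_ac ?_)
  · rw [side, ← comp_eq h1]; exact h2
  · rw [side, ← comp_eq h1]; exact h2

/-- By `hrp` the component of p is a copy of G. It also arises from a copy of G - a by attaching a
leaf at the image of n, while G arises by attaching a at c, so these two places are equivalent. -/
theorem cls_p_eq (h : Balanced T a b c d) (k : LeafMove T a b c p q n ψ)
    (hr : r ∈ comp (edgeCard T s(a, b)) a)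
    (hrp : cls (edgeCard T s(a, b)) r = cls (edgeCard T s(a, b)) p) :
    cls (edgeCard T s(a, b)) p = cls (edgeCard T s(a, b)) a := by
  have hF := isAcyclic_edgeCard (e := s(a, b)) h.acyc
  have key := cls_eq_of_cls_eq_of_unique (isAcyclic_isolate (p := a) h.acyc) (s := a) not_isolate_adj
    h.adj_ac.ne' (k.mem_n h) (r := r) (by rwa [← h.edgeCard_ab]) hF k.adj k.unique
    (k.cls_n h) (by rw [← h.edgeCard_ab, hrp])
  rw [cls_eq_of_unique hF hF k.adj k.unique (h.a_adj_F.2 rfl) (fun y hy => h.a_adj_F.1 hy),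
    h.isolate_F, ← key]
  exact (k.cls_n h).symm

/-- By `htq` the component of q is a copy of H in which t plays the part of q. Attaching p at q and
attaching a at b give isomorphic trees through ψ, so t and b are equivalent in H. -/
theorem cls_q_eq (h : Balanced T a b c d) (k : LeafMove T a b c p q n ψ)
    (ht : t ∈ comp (edgeCard T s(a, b)) b)
    (htq : cls (edgeCard T s(a, b)) t = cls (edgeCard T s(a, b)) q) :
    cls (edgeCard T s(a, b)) t = cls (edgeCard T s(a, b)) b := by
  have hb : ∀ {t}, t ∈ comp (edgeCard T s(a, b)) b →
      cls (isolate T a) t = cls (edgeCard T s(a, b)) t := by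
    intro t ht
    rw [← h.isolate_F]
    refine cls_isolate ?_
    rw [comp_eq ht, comp_edgeCard' h.acyc h.adj]
    exact not_mem_side h.adj.ne'
  have hpc : p ∉ comp (edgeCard T s(a, b)) q := fun h => k.not_mem (mem_comp_comm.1 h)
  rw [← hb ht, ← hb mem_comp_self]
  refine cls_eq_of_cls_eq_of_unique (isAcyclic_isolate (p := a) h.acyc) (s := a) not_isolate_adj
    h.adj.ne' (r := ψ p) ?_ ?_ (k.acyc h) (k.adj_iff.2 rfl) (fun x hx => k.adj_iff.1 hx) ?_ ?_
  · have := ht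
    rwa [comp_edgeCard' h.acyc h.adj] at this
  · rw [← h.edgeCard_ac, comp_edgeCard h.acyc h.adj_ac]
    exact k.mem_p h
  · rw [hb ht, htq, isolate_addEdge_self, isolate_isolated not_isolate_adj]
    exact (cls_isolate hpc).symm
  · rw [← h.edgeCard_ac]
    exact cls_iso ψ p

end LeafMove

/-! ### Leaf counts in the cards at a -/

theorem card_nbrs_ac (h : Balanced T a b c d) (hx : x ∈ side T a b) :
    nbrs (edgeCard T s(a, c)) x = nbrs T x := by
  have hxa : x ≠ a := fun e => not_mem_side h.adj.ne' (e ▸ hx)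
  have hxc : x ≠ c := fun e =>
    Set.disjoint_left.1 h.disj (h.side_ac_subset mem_comp_self) (e ▸ hx)
  refine nbrs_congr fun y => ?_
  rw [edgeCard_adj_iff]
  simp [hxa, hxc]

theorem card_nbrs_ab (h : Balanced T a b c d) (hx : x ∈ side T b a) (hxa : x ≠ a) :
    nbrs (edgeCard T s(a, b)) x = nbrs T x := by
  have hxb : x ≠ b := fun e => not_mem_side h.adj.ne (e ▸ hx)
  refine nbrs_congr fun y => ?_
  rw [edgeCard_adj_iff]
  simp [hxa, hxb]

theorem card_nbrs_a (h : Balanced T a b c d) : (nbrs T a).card = 2 := by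
  classical
  have : nbrs T a = {b, c} := by
    ext x
    rw [mem_nbrs, h.adj_a]; simp
  rw [this, Finset.card_pair h.c_ne.symm]

theorem side_ca_eq (h : Balanced T a b c d) : side T c a = insert a (side T a b) := by
  have h1 : ∀ x, (isolate T c).Adj a x ↔ x = b := by
    intro x
    rw [isolate_adj, h.adj_a]
    have := h.adj_ac.ne
    have := h.c_ne
    constructor
    · tauto
    · rintro rfl; tauto
  have h2 : comp (isolate T c) a = insert a (side (isolate T c) a b) :=
    comp_eq_insert_side ((h1 b).2 rfl) fun y hy => (h1 y).1 hy
  rw [side, h2, side, isolate_comm, comp_isolate]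
  · rfl
  · exact fun h' => Set.disjoint_left.1 h.disj (h.side_ac_subset mem_comp_self) h'

theorem numLeaves_ac (h : Balanced T a b c d) :
    numLeaves (edgeCard T s(a, c)) (side T c a) = numLeaves T (side T a b) + 1 := by
  have ha : a ∉ side T a b := not_mem_side h.adj.ne'
  have : {w ∈ side T c a | (nbrs (edgeCard T s(a, c)) w).card = 1} =
      insert a {w ∈ side T a b | (nbrs T w).card = 1} := by
    rw [h.side_ca_eq]
    ext w
    simp only [Set.mem_insert_iff, Set.mem_ofPred_eq]
    constructor
    · rintro ⟨rfl | hw, h1⟩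
      · exact Or.inl rfl
      · rw [card_nbrs_ac h hw] at h1
        exact Or.inr ⟨hw, h1⟩
    · rintro (rfl | ⟨hw, h1⟩)
      · refine ⟨Or.inl rfl, card_nbrs_eq_one_iff.2 ⟨b, ?_⟩⟩
        have := fun x => addEdge_adj_isolated (F := isolate T w) (s := w) (t := b) (x := x) not_isolate_adj
          h.adj.ne
        rw [h.edgeCard_ac]
        exact ⟨(this b).2 rfl, fun y hy => (this y).1 hy⟩
      · rw [card_nbrs_ac h hw]
        exact ⟨Or.inr hw, h1⟩
  rw [numLeaves, this, Set.ncard_insert_of_notMem fun h => ha h.1, numLeaves]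

theorem numLeaves_ab (h : Balanced T a b c d) :
    numLeaves (edgeCard T s(a, b)) (side T b a) = numLeaves T (side T b a) + 1 := by
  have : {w ∈ side T b a | (nbrs (edgeCard T s(a, b)) w).card = 1} =
      insert a {w ∈ side T b a | (nbrs T w).card = 1} := by
    ext w
    simp only [Set.mem_insert_iff, Set.mem_ofPred_eq]
    by_cases hwa : w = a
    · subst hwa
      simp only [true_or, iff_true]
      exact ⟨mem_comp_self, card_nbrs_eq_one_iff.2 ⟨c, h.a_adj_F.2 rfl, fun y hy =>
        h.a_adj_F.1 hy⟩⟩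
    · simp only [hwa, false_or]
      exact and_congr_right fun hw => by rw [card_nbrs_ab h hw hwa]
  rw [numLeaves, this, Set.ncard_insert_of_notMem, numLeaves]
  rintro ⟨-, h1⟩
  rw [card_nbrs_a h] at h1
  omega

namespace LeafMove
variable {ψ : addEdge (isolate (edgeCard T s(a, b)) p) p q ≃g edgeCard T s(a, c)}

theorem card_nbrs_q (k : LeafMove T a b c p q n ψ) :
    (nbrs (addEdge (isolate (edgeCard T s(a, b)) p) p q) q).card =
      (nbrs (edgeCard T s(a, b)) q).card + 1 := by
  classical
  have hqp : ¬ (edgeCard T s(a, b)).Adj q p := fun h => k.not_mem (mem_comp_of_adj h.symm)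
  have : nbrs (addEdge (isolate (edgeCard T s(a, b)) p) p q) q =
      insert p (nbrs (edgeCard T s(a, b)) q) := by
    ext x
    rw [Finset.mem_insert, mem_nbrs, mem_nbrs, addEdge_adj, isolate_adj]
    have h1 := k.ne
    have h2 := k.ne.symm
    simp only [h1, h2, ne_eq, not_false_eq_true, true_and, false_and, false_or]
    constructor
    · tauto
    · rintro (h | h)
      · exact Or.inr h
      · refine Or.inl ⟨h, ?_⟩
        rintro rfl; exact hqp h
  rw [this, Finset.card_insert_of_notMem]
  rw [mem_nbrs]; exact hqp

/-- Attaching p creates one leaf and destroys one if q was a leaf of T - ab; hence the removal of q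
from the set. -/
theorem numLeaves_p (h : Balanced T a b c d) (k : LeafMove T a b c p q n ψ)
    (hq : q ∈ side T b a) :
    numLeaves (addEdge (isolate (edgeCard T s(a, b)) p) p q)
      (comp (addEdge (isolate (edgeCard T s(a, b)) p) p q) p) =
      ({w ∈ side T b a | (nbrs (edgeCard T s(a, b)) w).card = 1} \ {q}).ncard + 1 := by
  have hpc : p ∉ comp (edgeCard T s(a, b)) q := fun h => k.not_mem (mem_comp_comm.1 h)
  have hqc : comp (edgeCard T s(a, b)) q = side T b a := by
    rw [← comp_edgeCard h.acyc h.adj] at hq ⊢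
    exact comp_eq hq
  have hp : p ∉ side T b a := hqc ▸ hpc
  have hdeg : ∃ y, (edgeCard T s(a, b)).Adj q y := by
    by_contra! hcon
    have h1 := comp_eq_singleton hcon
    rw [hqc] at h1
    have h2 := h.ncard_c
    rw [h1, Set.ncard_singleton] at h2
    have h3 : 0 < (side T a c).ncard := ncard_comp_pos
    omega
  have : {w ∈ comp (addEdge (isolate (edgeCard T s(a, b)) p) p q) p |
      (nbrs (addEdge (isolate (edgeCard T s(a, b)) p) p q) w).card = 1} =
      insert p ({w ∈ side T b a | (nbrs (edgeCard T s(a, b)) w).card = 1} \ {q}) := by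
    rw [addEdge_comm (F := isolate _ _), comp_addEdge mem_comp_self, comp_isolate_self,
      comp_isolate hpc, addEdge_comm, hqc]
    ext w
    simp only [Set.singleton_union, Set.mem_insert_iff, Set.mem_ofPred_eq, Set.mem_sdiff,
      Set.mem_singleton_iff]
    by_cases hwp : w = p
    · subst hwp
      simp only [true_or, true_and, iff_true]
      exact card_nbrs_eq_one_iff.2 ⟨q, k.adj_iff.2 rfl, fun y hy => k.adj_iff.1 hy⟩
    · simp only [hwp, false_or]
      by_cases hwq : w = q
      · subst hwq
        simp only [not_true_eq_false, and_false, iff_false]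
        rintro ⟨-, h1⟩
        rw [k.card_nbrs_q] at h1
        obtain ⟨y, hy⟩ := hdeg
        have := Finset.card_pos.2 ⟨y, mem_nbrs.2 hy⟩
        omega
      · simp only [hwq, not_false_eq_true, and_true]
        refine and_congr_right fun hw => ?_
        rw [nbrs_congr (F := addEdge _ _ _) (F' := edgeCard T s(a, b)) fun y => ?_]
        rw [addEdge_adj_of_ne hwp hwq, isolate_adj]
        refine ⟨fun h => h.1, fun h => ⟨h, hwp, ?_⟩⟩
        rintro rfl
        rw [← hqc] at hw
        exact hpc (comp_adj hw h)
  rw [numLeaves, this, Set.ncard_insert_of_notMem fun h => hp h.1.1]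

/-- The vertex a is an additional leaf of G in T - ab and of the side of b in T - ac, so these
contributions cancel. What remains depends on whether attaching p spoils a leaf at q. -/
theorem numLeaves_or (h : Balanced T a b c d) (k : LeafMove T a b c p q n ψ)
    (hq : q ∈ side T b a) :
    ((nbrs (edgeCard T s(a, b)) q).card ≠ 1 ∧
      numLeaves T (side T a b) = numLeaves T (side T b a) + 1) ∨
    ((nbrs (edgeCard T s(a, b)) q).card = 1 ∧
      numLeaves T (side T a b) = numLeaves T (side T b a)) := by
  have h1 := numLeaves_eq (cls_iso ψ p)
  rw [k.numLeaves_p h hq] at h1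
  have h2 := k.mem_p h
  rw [← comp_edgeCard h.acyc h.adj_ac] at h2
  rw [comp_eq h2, comp_edgeCard h.acyc h.adj_ac, numLeaves_ac h] at h1
  have h3 := numLeaves_ab h
  rw [numLeaves] at h3
  by_cases hdeg : (nbrs (edgeCard T s(a, b)) q).card = 1
  · have := Set.ncard_sdiff_singleton_add_one
      (s := {w ∈ side T b a | (nbrs (edgeCard T s(a, b)) w).card = 1}) (a := q) ⟨hq, hdeg⟩
    right
    refine ⟨hdeg, ?_⟩
    omega
  · rw [Set.sdiff_singleton_eq_self fun h => hdeg h.2] at h1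
    left
    refine ⟨hdeg, ?_⟩
    omega

/-- If q had been a leaf of its component, p would hang at a vertex of degree two. Its image would
then be a leaf of H hanging at such a vertex, against thinness. -/
theorem numLeaves_of_isThin (h : Balanced T a b c d) (k : LeafMove T a b c p q n ψ)
    (hq : q ∈ side T b a) (hpa : ψ p ≠ a) (ht : IsThin T (side T a b)) :
    numLeaves T (side T a b) = numLeaves T (side T b a) + 1 := by
  refine ((k.numLeaves_or h hq).resolve_right ?_).2
  rintro ⟨hdeg, -⟩
  have h1 := k.mem_p h
  rw [side_ca_eq h] at h1
  replace h1 := h1.resolve_left hpa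
  have e := RootedIso.of_iso ψ (m := ∅) (m' := ∅) (fun _ => Iff.rfl) p
  have hpq := k.adj_iff.2 rfl
  have h2 := e.card_nbrs mem_comp_self
  have h3 := e.card_nbrs (mem_comp_of_adj hpq)
  have hadj : (edgeCard T s(a, c)).Adj (ψ p) (ψ q) := ψ.map_adj_iff.2 hpq
  rw [card_nbrs_ac h h1, card_nbrs_eq_one_iff.2 ⟨q, hpq, fun y hy => k.adj_iff.1 hy⟩] at h2
  have h4 := ht _ h1 h2 _ (edgeCard_le hadj)
  rw [k.card_nbrs_q, hdeg] at h3
  have h5 : ψ q ∈ side T a b := by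
    have h6 := k.mem_p h
    rw [← comp_edgeCard h.acyc h.adj_ac] at h6
    have h7 := comp_adj h6 hadj
    rw [comp_edgeCard h.acyc h.adj_ac, side_ca_eq h] at h7
    refine h7.resolve_left fun h8 => ?_
    rw [h8, card_nbrs_a h] at h4
    omega
  rw [card_nbrs_ac h h5] at h3
  omega

end LeafMove

theorem edgeCard_addEdge_leaf (hpq : q ∉ comp F p) (hn : F.Adj p n)
    (hu : ∀ x, F.Adj p x → x = n) :
    edgeCard (addEdge F p q) s(p, n) = addEdge (isolate F p) p q := by
  have hqn : q ≠ n := fun e => hpq (e ▸ mem_comp_of_adj hn)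
  have hqp : q ≠ p := fun e => hpq (e ▸ mem_comp_self)
  ext x y
  rw [edgeCard_adj_iff, addEdge_adj, addEdge_adj, isolate_adj]
  have h1 := hu x
  have h2 := hu y
  have h3 := F.adj_comm p x
  by_cases hx : x = p
  · subst hx
    simp only [true_and, hqp.symm, ne_eq, not_false_eq_true, not_true_eq_false, false_and,
      and_false, or_false, false_or]
    constructor
    · rintro ⟨h4 | h4, h5⟩
      · exact absurd (h2 h4) h5.1
      · exact h4
    · rintro rfl
      exact ⟨Or.inr rfl, hqn, fun h => hn.ne h.1⟩
  · by_cases hy : y = p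
    · subst hy
      simp only [true_and, hqp.symm, ne_eq, not_false_eq_true, not_true_eq_false, false_and,
        and_false, false_or, hx, and_true]
      constructor
      · rintro ⟨h4 | h4, h5⟩
        · exact absurd (h1 (h3.2 h4)) h5
        · exact h4
      · rintro rfl
        exact ⟨Or.inr rfl, hqn⟩
    · simp [hx, hy]

/-- The pair of cards `T - ab`, `T - ac` determines `T` if the two sides of `ab` are equivalent, or
their numbers of leaves differ in a suitable way. -/
theorem reconstructs_ab_ac [DecidableEq V] (h : Balanced T a b c d)
    (hcond : cls (isolate T b) a = cls (isolate T a) b ∨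
      ¬ (numLeaves T (side T a b) = numLeaves T (side T b a) ∨
        numLeaves T (side T a b) = numLeaves T (side T b a) + 1) ∨
      (IsThin T (side T a b) ∧ numLeaves T (side T a b) ≠ numLeaves T (side T b a) + 1)) :
    Reconstructs T {s(a, b), s(a, c)} := by
  have hFacyc := isAcyclic_edgeCard (e := s(a, b)) h.acyc
  have hFa := comp_edgeCard h.acyc h.adj
  have hFb := comp_edgeCard' h.acyc h.adj
  have hmem : ∀ x, x ∈ comp (edgeCard T s(a, b)) a ∨ x ∈ comp (edgeCard T s(a, b)) b := by
    rw [hFa, hFb]; exact h.mem_side_or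
  have hdisj : ∀ {x y}, x ∈ comp (edgeCard T s(a, b)) a → y ∈ comp (edgeCard T s(a, b)) b →
      y ∉ comp (edgeCard T s(a, b)) x := by
    intro x y hx hy hxy
    rw [comp_eq hx, hFa] at hxy
    rw [hFb] at hy
    exact Set.disjoint_left.1 h.disj hxy hy
  have hsz : ∀ x, (comp (edgeCard T s(a, b)) x).ncard = (side T b a).ncard := by
    intro x
    rcases hmem x with hx | hx
    · rw [comp_eq hx, hFa]
    · rw [comp_eq hx, hFb, h.size]
  have hsz' : ∀ x, (comp (edgeCard T s(a, c)) x).ncard ≤ (side T b a).ncard + 1 := by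
    intro x
    have h1 : x ∈ comp T a := by rw [isTree_comp h.isTree]; trivial
    rw [comp_eq_union h.adj_ac, ← comp_edgeCard h.acyc h.adj_ac,
      ← comp_edgeCard' h.acyc h.adj_ac] at h1
    rcases h1 with h1 | h1
    · rw [comp_eq h1, comp_edgeCard h.acyc h.adj_ac, h.ncard_ca]
    · rw [comp_eq h1, comp_edgeCard' h.acyc h.adj_ac, ← h.ncard_c]; omega
  have hne : s(a, b) ≠ s(a, c) := fun e => h.c_ne.symm (Sym2.congr_right.1 e)
  have move : ∀ p q x y, (edgeCard T s(a, b)).Adj x y → x ∈ comp (edgeCard T s(a, b)) p →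
      q ∉ comp (edgeCard T s(a, b)) p →
      Nonempty (edgeCard (addEdge (edgeCard T s(a, b)) p q) s(x, y) ≃g edgeCard T s(a, c)) →
      ∃ n ψ, LeafMove T a b c p q n ψ := by
    rintro p q x y hxy hx hpq ⟨φ⟩
    obtain ⟨n, hn, hadj, hu⟩ := exists_leaf_of_ncard hFacyc hpq (hsz q) hxy hx fun v => by
      rw [ncard_eq_of_mcls_eq (cls_iso φ v)]; exact hsz' _
    rw [hn, edgeCard_addEdge_leaf hpq hadj hu] at φ
    exact ⟨n, φ, hpq, hsz p, hsz q, hadj, hu⟩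
  have key : ∀ p q x y, (edgeCard T s(a, b)).Adj x y → p ∈ comp (edgeCard T s(a, b)) a →
      q ∈ comp (edgeCard T s(a, b)) b →
      Nonempty (edgeCard (addEdge (edgeCard T s(a, b)) p q) s(x, y) ≃g edgeCard T s(a, c)) →
      Nonempty (addEdge (edgeCard T s(a, b)) p q ≃g T) := by
    intro p q x y hxy hp hq hφ
    have hpq := hdisj hp hq
    have hqp : p ∉ comp (edgeCard T s(a, b)) q := fun h => hpq (mem_comp_comm.1 h)
    rcases hmem x with hx | hx
    · obtain ⟨n, ψ, k⟩ := move p q x y hxy (by rwa [comp_eq hp]) hpq hφ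
      refine h.nonempty_iso hpq (fun x => ?_) (k.cls_p_eq h hp rfl) (k.cls_q_eq h hq rfl)
      rw [comp_eq hp, comp_eq hq]; exact hmem x
    -- Here the moved leaf is q, taken from H to the vertex p of G. If p in G corresponds to b in H,
    -- then G and H are copies of each other and both ends can be identified (`fin`).
    · rw [addEdge_comm] at hφ
      obtain ⟨n, ψ, k⟩ := move q p x y hxy (by rwa [comp_eq hq]) hqp hφ
      have fin : cls (edgeCard T s(a, b)) p = cls (edgeCard T s(a, b)) b →
          Nonempty (addEdge (edgeCard T s(a, b)) p q ≃g T) := by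
        intro hpb
        rw [addEdge_comm]
        refine h.nonempty_iso hqp (fun x => ?_) ?_ hpb
        · rw [comp_eq hp, comp_eq hq]; exact (hmem x).symm
        · obtain ⟨f, hf⟩ := mcls_eq_iff.1 hpb
          obtain ⟨r, hr, hrq⟩ := hf.bij.surjOn hq
          refine k.cls_p_eq h (r := r) (by rwa [comp_eq hp] at hr) ?_
          rw [← hrq]; exact (hf.reroot hr).mcls_eq
      by_cases hc : cls (edgeCard T s(a, b)) a = cls (edgeCard T s(a, b)) b
      · obtain ⟨f, hf⟩ := mcls_eq_iff.1 hc
        have h1 := (hf.reroot hp).mcls_eq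
        exact fin (Eq.trans h1 (k.cls_q_eq h (hf.bij.mapsTo hp) h1.symm))
      -- If the moved leaf goes to a, removing both shows that G rooted at p is a copy of H rooted
      -- at b. If not, the leaf counts contradict `hcond`.
      by_cases hqa : ψ q = a
      · have h1 := cls_iso ψ q
        have hiso : ∀ y, ¬ (isolate T a).Adj a y := not_isolate_adj
        rw [hqa] at h1
        have h2 := fun x => addEdge_adj_isolated (x := x) hiso h.adj.ne
        have h3 : cls (edgeCard T s(a, c)) a = cls (addEdge (isolate T a) a b) a := by
          rw [h.edgeCard_ac]
        rw [h3, cls_eq_of_unique (k.acyc h) (h.edgeCard_ac ▸ isAcyclic_edgeCard h.acyc)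
          (k.adj_iff.2 rfl) (fun x hx => k.adj_iff.1 hx) ((h2 b).2 rfl) (fun x hx => (h2 x).1 hx),
          isolate_addEdge_self, isolate_addEdge_self, isolate_isolated not_isolate_adj,
          isolate_isolated hiso, cls_isolate hpq, ← cls_edgeCard' h.acyc h.adj] at h1
        exact fin h1
      · exfalso
        rw [hFa] at hp
        have h1 := k.numLeaves_or h hp
        have h2 := k.numLeaves_of_isThin h hp hqa
        rcases hcond with h3 | h3 | h3
        · rw [← cls_edgeCard h.acyc h.adj, ← cls_edgeCard' h.acyc h.adj] at h3
          exact hc h3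
        · omega
        · exact h3.2 (h2 h3.1)
  refine reconstructs_pair h.adj h.adj_ac hne ?_
  intro p q f hf hfe hpq hnadj hφ
  induction f using Sym2.ind with | _ x y
  have hxy : (edgeCard T s(a, b)).Adj x y := edgeCard_adj.2 ⟨hf, hfe⟩
  -- An edge within one component would leave all components with at most N vertices, but T - ac has
  -- one with N + 1.
  have hsame : ∀ {v}, p ∈ comp (edgeCard T s(a, b)) v → q ∈ comp (edgeCard T s(a, b)) v →
      False := by
    intro v hp hq
    obtain ⟨φ⟩ := hφ
    have h1 := ncard_eq_of_mcls_eq (cls_iso φ (φ.symm a))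
    rw [φ.apply_symm_apply, comp_edgeCard h.acyc h.adj_ac, h.ncard_ca] at h1
    have h2 : comp (addEdge (edgeCard T s(a, b)) p q) (φ.symm a) =
        comp (edgeCard T s(a, b)) (φ.symm a) := by
      by_cases hw : φ.symm a ∈ comp (edgeCard T s(a, b)) v
      · rw [comp_addEdge (by rwa [comp_eq hw]), comp_eq hw, comp_eq hp, Set.union_self]
      · refine comp_addEdge_of_not_mem (fun h => hw ?_) (fun h => hw ?_)
        · exact Reachable.trans hp (Reachable.symm h)
        · exact Reachable.trans hq (Reachable.symm h)
    have h3 := Set.ncard_le_ncard (comp_mono (F := edgeCard (addEdge (edgeCard T s(a, b)) p q)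
      s(x, y)) (v := φ.symm a) edgeCard_le)
    rw [h1, h2, hsz] at h3
    omega
  rcases hmem p with hp | hp <;> rcases hmem q with hq | hq
  · exact (hsame hp hq).elim
  · exact key p q x y hxy hp hq hφ
  · rw [addEdge_comm] at hφ ⊢
    exact key q p x y hxy hq hp hφ
  · exact (hsame hp hq).elim

/-- If every leaf behind `b` is attached to a vertex of degree at least three, then two of the cards
`T - ab`, `T - ac`, `T - bd` determine `T`. -/
theorem exists_reconstructs_of_isThin (h : Balanced T a b c d) (ht : IsThin T (side T a b)) :
    ∃ S : Finset (Sym2 V), S.card = 2 ∧ Reconstructs T S := by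
  classical
  -- If H has one leaf more than G, then G has neither as many leaves as H nor one more, so the
  -- mirror pair works.
  by_cases hl : numLeaves T (side T a b) = numLeaves T (side T b a) + 1
  · refine ⟨_, Finset.card_pair ?_, h.symm.reconstructs_ab_ac (Or.inr (Or.inl ?_))⟩
    · exact fun e => h.d_ne.symm (Sym2.congr_right.1 e)
    · omega
  · refine ⟨_, Finset.card_pair ?_, h.reconstructs_ab_ac (Or.inr (Or.inr ⟨ht, hl⟩))⟩
    exact fun e => h.c_ne.symm (Sym2.congr_right.1 e)

end Balanced

end AdjacentCards

/-! ### Cutting off a path of two vertices -/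

section EndEdge

variable {F F' T X Y : SimpleGraph V} {m m' : Set V}
  {a a' b b' c d l n n' p q r r' s s' t u u₀ l₀ w₀ v v' w w' x y z : V} {S : Set V}

section Finite
variable [Finite V]

/-- An edge with two sides of equal size is determined by this property. -/
theorem eq_or_eq_of_ncard_side {M : ℕ} (hF : F.IsAcyclic) (h : F.Adj s t)
    (h1 : (side F s t).ncard = M) (h2 : (side F t s).ncard = M) (hxu : F.Adj x u)
    (hx : x ∈ comp F s) (h3 : (side F x u).ncard = M) : (x = s ∧ u = t) ∨ (x = t ∧ u = s) := by
  have h4 : (side F u x).ncard = M := by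
    have e1 := ncard_comp_eq hF h
    have e2 := ncard_comp_eq hF hxu
    rw [comp_eq hx] at e2
    omega
  obtain ⟨u', hu', hs⟩ := exists_side_subset hF h hx
  have hle : M ≤ (side F x u').ncard := by
    rcases hs with ⟨-, hs⟩ | ⟨-, hs⟩
    · exact h1 ▸ Set.ncard_le_ncard hs
    · exact h2 ▸ Set.ncard_le_ncard hs
  -- Otherwise one half would lie strictly inside the side of x, which also has M vertices.
  have huu : u' = u := by
    by_contra hne
    have := ncard_side_lt_side hF hxu.symm hu' hne
    omega
  subst huu
  rcases hs with ⟨hxs, hs⟩ | ⟨hxs, hs⟩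
  · exact Or.inl (eq_of_side_eq hF h hxu hxs (Set.eq_of_subset_of_ncard_le hs (by omega)))
  · exact Or.inr (eq_of_side_eq hF h.symm hxu hxs (Set.eq_of_subset_of_ncard_le hs (by omega)))

/-- If the edge `yx` misses by one to have two sides of equal size, then `x` has exactly one
further neighbour. -/
theorem exists_eq_of_ncard_side {M : ℕ} (hF : F.IsAcyclic) (h : F.Adj s t)
    (h1 : (side F s t).ncard = M) (h2 : (side F t s).ncard = M) (hxy : F.Adj x y)
    (hx : x ∈ comp F s) (h3 : (side F y x).ncard = M + 1) :
    ∃ u, F.Adj x u ∧ u ≠ y ∧ (∀ w, F.Adj x w → w = y ∨ w = u) ∧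
      ((x = s ∧ u = t) ∨ (x = t ∧ u = s)) := by
  have hpos : 0 < M := h1 ▸ ncard_comp_pos
  have h4 : (side F x y).ncard < M := by
    have e1 := ncard_comp_eq hF h
    have e2 := ncard_comp_eq hF hxy
    rw [comp_eq hx] at e2
    omega
  obtain ⟨u, hu, hs⟩ := exists_side_subset hF h hx
  have hle : M ≤ (side F x u).ncard := by
    rcases hs with ⟨-, hs⟩ | ⟨-, hs⟩
    · exact h1 ▸ Set.ncard_le_ncard hs
    · exact h2 ▸ Set.ncard_le_ncard hs
  have huy : u ≠ y := by rintro rfl; omega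
  have hlt := ncard_side_lt_side hF hxy.symm hu huy
  refine ⟨u, hu, huy, fun w hw => ?_, ?_⟩
  -- With a third neighbour w, the side of x would contain x, the M vertices behind u and something
  -- behind w: more than M + 1.
  · by_contra! hne
    have hd := disjoint_side_side hF hu hw hne.2.symm
    have hx' : x ∉ side F x u ∪ side F x w := by
      rintro (h | h)
      · exact not_mem_side hu.ne' h
      · exact not_mem_side hw.ne' h
    have hsub : insert x (side F x u ∪ side F x w) ⊆ side F y x := by
      rw [Set.insert_subset_iff, Set.union_subset_iff]
      exact ⟨mem_comp_self, side_subset_side hF hxy.symm hu huy,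
        side_subset_side hF hxy.symm hw hne.1⟩
    have := Set.ncard_le_ncard hsub
    rw [Set.ncard_insert_of_notMem hx', Set.ncard_union_eq hd] at this
    have : 0 < (side F x w).ncard := ncard_comp_pos
    omega
  · rcases hs with ⟨hxs, hs⟩ | ⟨hxs, hs⟩
    · exact Or.inl (eq_of_side_eq hF h hu hxs (Set.eq_of_subset_of_ncard_le hs (by omega)))
    · exact Or.inr (eq_of_side_eq hF h.symm hu hxs (Set.eq_of_subset_of_ncard_le hs (by omega)))

theorem cls_eq_of_two (hF : F.IsAcyclic) (hF' : F'.IsAcyclic) {w₁ w₂ w₁' w₂' : V}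
    (h : ∀ x, F.Adj v x ↔ x = w₁ ∨ x = w₂) (hne : w₁ ≠ w₂)
    (h' : ∀ x, F'.Adj v' x ↔ x = w₁' ∨ x = w₂') (hne' : w₁' ≠ w₂')
    (h1 : cls (isolate F v) w₁ = cls (isolate F' v') w₁')
    (h2 : cls (isolate F v) w₂ = cls (isolate F' v') w₂') : cls F v = cls F' v' := by
  classical
  have key : ∀ {F : SimpleGraph V} {v w₁ w₂ : V}, (∀ x, F.Adj v x ↔ x = w₁ ∨ x = w₂) →
      w₁ ≠ w₂ → kids F v = {cls (isolate F v) w₁, cls (isolate F v) w₂} := by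
    intro F v w₁ w₂ h hne
    have : nbrs F v = {w₁, w₂} := by
      ext x; rw [mem_nbrs, h]; simp
    rw [kids, mkids, this, Finset.insert_val_of_notMem (by simpa using hne)]
    rfl
  rw [cls_eq_iff_kids hF hF', key h hne, key h' hne', h1, h2]

theorem Leg.exists_adj {i : ℕ} (h : Leg F v i) : ∃ w, F.Adj v w := by
  cases i with
  | zero => obtain ⟨x, -, -, hx, -⟩ := h; exact ⟨x, hx⟩
  | succ i => obtain ⟨x, hx, -⟩ := h; exact ⟨x, hx⟩

theorem Leg.exists_adj_ne {i : ℕ} (h : Leg F v i)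
    (hl : ∀ y z, F.Adj l y → F.Adj l z → y = z) : ∃ w, F.Adj v w ∧ w ≠ l := by
  cases i with
  | zero =>
    obtain ⟨x, y, hne, hx, hy⟩ := h
    by_cases hxl : x = l
    · exact ⟨y, hy, fun e => hne (hxl.trans e.symm)⟩
    · exact ⟨x, hx, hxl⟩
  | succ i =>
    obtain ⟨x, hx, -, hleg⟩ := h
    refine ⟨x, hx, ?_⟩
    rintro rfl
    obtain ⟨y, hy⟩ := hleg.exists_adj
    exact hy.2.2 (hl _ _ hx.symm hy.1).symm

end Finite

/-- Deleting the edge `vw` does not change a side that does not contain `v`. -/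
theorem isolate_edgeCard_adj (hv : v ∉ comp (isolate X p) q) (hx : x ∈ comp (isolate X p) q) :
    (isolate (edgeCard X s(v, w)) p).Adj x y ↔ (isolate X p).Adj x y := by
  rw [isolate_adj, isolate_adj, edgeCard_adj_iff]
  refine ⟨fun h => ⟨h.1.1, h.2⟩, fun h => ⟨⟨h.1, ?_, ?_⟩, h.2⟩⟩
  · rintro ⟨rfl, -⟩; exact hv hx
  · rintro ⟨-, rfl⟩; exact hv (comp_adj hx h)

theorem side_edgeCard (hv : v ∉ side X p q) : side (edgeCard X s(v, w)) p q = side X p q :=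
  comp_congr fun _ hx _ => isolate_edgeCard_adj hv hx

theorem cls_isolate_edgeCard (hv : v ∉ side X p q) :
    cls (isolate (edgeCard X s(v, w)) p) q = cls (isolate X p) q :=
  cls_congr fun _ hx _ => isolate_edgeCard_adj hv hx

theorem isolate_addEdge_adj (hs : s ∉ comp (isolate F p) q) (ht : t ∉ comp (isolate F p) q)
    (hx : x ∈ comp (isolate F p) q) :
    (isolate (addEdge F s t) p).Adj x y ↔ (isolate F p).Adj x y := by
  have h1 : x ≠ s := by rintro rfl; exact hs hx
  have h2 : x ≠ t := by rintro rfl; exact ht hx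
  rw [isolate_adj, isolate_adj, addEdge_adj_of_ne h1 h2]

theorem side_addEdge (hs : s ∉ side F p q) (ht : t ∉ side F p q) :
    side (addEdge F s t) p q = side F p q :=
  comp_congr fun _ hx _ => isolate_addEdge_adj hs ht hx

theorem cls_isolate_addEdge (hs : s ∉ side F p q) (ht : t ∉ side F p q) :
    cls (isolate (addEdge F s t) p) q = cls (isolate F p) q :=
  cls_congr fun _ hx _ => isolate_addEdge_adj hs ht hx

/-- A leaf `l₀` behind `a`, whose neighbour `u₀` has degree two and the other neighbour `w₀`. -/
structure EndEdge (T : SimpleGraph V) (a b l₀ u₀ w₀ : V) : Prop where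
  mem : l₀ ∈ side T b a
  mem' : u₀ ∈ side T b a
  adj_l : ∀ x, T.Adj l₀ x ↔ x = u₀
  adj_u : ∀ x, T.Adj u₀ x ↔ x = l₀ ∨ x = w₀
  ne : l₀ ≠ w₀

namespace EndEdge
variable [Finite V]

theorem adj (e : EndEdge T a b l₀ u₀ w₀) : T.Adj u₀ w₀ := (e.adj_u _).2 (Or.inr rfl)

theorem comp_eq_pair (e : EndEdge T a b l₀ u₀ w₀) :
    comp (edgeCard T s(u₀, w₀)) u₀ = {u₀, l₀} := by
  apply Set.Subset.antisymm
  · refine comp_subset (Or.inl rfl) ?_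
    rintro x (rfl | rfl) y hxy
    · rw [edgeCard_adj_iff, e.adj_u] at hxy
      right
      exact hxy.1.resolve_right fun h => hxy.2.1 ⟨rfl, h⟩
    · exact Or.inl ((e.adj_l y).1 (edgeCard_le hxy))
  · rintro x (rfl | rfl)
    · exact mem_comp_self
    · refine mem_comp_of_adj ?_
      have := (e.adj_u x).2 (Or.inl rfl)
      rw [edgeCard_adj_iff]
      exact ⟨this, fun h => e.ne h.2, fun h => this.ne h.2.symm⟩

theorem side_eq_pair (h : Balanced T a b c d) (e : EndEdge T a b l₀ u₀ w₀) :
    side T w₀ u₀ = {u₀, l₀} := by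
  rw [← comp_edgeCard h.acyc e.adj, e.comp_eq_pair]

theorem not_mem (h : Balanced T a b c d) (e : EndEdge T a b l₀ u₀ w₀) (hx : x ∈ side T a b) :
    x ≠ u₀ ∧ x ≠ l₀ := by
  have := Set.disjoint_left.1 h.disj
  exact ⟨fun h => this (h ▸ e.mem') hx, fun h => this (h ▸ e.mem) hx⟩

theorem mem_comp (h : Balanced T a b c d) (e : EndEdge T a b l₀ u₀ w₀) (hu : x ≠ u₀)
    (hl : x ≠ l₀) : x ∈ comp (edgeCard T s(u₀, w₀)) b := by
  have key : ∀ x, x ≠ u₀ → x ≠ l₀ → x ∈ comp (edgeCard T s(u₀, w₀)) w₀ := by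
    intro x hu hl
    have h1 : x ∈ comp T u₀ := by rw [isTree_comp h.isTree]; trivial
    rw [comp_eq_union e.adj, e.side_eq_pair h] at h1
    rw [comp_edgeCard' h.acyc e.adj]
    exact h1.resolve_left fun h => h.elim hu hl
  have hb := e.not_mem h (x := b) mem_comp_self
  rw [comp_eq (key b hb.1 hb.2)]
  exact key x hu hl

theorem adj_bd (h : Balanced T a b c d) (e : EndEdge T a b l₀ u₀ w₀) :
    (edgeCard T s(u₀, w₀)).Adj b d := by
  have h1 := (e.not_mem h (x := b) mem_comp_self).1
  have h2 := (e.not_mem h (x := d) (h.symm.side_ac_subset mem_comp_self)).1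
  rw [edgeCard_adj_iff]
  exact ⟨h.adj_bd, fun h => h1 h.1, fun h => h2 h.2⟩

/-- That no vertex of this card is isolated will force a competitor to reattach the leaf m. -/
theorem exists_adj (h : Balanced T a b c d) (e : EndEdge T a b l₀ u₀ w₀) (x : V) :
    ∃ y, (edgeCard T s(u₀, w₀)).Adj x y := by
  have hul : (edgeCard T s(u₀, w₀)).Adj u₀ l₀ := by
    have : l₀ ∈ comp (edgeCard T s(u₀, w₀)) u₀ := by rw [e.comp_eq_pair]; exact Or.inr rfl
    have hadj := (e.adj_u l₀).2 (Or.inl rfl)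
    rw [edgeCard_adj_iff]
    exact ⟨hadj, fun h => e.ne h.2, fun h => hadj.ne h.2.symm⟩
  by_cases hu : x = u₀
  · exact ⟨l₀, hu ▸ hul⟩
  by_cases hl : x = l₀
  · exact ⟨u₀, hl ▸ hul.symm⟩
  by_cases hb : x = b
  · exact ⟨d, hb ▸ e.adj_bd h⟩
  obtain ⟨y, hy, -⟩ := exists_adj_of_mem_comp (mem_comp_comm.1 (e.mem_comp h hu hl)) (Ne.symm hb)
  exact ⟨y, hy⟩

theorem not_mem_side_bd (h : Balanced T a b c d) (e : EndEdge T a b l₀ u₀ w₀) :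
    u₀ ∉ side T b d := fun hu => (e.not_mem h (h.symm.side_ac_subset hu)).1 rfl

theorem ncard_bd (h : Balanced T a b c d) (e : EndEdge T a b l₀ u₀ w₀) :
    (side (edgeCard T s(u₀, w₀)) b d).ncard + 1 = (side T b a).ncard := by
  rw [side_edgeCard (e.not_mem_side_bd h), h.symm.ncard_c, h.size]

/-- The cut removes two of the N vertices of G, and b is now counted on this side: N - 2 + 1 = N -
1. So bd halves the large component. -/
theorem ncard_db (h : Balanced T a b c d) (e : EndEdge T a b l₀ u₀ w₀) :
    (side (edgeCard T s(u₀, w₀)) d b).ncard + 1 = (side T b a).ncard := by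
  have h1 := ncard_comp_eq (isAcyclic_edgeCard h.acyc) (e.adj_bd h)
  have h2 := e.ncard_bd h
  have h3 := ncard_comp_eq h.acyc e.adj
  have h4 := ncard_comp_eq h.acyc h.adj
  rw [isTree_comp h.isTree] at h3 h4
  have hne : u₀ ≠ l₀ := ((e.adj_u l₀).2 (Or.inl rfl)).ne
  rw [e.side_eq_pair h, Set.ncard_pair hne, ← comp_edgeCard' h.acyc e.adj] at h3
  have hb := e.not_mem h (x := b) mem_comp_self
  have h5 : w₀ ∈ comp (edgeCard T s(u₀, w₀)) b := e.mem_comp h e.adj.ne' e.ne.symm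
  rw [comp_eq h5] at h3
  have h6 := h.size
  omega

theorem cls_bd (h : Balanced T a b c d) (e : EndEdge T a b l₀ u₀ w₀) :
    cls (isolate (edgeCard T s(u₀, w₀)) b) d = cls (isolate T b) d :=
  cls_isolate_edgeCard (e.not_mem_side_bd h)

/-- Entered from d, the path runs through b to a and on along the leg of G; deleting edges cannot
bring its branching closer. -/
theorem le_of_leg (h : Balanced T a b c d) {i j : ℕ} (ha : Leg (isolate T b) a i)
    (hj : Leg (isolate (edgeCard T s(u₀, w₀)) d) b j) : i + 1 ≤ j := by
  obtain ⟨k, hk, hl⟩ := hj.exists_of_le (isolate_mono edgeCard_le)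
  have h1 : ∀ y, (isolate T d).Adj b y ↔ y = a := by
    intro y
    rw [isolate_adj, h.adj_b]
    have h2 := h.adj_bd.ne
    have h3 := h.d_ne
    constructor
    · tauto
    · rintro rfl; exact ⟨Or.inl rfl, h2, h3.symm⟩
  have h2 : Leg (isolate T d) b (i + 1) := ⟨a, (h1 a).2 rfl, fun y hy => (h1 y).1 hy,
    ha.of_mcls_eq (cls_isolate_isolate h.acyc h.adj_bd.symm h.adj.symm h.d_ne.symm).symm⟩
  have := h2.unique hl
  omega

/-- How `T - u₀w₀` sits in a graph that has it as a card. -/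
theorem exists_of_iso (h : Balanced T a b c d) (e : EndEdge T a b l₀ u₀ w₀) (hX : X.IsTree)
    {x₁ x₂ : V} (hx : X.Adj x₁ x₂) (φ : edgeCard X s(x₁, x₂) ≃g edgeCard T s(u₀, w₀)) {i : ℕ}
    (ha : Leg (isolate T b) a i) :
    ∃ v v' w, s(x₁, x₂) = s(v, w) ∧ (∀ t, X.Adj v' t → t = v) ∧
      (∀ t, X.Adj v t → t = v' ∨ t = w) ∧ ∃ s t, (edgeCard X s(v, w)).Adj s t ∧
      (side (edgeCard X s(v, w)) s t).ncard + 1 = (side T b a).ncard ∧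
      (side (edgeCard X s(v, w)) t s).ncard + 1 = (side T b a).ncard ∧
      cls (isolate (edgeCard X s(v, w)) s) t = cls (isolate T b) d ∧
      (∀ j, Leg (isolate (edgeCard X s(v, w)) t) s j → i + 1 ≤ j) ∧
      ∀ x, x ≠ v → x ≠ v' → x ∈ comp (edgeCard X s(v, w)) s := by
  have hXa := hX.isAcyclic
  have hne : u₀ ≠ l₀ := ((e.adj_u l₀).2 (Or.inl rfl)).ne
  -- The two-vertex component of the card appears in X as v, v', where v is the end of the deleted
  -- edge on its side. So v' is a leaf of X and v has no neighbours besides v' and w.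
  have key : ∀ v w, X.Adj v w → φ.symm u₀ ∈ comp (edgeCard X s(x₁, x₂)) v →
      s(x₁, x₂) = s(v, w) → ∃ v', (∀ t, X.Adj v' t → t = v) ∧ (∀ t, X.Adj v t → t = v' ∨ t = w) ∧
      ∀ x, x ≠ v → x ≠ v' → φ x ≠ u₀ ∧ φ x ≠ l₀ := by
    intro v w hvw hu hs
    have hcomp : ∀ x, x ∈ comp (edgeCard X s(x₁, x₂)) v ↔ φ x = u₀ ∨ φ x = l₀ := by
      intro x
      rw [← comp_eq hu, EdgeReconstruction.mem_comp, ← φ.reachable_iff, φ.apply_symm_apply,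
        ← EdgeReconstruction.mem_comp, e.comp_eq_pair]
      rfl
    obtain ⟨v', hv', hvv⟩ : ∃ v', (∀ x, x ∈ comp (edgeCard X s(x₁, x₂)) v ↔ x = v ∨ x = v') ∧
        v ≠ v' := by
      have hx' : ∀ x z, φ x = z ↔ x = φ.symm z := fun x z =>
        ⟨fun h => by rw [← h, φ.symm_apply_apply], fun h => by rw [h, φ.apply_symm_apply]⟩
      have hne' : φ.symm u₀ ≠ φ.symm l₀ := fun h => hne (φ.symm.injective h)
      rcases (hcomp v).1 mem_comp_self with hv | hv
      · rw [hx'] at hv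
        refine ⟨φ.symm l₀, fun x => ?_, hv ▸ hne'⟩
        rw [hcomp, hx', hx', hv]
      · rw [hx'] at hv
        refine ⟨φ.symm u₀, fun x => ?_, hv ▸ hne'.symm⟩
        rw [hcomp, hx', hx', hv, or_comm]
    rw [hs] at hv'
    have hw : w ∉ comp (edgeCard X s(v, w)) v := by
      rw [comp_edgeCard hXa hvw]; exact not_mem_side hvw.ne
    have hv'w : v' ≠ w := fun h => hw ((hv' w).2 (Or.inr h.symm))
    have h1 : ∀ t, X.Adj v t → t = v' ∨ t = w := by
      intro t ht
      by_cases htw : t = w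
      · exact Or.inr htw
      · have : (edgeCard X s(v, w)).Adj v t :=
          edgeCard_adj_iff.2 ⟨ht, fun h => htw h.2, fun h => hvw.ne h.1⟩
        exact Or.inl (((hv' t).1 (mem_comp_of_adj this)).resolve_left ht.ne')
    refine ⟨v', ?_, h1, ?_⟩
    · intro t ht
      have : (edgeCard X s(v, w)).Adj v' t :=
        edgeCard_adj_iff.2 ⟨ht, fun h => hvv h.1.symm, fun h => hv'w h.1⟩
      exact ((hv' t).1 (comp_adj ((hv' v').2 (Or.inr rfl)) this)).resolve_right ht.ne'
    · intro x hxv hxv'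
      rw [← not_or, ← hcomp x, hs, hv' x]
      exact fun h => h.elim hxv hxv'
  obtain ⟨v, w, hvw, hs, v', h3, h4, h5⟩ : ∃ v w, X.Adj v w ∧ s(x₁, x₂) = s(v, w) ∧
      ∃ v', (∀ t, X.Adj v' t → t = v) ∧ (∀ t, X.Adj v t → t = v' ∨ t = w) ∧
      ∀ x, x ≠ v → x ≠ v' → φ x ≠ u₀ ∧ φ x ≠ l₀ := by
    have hu : φ.symm u₀ ∈ comp X x₁ := by rw [isTree_comp hX]; trivial
    rw [comp_eq_union hx, ← comp_edgeCard hXa hx, ← comp_edgeCard' hXa hx] at hu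
    rcases hu with hu | hu
    · exact ⟨x₁, x₂, hx, rfl, key x₁ x₂ hx hu rfl⟩
    · exact ⟨x₂, x₁, hx.symm, Sym2.eq_swap, key x₂ x₁ hx.symm hu Sym2.eq_swap⟩
  refine ⟨v, v', w, hs, h3, h4, φ.symm b, φ.symm d, ?_⟩
  rw [← hs]
  have hiso : ∀ p q, ∃ f, RootedIso (isolate (edgeCard T s(u₀, w₀)) p)
      (isolate (edgeCard X s(x₁, x₂)) (φ.symm p)) ∅ ∅ q (φ.symm q) f := fun p q =>
    ⟨φ.symm, RootedIso.of_closed (S := Set.univ) (S' := Set.univ)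
      (Set.bijOn_univ.2 φ.symm.bijective) (fun _ _ _ _ => trivial) (fun _ _ _ _ => trivial)
      (fun x _ y _ => by
        rw [isolate_adj, isolate_adj, φ.symm.map_adj_iff, φ.symm.injective.ne_iff,
          φ.symm.injective.ne_iff]) (fun x _ => Iff.rfl) trivial⟩
  have hcls : ∀ p q, cls (isolate (edgeCard X s(x₁, x₂)) (φ.symm p)) (φ.symm q) =
      cls (isolate (edgeCard T s(u₀, w₀)) p) q := fun p q => (mcls_eq_iff.2 (hiso p q)).symm
  refine ⟨φ.symm.map_adj_iff.2 (e.adj_bd h), ?_, ?_, ?_, ?_, ?_⟩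
  · rw [← e.ncard_bd h]; exact congrArg (· + 1) (ncard_eq_of_mcls_eq (hcls b d))
  · rw [← e.ncard_db h]; exact congrArg (· + 1) (ncard_eq_of_mcls_eq (hcls d b))
  · rw [← e.cls_bd h]; exact hcls b d
  · intro j hj
    exact le_of_leg h ha (hj.of_mcls_eq (hcls d b))
  · intro x hx hx'
    have := h5 x hx hx'
    rw [EdgeReconstruction.mem_comp, ← φ.reachable_iff, φ.apply_symm_apply]
    exact e.mem_comp h this.1 this.2

end EndEdge

end EndEdge

/-! ### Moving a leaf: locating the halving edge -/

section MovedLeaf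

variable {F F' T X Y : SimpleGraph V} {m : V} {i j : ℕ}
  {a a' b b' c d l n n' p q r r' s s' t u u₀ l₀ w₀ v v' w w' x y z : V} {S : Set V}

/-- The graph obtained from `T` by replacing the edges at `m` by the single edge `mz`. -/
abbrev reattach (T : SimpleGraph V) (m z : V) : SimpleGraph V := addEdge (isolate T m) m z

theorem side_isolate (h : x ∉ side F p q) : side (isolate F x) p q = side F p q := by
  rw [side, isolate_comm]; exact comp_isolate h

theorem cls_isolate_side (h : x ∉ side F p q) :
    cls (isolate (isolate F x) p) q = cls (isolate F p) q := by
  rw [isolate_comm]; exact cls_isolate h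

theorem side_reattach (hm : m ∉ side T p q) (hz : z ∉ side T p q) :
    side (reattach T m z) p q = side T p q := by
  have h := side_isolate hm
  rw [side_addEdge (by rwa [h]) (by rwa [h]), h]

theorem cls_reattach (hm : m ∉ side T p q) (hz : z ∉ side T p q) :
    cls (isolate (reattach T m z) p) q = cls (isolate T p) q := by
  have h := side_isolate hm
  rw [cls_isolate_addEdge (by rwa [h]) (by rwa [h]), cls_isolate_side hm]

theorem isTree_reattach (hT : T.IsTree) (hm : ∀ x y, T.Adj m x → T.Adj m y → x = y)
    (hne : m ≠ z) : (reattach T m z).IsTree := by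
  have h1 : comp (isolate T m) z = comp T z \ {m} := comp_isolate_of_leaf hm hne.symm
  rw [isTree_comp hT] at h1
  refine isTree_of_comp (v := z) (isAcyclic_addEdge (isAcyclic_isolate hT.isAcyclic) ?_) ?_
  · rw [comp_isolate_self]; exact hne.symm
  · rw [comp_addEdge mem_comp_self, h1, comp_isolate_self]
    ext x; simp

/-- A tree `X` obtained from `T` by moving a leaf `m` behind `b` to another vertex `z`, with an edge
`vw`, where `v` has degree two and a leaf `v'` as a neighbour, so that `X - vw` has an edge `st` with
equal sides that looks like the edge `bd` in a subgraph of `T`. -/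
structure MovedLeaf (T : SimpleGraph V) (a b c d m z v v' w s t : V) (i j : ℕ) : Prop where
  bal : Balanced T a b c d
  leg_c : Leg (isolate T a) c i
  leg_d : Leg (isolate T b) d j
  le : j ≤ i
  cls_ne : cls (isolate T a) c ≠ cls (isolate T b) d
  mem : m ∈ side T a b
  leaf : ∀ x y, T.Adj m x → T.Adj m y → x = y
  ne : m ≠ z
  leaf_v : ∀ x, (reattach T m z).Adj v' x → x = v
  nbr_v : ∀ x, (reattach T m z).Adj v x → x = v' ∨ x = w
  adj_st : (edgeCard (reattach T m z) s(v, w)).Adj s t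
  ncard_st : (side (edgeCard (reattach T m z) s(v, w)) s t).ncard + 1 = (side T b a).ncard
  ncard_ts : (side (edgeCard (reattach T m z) s(v, w)) t s).ncard + 1 = (side T b a).ncard
  cls_st : cls (isolate (edgeCard (reattach T m z) s(v, w)) s) t = cls (isolate T b) d
  leg_ts : ∀ k, Leg (isolate (edgeCard (reattach T m z) s(v, w)) t) s k → i + 2 ≤ k
  mem_comp : ∀ x, x ≠ v → x ≠ v' → x ∈ comp (edgeCard (reattach T m z) s(v, w)) s

theorem adj_of_reattach_adj (h : (reattach T m z).Adj x y) (hx : x ≠ m) (hy : y ≠ m) :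
    T.Adj x y := by
  rcases addEdge_adj.1 h with h | ⟨-, ⟨h, -⟩ | ⟨-, h⟩⟩
  · exact h.1
  · exact absurd h hx
  · exact absurd h hy

theorem Balanced.leg_of_leg [Finite V] (h : Balanced T a b c d) (hc : Leg (isolate T a) c i) :
    Leg (isolate T b) a (i + 1) :=
  ⟨c, h.side_ac_adj.2 rfl, fun _ hy => h.side_ac_adj.1 hy, hc.of_mcls_eq h.cls_isolate_c.symm⟩

namespace MovedLeaf
variable [Finite V]

theorem ne_b (k : MovedLeaf T a b c d m z v v' w s t i j) : m ≠ b := by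
  rintro rfl
  exact k.bal.d_ne (k.leaf _ _ k.bal.adj_bd k.bal.adj.symm)

theorem not_mem (k : MovedLeaf T a b c d m z v v' w s t i j) : m ∉ side T b a :=
  fun h => Set.disjoint_left.1 k.bal.disj h k.mem

theorem ne_a (k : MovedLeaf T a b c d m z v v' w s t i j) : m ≠ a :=
  fun e => k.not_mem (e ▸ mem_comp_self)

theorem not_mem_c (k : MovedLeaf T a b c d m z v v' w s t i j) : m ∉ side T a c :=
  fun h => k.not_mem (k.bal.side_ac_subset h)

theorem ne_c (k : MovedLeaf T a b c d m z v v' w s t i j) : m ≠ c :=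
  fun e => k.not_mem_c (e ▸ mem_comp_self)

theorem exists_adj_c (k : MovedLeaf T a b c d m z v v' w s t i j) :
    ∃ x, T.Adj c x ∧ x ≠ a ∧ x ≠ m := by
  obtain ⟨x, hx⟩ := k.leg_c.exists_adj
  exact ⟨x, hx.1, hx.2.2, fun e => k.not_mem_c (e ▸ mem_comp_of_adj hx)⟩

theorem exists_adj_d (k : MovedLeaf T a b c d m z v v' w s t i j) :
    ∃ x, T.Adj d x ∧ x ≠ b ∧ x ≠ m := by
  obtain ⟨x, hx, hxm⟩ := k.leg_d.exists_adj_ne (l := m) fun y z hy hz => k.leaf y z hy.1 hz.1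
  exact ⟨x, hx.1, hx.2.2, hxm⟩

theorem ne_d (k : MovedLeaf T a b c d m z v v' w s t i j) : m ≠ d := by
  rintro rfl
  obtain ⟨x, hx, hxb, -⟩ := k.exists_adj_d
  exact hxb (k.leaf _ _ hx k.bal.adj_bd.symm)

theorem reattach_adj_of_adj (h : T.Adj x y) (hx : m ≠ x) (hy : m ≠ y) :
    (reattach T m z).Adj x y :=
  le_addEdge ⟨h, hx.symm, hy.symm⟩

theorem isTree (k : MovedLeaf T a b c d m z v v' w s t i j) : (reattach T m z).IsTree :=
  isTree_reattach k.bal.isTree k.leaf k.ne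

theorem ab (k : MovedLeaf T a b c d m z v v' w s t i j) : (reattach T m z).Adj a b :=
  reattach_adj_of_adj k.bal.adj k.ne_a k.ne_b

theorem ac (k : MovedLeaf T a b c d m z v v' w s t i j) : (reattach T m z).Adj a c :=
  reattach_adj_of_adj k.bal.adj_ac k.ne_a k.ne_c

theorem bd (k : MovedLeaf T a b c d m z v v' w s t i j) : (reattach T m z).Adj b d :=
  reattach_adj_of_adj k.bal.adj_bd k.ne_b k.ne_d

theorem v'_ne_a (k : MovedLeaf T a b c d m z v v' w s t i j) : v' ≠ a := by
  rintro rfl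
  exact k.bal.c_ne ((k.leaf_v _ k.ac).trans (k.leaf_v _ k.ab).symm)

theorem v'_ne_b (k : MovedLeaf T a b c d m z v v' w s t i j) : v' ≠ b := by
  rintro rfl
  exact k.bal.d_ne ((k.leaf_v _ k.bd).trans (k.leaf_v _ k.ab.symm).symm)

/-- The neighbours of v are among v' and w, and v' is a leaf. But a keeps its neighbours b and c,
and each of these has a further neighbour after m has been moved. -/
theorem v_ne_a (k : MovedLeaf T a b c d m z v v' w s t i j) : v ≠ a := by
  rintro rfl
  rcases k.nbr_v _ k.ab with h | h
  · exact k.v'_ne_b h.symm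
  rcases k.nbr_v _ k.ac with h' | h'
  · obtain ⟨x, hx, hxa, hxm⟩ := k.exists_adj_c
    subst h'
    exact hxa (k.leaf_v _ (reattach_adj_of_adj hx k.ne_c hxm.symm))
  · exact k.bal.c_ne (h'.trans h.symm)

theorem v_ne_b (k : MovedLeaf T a b c d m z v v' w s t i j) : v ≠ b := by
  rintro rfl
  rcases k.nbr_v _ k.ab.symm with h | h
  · exact k.v'_ne_a h.symm
  rcases k.nbr_v _ k.bd with h' | h'
  · obtain ⟨x, hx, hxa, hxm⟩ := k.exists_adj_d
    subst h'
    exact hxa (k.leaf_v _ (reattach_adj_of_adj hx k.ne_d hxm.symm))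
  · exact k.bal.d_ne (h'.trans h.symm)

theorem edgeCard_adj_of_ne (h : (reattach T m z).Adj x y) (hx : v ≠ x) (hy : v ≠ y) :
    (edgeCard (reattach T m z) s(v, w)).Adj x y :=
  edgeCard_adj_iff.2 ⟨h, fun h => hx h.1.symm, fun h => hy h.2.symm⟩

theorem a_mem (k : MovedLeaf T a b c d m z v v' w s t i j) :
    a ∈ comp (edgeCard (reattach T m z) s(v, w)) s := k.mem_comp a k.v_ne_a.symm k.v'_ne_a.symm

theorem b_mem (k : MovedLeaf T a b c d m z v v' w s t i j) :
    b ∈ comp (edgeCard (reattach T m z) s(v, w)) s := k.mem_comp b k.v_ne_b.symm k.v'_ne_b.symm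

theorem acyc (k : MovedLeaf T a b c d m z v v' w s t i j) :
    (edgeCard (reattach T m z) s(v, w)).IsAcyclic := isAcyclic_edgeCard k.isTree.isAcyclic

theorem ncard_ab (k : MovedLeaf T a b c d m z v v' w s t i j) :
    (side (isolate T m) a b).ncard + 1 = (side T b a).ncard := by
  have : side (isolate T m) a b = side T a b \ {m} := by
    rw [side, isolate_comm]
    exact comp_isolate_of_leaf (fun x y hx hy => k.leaf x y hx.1 hy.1) k.ne_b.symm
  rw [this, Set.ncard_sdiff_singleton_add_one k.mem, k.bal.size]

/-- An edge with sides of the right size is the edge `st`. -/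
theorem elim (k : MovedLeaf T a b c d m z v v' w s t i j)
    (hpq : (edgeCard (reattach T m z) s(v, w)).Adj p q)
    (hp : p ∈ comp (edgeCard (reattach T m z) s(v, w)) s)
    (hc : (side (edgeCard (reattach T m z) s(v, w)) p q).ncard + 1 = (side T b a).ncard) :
    cls (isolate (edgeCard (reattach T m z) s(v, w)) p) q = cls (isolate T b) d ∨
    ∀ l, Leg (isolate (edgeCard (reattach T m z) s(v, w)) p) q l → i + 2 ≤ l := by
  have h1 := k.ncard_st
  have h2 := k.ncard_ts
  rcases eq_or_eq_of_ncard_side k.acyc k.adj_st rfl (by omega) hpq hp (by omega) with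
    ⟨rfl, rfl⟩ | ⟨rfl, rfl⟩
  · exact Or.inl k.cls_st
  · exact Or.inr k.leg_ts

/-- A side of `T` that is not affected by the changes is not equivalent to one at `st`. -/
theorem false_of_side_ac (k : MovedLeaf T a b c d m z v v' w s t i j) (hz : z ∉ side T a c)
    (hv : v ∈ side (reattach T m z) a b) : False := by
  have hva : v ∉ side (reattach T m z) a c := fun h =>
    Set.disjoint_left.1 (disjoint_side_side k.isTree.isAcyclic k.ab k.ac k.bal.c_ne.symm) hv h
  have hvc : v ≠ c := fun e => hva (e ▸ mem_comp_self)
  have hs : side (edgeCard (reattach T m z) s(v, w)) a c = side T a c := by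
    rw [side_edgeCard hva, side_reattach k.not_mem_c hz]
  have hcls : cls (isolate (edgeCard (reattach T m z) s(v, w)) a) c = cls (isolate T a) c := by
    rw [cls_isolate_edgeCard hva, cls_reattach k.not_mem_c hz]
  rcases k.elim (edgeCard_adj_of_ne k.ac k.v_ne_a hvc) k.a_mem (by rw [hs]; exact k.bal.ncard_c)
    with h | h
  · exact k.cls_ne (hcls.symm.trans h)
  · have := h i (k.leg_c.of_mcls_eq hcls.symm)
    omega

theorem not_mem_ab_of_mem (k : MovedLeaf T a b c d m z v v' w s t i j) (hz : z ∈ side T b a) :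
    m ∉ side (isolate T m) a b ∧ z ∉ side (isolate T m) a b := by
  refine ⟨?_, fun h => ?_⟩
  · exact not_mem_comp_of_isolated (F := isolate (isolate T m) a)
      (fun x hx => hx.1.2.1 rfl) k.ne_b.symm
  · exact Set.disjoint_left.1 k.bal.disj hz (comp_mono (isolate_mono isolate_le) h)

/-- With z and v on the side of a, the tree H - m is intact and has N - 1 vertices, so ab is the
halving edge. Then H - m would be a copy of D or have leg at least i + 2. The first choice of m
makes it a copy of C, which differs from D and has leg i; the second gives it leg j + 1, which is
neither j nor above i + 1. -/
theorem false_of_mem_ba (k : MovedLeaf T a b c d m z v v' w s t i j) (hz : z ∈ side T b a)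
    (hv : v ∈ side (reattach T m z) b a)
    (hm : cls (isolate (isolate T m) a) b = cls (isolate T a) c ∨
      Leg (isolate (isolate T m) a) b (j + 1)) : False := by
  have hva : v ∉ side (reattach T m z) a b := fun h =>
    Set.disjoint_left.1 (disjoint_side k.isTree.isAcyclic k.ab) h hv
  have hs : side (edgeCard (reattach T m z) s(v, w)) a b = side (isolate T m) a b := by
    rw [side_edgeCard hva, side_addEdge (k.not_mem_ab_of_mem hz).1 (k.not_mem_ab_of_mem hz).2]
  have hcls : cls (isolate (edgeCard (reattach T m z) s(v, w)) a) b =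
      cls (isolate (isolate T m) a) b := by
    rw [cls_isolate_edgeCard hva,
      cls_isolate_addEdge (k.not_mem_ab_of_mem hz).1 (k.not_mem_ab_of_mem hz).2]
  have hle := k.le
  rcases k.elim (edgeCard_adj_of_ne k.ab k.v_ne_a k.v_ne_b) k.a_mem (by rw [hs]; exact k.ncard_ab)
    with h | h
  · rw [hcls] at h
    rcases hm with hm | hm
    · exact k.cls_ne (hm.symm.trans h)
    · have := k.leg_d.unique (hm.of_mcls_eq h)
      omega
  · rcases hm with hm | hm
    · have := h i (k.leg_c.of_mcls_eq (hcls.trans hm).symm)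
      omega
    · have := h _ (hm.of_mcls_eq hcls.symm)
      omega

/-- Here m stays behind b while v lies behind a, so the side of b has N vertices, one too many for a
half. Hence b is an end of the halving edge, its only other neighbour is d, and that edge is bd. In
the right direction X has the branches G and D at b, as T has; in the wrong one D would be a copy of
b with a part of G, whose leg exceeds i. -/
theorem nonempty_iso_of_mem_ab (k : MovedLeaf T a b c d m z v v' w s t i j)
    (hz : z ∈ side T a b) (hv : v ∈ side (reattach T m z) b a) :
    Nonempty (reattach T m z ≃g T) := by
  have hXa := k.isTree.isAcyclic
  have hva : v ∉ side (reattach T m z) a b := fun h =>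
    Set.disjoint_left.1 (disjoint_side hXa k.ab) h hv
  have hza : z ∉ side T b a := fun h => Set.disjoint_left.1 k.bal.disj h hz
  have hzne : z ≠ a := fun e => hza (e ▸ mem_comp_self)
  have hsize : (side (edgeCard (reattach T m z) s(v, w)) a b).ncard = (side T b a).ncard := by
    have hz' : z ∈ side (isolate T m) a b := by
      have : side (isolate T m) a b = side T a b \ {m} := by
        rw [side, isolate_comm]
        exact comp_isolate_of_leaf (fun x y hx hy => k.leaf x y hx.1 hy.1) k.ne_b.symm
      rw [this]; exact ⟨hz, k.ne.symm⟩
    have hm' : m ∉ side (isolate T m) a b :=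
      not_mem_comp_of_isolated (F := isolate (isolate T m) a) (fun x hx => hx.1.2.1 rfl) k.ne_b.symm
    rw [side_edgeCard hva, side, isolate_addEdge k.ne_a hzne, comp_addEdge hz',
      comp_eq_singleton (v := m) fun x (hx : (isolate (isolate T m) a).Adj m x) => hx.1.2.1 rfl,
      Set.union_singleton,
      Set.ncard_insert_of_notMem (show m ∉ comp (isolate (isolate T m) a) b from hm')]
    exact k.ncard_ab
  have hY : (edgeCard (reattach T m z) s(v, w)).Adj b a :=
    edgeCard_adj_of_ne k.ab.symm k.v_ne_b k.v_ne_a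
  have hvbd : v ∉ side (reattach T m z) b d := fun h =>
    hva (side_subset_side hXa k.ab k.bd k.bal.d_ne h)
  have hvd : v ≠ d := fun e => hvbd (e ▸ mem_comp_self)
  have hYd : (edgeCard (reattach T m z) s(v, w)).Adj b d := edgeCard_adj_of_ne k.bd k.v_ne_b hvd
  obtain ⟨u, hu, hua, hnb, hst⟩ := exists_eq_of_ncard_side k.acyc k.adj_st rfl
    (by have h1 := k.ncard_st; have h2 := k.ncard_ts; omega) hY k.b_mem
    (by have := k.ncard_st; omega)
  obtain rfl : d = u := (hnb d hYd).resolve_left k.bal.d_ne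
  have hnX : ∀ x, (reattach T m z).Adj b x ↔ x = a ∨ x = d := by
    intro x
    refine ⟨fun hx => ?_, ?_⟩
    · by_cases hvx : v = x
      · subst hvx
        exact absurd (eq_of_reachable_isolate hXa k.ab.symm hx hv).symm k.v_ne_a
      · exact hnb x (edgeCard_adj_of_ne hx k.v_ne_b hvx)
    · rintro (rfl | rfl)
      · exact k.ab.symm
      · exact k.bd
  have hsba : side (reattach T m z) b a = side T b a := side_reattach k.not_mem hza
  rcases hst with ⟨rfl, rfl⟩ | ⟨rfl, rfl⟩
  · have h1 : cls (reattach T m z) b = cls T b := by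
      refine cls_eq_of_two hXa k.bal.acyc hnX hua.symm k.bal.adj_b hua.symm
        (cls_reattach k.not_mem hza) ?_
      rw [← k.cls_st]
      exact (cls_isolate_edgeCard hvbd).symm
    exact nonempty_iso_of_cls_eq h1 (isTree_comp k.isTree b) (isTree_comp k.bal.isTree b)
  · exfalso
    have hleg := k.leg_d.of_mcls_eq k.cls_st.symm
    have hnd : ∀ x, (isolate (edgeCard (reattach T m z) s(v, w)) d).Adj b x → x = a :=
      fun x hx => (hnb x hx.1).resolve_right hx.2.2
    cases j with
    | zero =>
      obtain ⟨x, y, hne, hx, hy⟩ := hleg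
      exact hne ((hnd x hx).trans (hnd y hy).symm)
    | succ j =>
      obtain ⟨x, hx, -, hleg⟩ := hleg
      obtain rfl := hnd x hx
      have hm : m ∉ comp (isolate (isolate (edgeCard (reattach T m z) s(v, w)) d) b) x := by
        intro h
        have := comp_mono (isolate_mono (isolate_le.trans edgeCard_le)) h
        change m ∈ side (reattach T m z) b x at this
        rw [hsba] at this
        exact k.not_mem this
      obtain ⟨l, hl, hleg⟩ := (hleg.of_mcls_eq (cls_isolate hm).symm).exists_of_le
        (F := isolate T b)
        fun x y hxy => ⟨adj_of_reattach_adj hxy.1.1.1.1 hxy.2.1 hxy.2.2, hxy.1.2⟩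
      have := hleg.unique (k.bal.leg_of_leg k.leg_c)
      have := k.le
      omega

/-- Now C with m attached has N vertices, so c is an end of the halving edge and has a single
neighbour u besides a. If D is the half behind u, then C with m is D with an edge in front, a copy
of H. In the other direction D would start with c, a, b and continue into H - m, which makes its leg
exceed j. -/
theorem cls_eq_of_mem_ac (k : MovedLeaf T a b c d m z v v' w s t i j) (hz : z ∈ side T a c)
    (hv : v ∈ side (reattach T m z) a b) :
    cls (isolate (reattach T m z) a) c = cls (isolate T a) b := by
  have hXa := k.isTree.isAcyclic
  have hva : v ∉ side (reattach T m z) a c := fun h =>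
    Set.disjoint_left.1 (disjoint_side_side hXa k.ab k.ac k.bal.c_ne.symm) hv h
  have hvc : v ≠ c := fun e => hva (e ▸ mem_comp_self)
  have hza : z ≠ a := fun e => not_mem_side (F := T) k.bal.adj_ac.ne' (e ▸ hz)
  have hsize : (side (edgeCard (reattach T m z) s(v, w)) a c).ncard = (side T b a).ncard := by
    rw [side_edgeCard hva, side, isolate_addEdge k.ne_a hza, comp_addEdge
      (by rw [← side_isolate k.not_mem_c] at hz; exact hz),
      comp_eq_singleton (v := m) fun x (hx : (isolate (isolate T m) a).Adj m x) => hx.1.2.1 rfl,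
      Set.union_singleton, show comp (isolate (isolate T m) a) c = side T a c from
        side_isolate k.not_mem_c, Set.ncard_insert_of_notMem k.not_mem_c]
    exact k.bal.ncard_c
  have hv'c : v' ≠ c := by
    rintro rfl
    exact k.v_ne_a (k.leaf_v a k.ac.symm).symm
  have hY : (edgeCard (reattach T m z) s(v, w)).Adj c a :=
    edgeCard_adj_of_ne k.ac.symm hvc k.v_ne_a
  obtain ⟨u, hu, hua, hnb, hst⟩ := exists_eq_of_ncard_side k.acyc k.adj_st rfl
    (by have h1 := k.ncard_st; have h2 := k.ncard_ts; omega) hY (k.mem_comp c hvc.symm hv'c.symm)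
    (by have := k.ncard_st; omega)
  have huX := edgeCard_le hu
  rcases hst with ⟨rfl, rfl⟩ | ⟨rfl, rfl⟩
  · have hnX : ∀ x, (isolate (reattach T m z) a).Adj c x → x = u := by
      intro x hx
      refine (hnb x (edgeCard_adj_of_ne hx.1 hvc ?_)).resolve_left hx.2.2
      rintro rfl
      exact hva (mem_comp_of_adj hx)
    rw [cls_eq_of_unique (isAcyclic_isolate hXa) (isAcyclic_isolate k.bal.acyc)
      ⟨huX, k.ac.ne', hua⟩ hnX (k.bal.symm.side_ac_adj.2 rfl)
      (fun x hx => k.bal.symm.side_ac_adj.1 hx), k.bal.symm.cls_isolate_c,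
      cls_isolate_isolate hXa k.ac huX hua, ← k.cls_st]
    exact (cls_isolate_edgeCard fun h => hva (side_subset_side hXa k.ac huX hua h)).symm
  · exfalso
    have hleg := k.leg_d.of_mcls_eq k.cls_st.symm
    have hnd : ∀ x, (isolate (edgeCard (reattach T m z) s(v, w)) u).Adj c x → x = a :=
      fun x hx => (hnb x hx.1).resolve_right hx.2.2
    have hna : ∀ x, (isolate (isolate (edgeCard (reattach T m z) s(v, w)) u) c).Adj a x →
        x = b := by
      intro x hx
      rcases addEdge_adj.1 (edgeCard_le hx.1.1) with h | ⟨-, ⟨h, -⟩ | ⟨h, -⟩⟩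
      · exact ((k.bal.adj_a x).1 h.1).resolve_right hx.2.2
      · exact absurd h.symm k.ne_a
      · exact absurd h.symm hza
    cases j with
    | zero =>
      obtain ⟨x, y, hne, hx, hy⟩ := hleg
      exact hne ((hnd x hx).trans (hnd y hy).symm)
    | succ j =>
      obtain ⟨x, hx, -, hleg⟩ := hleg
      obtain rfl := hnd x hx
      cases j with
      | zero =>
        obtain ⟨x, y, hne, hx, hy⟩ := hleg
        exact hne ((hna x hx).trans (hna y hy).symm)
      | succ j =>
        obtain ⟨y, hy, -, hleg⟩ := hleg
        obtain rfl := hna y hy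
        have hm : m ∉ comp (isolate (isolate (isolate (edgeCard (reattach T m z) s(v, w)) u) c) x)
            y := by
          intro h
          have := comp_mono (isolate_mono (isolate_le.trans (isolate_le.trans edgeCard_le))) h
          change m ∈ side (reattach T m z) x y at this
          have h2 := k.not_mem_ab_of_mem (k.bal.side_ac_subset hz)
          rw [side_addEdge h2.1 h2.2] at this
          exact h2.1 this
        obtain ⟨l, hl, hleg⟩ := (hleg.of_mcls_eq (cls_isolate hm).symm).exists_of_le
          (F := isolate T x)
          fun p q hpq => ⟨adj_of_reattach_adj hpq.1.1.1.1.1 hpq.2.1 hpq.2.2, hpq.1.2⟩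
        have := hleg.unique (k.bal.symm.leg_of_leg k.leg_d)
        omega

/-- C with m attached is a copy of H. If H - m is a copy of C, the two branches of T at a have
merely changed places in X. Otherwise the image of m is a leaf l of H for which H - l is a copy of
C, and such leaves were excluded. -/
theorem nonempty_iso_of_mem_ac (k : MovedLeaf T a b c d m z v v' w s t i j) (hz : z ∈ side T a c)
    (hv : v ∈ side (reattach T m z) a b)
    (hm : cls (isolate (isolate T m) a) b = cls (isolate T a) c ∨
      ∀ l ∈ side T a b, (∀ x y, T.Adj l x → T.Adj l y → x = y) →
        cls (isolate (isolate T l) a) b ≠ cls (isolate T a) c) :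
    Nonempty (reattach T m z ≃g T) := by
  have hXa := k.isTree.isAcyclic
  have hza : z ≠ a := fun e => not_mem_side (F := T) k.bal.adj_ac.ne' (e ▸ hz)
  have hcls := k.cls_eq_of_mem_ac hz hv
  rcases hm with hm | hm
  · have hnX : ∀ x, (reattach T m z).Adj a x ↔ x = b ∨ x = c := by
      intro x
      constructor
      · intro hx
        rcases addEdge_adj.1 hx with h | ⟨-, ⟨h, -⟩ | ⟨h, -⟩⟩
        · exact (k.bal.adj_a x).1 h.1
        · exact absurd h.symm k.ne_a
        · exact absurd h.symm hza
      · rintro (rfl | rfl)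
        · exact k.ab
        · exact k.ac
    have h2 := k.not_mem_ab_of_mem (k.bal.side_ac_subset hz)
    have h1 : cls (reattach T m z) a = cls T a := by
      refine cls_eq_of_two hXa k.bal.acyc hnX k.bal.c_ne.symm
        (fun x => (k.bal.adj_a x).trans or_comm) k.bal.c_ne ?_ hcls
      rw [cls_isolate_addEdge h2.1 h2.2, hm]
    exact nonempty_iso_of_cls_eq h1 (isTree_comp k.isTree a) (isTree_comp k.bal.isTree a)
  · exfalso
    obtain ⟨f, hf⟩ := mcls_eq_iff.1 hcls
    have hmz : (isolate (reattach T m z) a).Adj z m :=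
      ⟨(addEdge_adj_self k.ne).symm, hza, k.ne_a⟩
    have hzc : z ∈ comp (isolate (reattach T m z) a) c := by
      rw [isolate_addEdge k.ne_a hza]
      rw [← side_isolate k.not_mem_c] at hz
      exact comp_mono le_addEdge hz
    have hmc := comp_adj hzc hmz
    have hlb : f m ∈ side T a b := hf.bij.mapsTo hmc
    refine hm (f m) hlb ?_ ?_
    · have hfmb : f m ≠ b := by
        rw [← hf.root]
        exact fun e => k.ne_c (hf.bij.injOn hmc mem_comp_self e)
      have key : ∀ x, T.Adj (f m) x → x = f z := by
        intro x hx
        have hxa : x ≠ a := by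
          rintro rfl
          rcases (k.bal.adj_a _).1 hx.symm with h | h
          · exact hfmb h
          · rw [h] at hlb
            exact Set.disjoint_left.1 k.bal.disj (k.bal.side_ac_subset mem_comp_self) hlb
        have hfa : f m ≠ a := fun e => not_mem_side k.bal.adj.ne' (e ▸ hlb)
        have hx' : (isolate T a).Adj (f m) x := ⟨hx, hfa, hxa⟩
        obtain ⟨y, hy, rfl⟩ := hf.bij.surjOn (comp_adj hlb hx')
        have hy' := (hf.adj _ hmc _ hy).1 hx'
        rw [(addEdge_adj_isolated not_isolate_adj k.ne).1 hy'.1]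
      exact fun x y hx hy => (key x hx).trans (key y hy).symm
    · have h1 := (hf.isolate hmc mem_comp_self).mcls_eq
      rw [hf.root] at h1
      have h3 : isolate (isolate (reattach T m z) a) m = isolate (isolate T a) m := by
        rw [isolate_comm, isolate_addEdge_self, isolate_isolated not_isolate_adj, isolate_comm]
      rw [h3] at h1
      rw [isolate_comm]
      exact Eq.trans h1.symm (cls_isolate k.not_mem_c)

theorem nonempty_iso (k : MovedLeaf T a b c d m z v v' w s t i j)
    (hm : cls (isolate (isolate T m) a) b = cls (isolate T a) c ∨
      (Leg (isolate (isolate T m) a) b (j + 1) ∧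
        ∀ l ∈ side T a b, (∀ x y, T.Adj l x → T.Adj l y → x = y) →
          cls (isolate (isolate T l) a) b ≠ cls (isolate T a) c)) :
    Nonempty (reattach T m z ≃g T) := by
  have hv : v ∈ comp (reattach T m z) a := by rw [isTree_comp k.isTree]; trivial
  rw [comp_eq_union k.ab] at hv
  rcases hv with hv | hv
  · rcases k.bal.mem_side_or z with hz | hz
    · exact (k.false_of_mem_ba hz hv (hm.imp_right fun h => h.1)).elim
    · exact k.nonempty_iso_of_mem_ab hz hv
  · by_cases hz : z ∈ side T a c
    · exact k.nonempty_iso_of_mem_ac hz hv (hm.imp_right fun h => h.2)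
    · exact (k.false_of_side_ac hz hv).elim

end MovedLeaf

end MovedLeaf

/-! ### Choosing the two cards -/

section Reconstruction

variable {F F' T X Y : SimpleGraph V} {m : V} {i j : ℕ}
  {a b c d p q u₀ l₀ w₀ w x y z : V} {S : Set V}

theorem edgeCard_leaf (hm : T.Adj m y) (hu : ∀ x y, T.Adj m x → T.Adj m y → x = y) :
    edgeCard T s(m, y) = isolate T m := by
  ext p q
  rw [edgeCard_adj_iff, isolate_adj]
  constructor
  · rintro ⟨h, h1, h2⟩
    refine ⟨h, ?_, ?_⟩
    · rintro rfl; exact h1 ⟨rfl, hu _ _ h hm⟩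
    · rintro rfl; exact h2 ⟨hu _ _ h.symm hm, rfl⟩
  · rintro ⟨h, h1, h2⟩
    exact ⟨h, fun h => h1 h.1, fun h => h2 h.2⟩

namespace Balanced
variable [Finite V]

theorem exists_endEdge (h : Balanced T a b c d) (ht : ¬ IsThin T (side T b a)) :
    ∃ l₀ u₀ w₀, EndEdge T a b l₀ u₀ w₀ := by
  simp only [IsThin, not_forall, not_le] at ht
  obtain ⟨l, hl, hcl, u, hlu, hcu⟩ := ht
  obtain ⟨u', hlu', hu'⟩ := card_nbrs_eq_one_iff.1 hcl
  obtain rfl := hu' u hlu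
  have hdis := Set.disjoint_left.1 h.disj
  have hub : u ≠ b := by
    rintro rfl
    rcases (h.adj_b l).1 hlu.symm with rfl | rfl
    · rw [h.card_nbrs_a] at hcl; omega
    · exact hdis hl (h.symm.side_ac_subset mem_comp_self)
  have hlb : l ≠ b := fun e => hdis hl (e ▸ mem_comp_self)
  have hu : u ∈ side T b a := comp_adj hl ⟨hlu, hlb, hub⟩
  -- Two adjacent vertices of degree one would make up the whole tree, but b is neither of them.
  have hcu1 : (nbrs T u).card ≠ 1 := by
    intro hcu1
    obtain ⟨l', hl', hul'⟩ := card_nbrs_eq_one_iff.1 hcu1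
    obtain rfl := hul' l hlu.symm
    have h1 : comp T u ⊆ {u, l} := by
      refine comp_subset (Or.inl rfl) ?_
      rintro x (rfl | rfl) y hxy
      · exact Or.inr (hul' y hxy)
      · exact Or.inl (hu' y hxy)
    have h2 : b ∈ comp T u := by rw [isTree_comp h.isTree]; trivial
    rcases h1 h2 with e | e
    · exact hub e.symm
    · exact hlb e.symm
  have hpos : 0 < (nbrs T u).card := Finset.card_pos.2 ⟨l, mem_nbrs.2 hlu.symm⟩
  have hcu2 : (nbrs T u).card = 2 := by omega
  classical
  obtain ⟨w, hw⟩ : ∃ w, (nbrs T u).erase l = {w} := by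
    rw [← Finset.card_eq_one, Finset.card_erase_of_mem (mem_nbrs.2 hlu.symm), hcu2]
  have hmem : ∀ x, x ∈ (nbrs T u).erase l ↔ x = w := fun x => by rw [hw, Finset.mem_singleton]
  simp only [Finset.mem_erase, mem_nbrs] at hmem
  refine ⟨l, u, w, hl, hu, fun x => ⟨hu' x, fun e => e ▸ hlu⟩, fun x => ?_, ?_⟩
  · by_cases hx : x = l
    · subst hx; simp [hlu.symm]
    · rw [← hmem x]; simp [hx]
  · exact ((hmem w).2 rfl).1.symm

theorem reconstructs_leaf [DecidableEq V] (h : Balanced T a b c d)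
    (e : EndEdge T a b l₀ u₀ w₀) (hc : Leg (isolate T a) c i) (hd : Leg (isolate T b) d j)
    (hle : j ≤ i) (hne : cls (isolate T a) c ≠ cls (isolate T b) d) (hm : m ∈ side T a b)
    (hmy : T.Adj m y) (hleaf : ∀ x y, T.Adj m x → T.Adj m y → x = y)
    (htype : cls (isolate (isolate T m) a) b = cls (isolate T a) c ∨
      (Leg (isolate (isolate T m) a) b (j + 1) ∧
        ∀ l ∈ side T a b, (∀ x y, T.Adj l x → T.Adj l y → x = y) →
          cls (isolate (isolate T l) a) b ≠ cls (isolate T a) c)) :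
    s(m, y) ≠ s(u₀, w₀) ∧ Reconstructs T {s(m, y), s(u₀, w₀)} := by
  have hee : s(m, y) ≠ s(u₀, w₀) := by
    intro heq
    obtain ⟨x, hx⟩ := e.exists_adj h m
    rw [edgeCard_adj] at hx
    exact hx.2 (hleaf x y hx.1 hmy ▸ heq)
  refine ⟨hee, reconstructs_pair hmy e.adj hee ?_⟩
  have key : ∀ z x₁ x₂, m ≠ z → (isolate T m).Adj x₁ x₂ →
      Nonempty (edgeCard (reattach T m z) s(x₁, x₂) ≃g edgeCard T s(u₀, w₀)) →
      Nonempty (reattach T m z ≃g T) := by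
    rintro z x₁ x₂ hmz hx ⟨φ⟩
    have hX := isTree_reattach h.isTree hleaf hmz
    obtain ⟨v, v', w, hs, h3, h4, s, t, h5, h6, h7, h8, h9, h10⟩ :=
      e.exists_of_iso h hX (le_addEdge hx) φ (h.leg_of_leg hc)
    exact MovedLeaf.nonempty_iso ⟨h, hc, hd, hle, hne, hm, hleaf, hmz, h3, h4, h5, h6, h7,
      h8, h9, h10⟩ htype
  rw [edgeCard_leaf hmy hleaf]
  intro p q f hf hfe hpq hnadj hφ
  induction f using Sym2.ind with | _ x₁ x₂
  have hx : (isolate T m).Adj x₁ x₂ := by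
    rw [← edgeCard_leaf hmy hleaf]; exact edgeCard_adj.2 ⟨hf, hfe⟩
  -- The vertex m is isolated in the first card and no vertex is isolated in the second, so the new
  -- edge ends at m: X is T with m moved.
  have hmpq : m = p ∨ m = q := by
    obtain ⟨φ⟩ := hφ
    obtain ⟨t, ht⟩ := e.exists_adj h (φ m)
    rw [← φ.apply_symm_apply t, φ.map_adj_iff] at ht
    rcases addEdge_adj.1 (edgeCard_le ht) with h | ⟨-, ⟨h, -⟩ | ⟨h, -⟩⟩
    · exact absurd h (not_isolate_adj _)
    · exact Or.inl h
    · exact Or.inr h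
  rcases hmpq with rfl | rfl
  · exact key q x₁ x₂ hpq hx hφ
  · rw [addEdge_comm] at hφ ⊢
    exact key p x₁ x₂ hpq.symm hx hφ

theorem exists_reconstructs_of_not_isThin (h : Balanced T a b c d)
    (hc : Leg (isolate T a) c i) (hd : Leg (isolate T b) d j) (hle : j ≤ i)
    (hne : cls (isolate T a) c ≠ cls (isolate T b) d) (ha : ¬ IsThin T (side T b a))
    (hb : ¬ IsThin T (side T a b)) :
    ∃ S : Finset (Sym2 V), S.card = 2 ∧ Reconstructs T S := by
  classical
  obtain ⟨l₀, u₀, w₀, e⟩ := h.exists_endEdge ha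
  -- A leaf m for which H - m is a copy of C is preferred. If there is none, a leaf beside a vertex
  -- of degree at most two serves, as its removal keeps the leg j + 1 of H.
  by_cases htype : ∃ l ∈ side T a b, (∀ x y, T.Adj l x → T.Adj l y → x = y) ∧
      cls (isolate (isolate T l) a) b = cls (isolate T a) c
  · obtain ⟨m, hm, hleaf, hcls⟩ := htype
    have hma : a ≠ m := fun e => not_mem_side (F := T) h.adj.ne' (e ▸ hm)
    obtain ⟨y, hmy, -⟩ := exists_adj_of_mem_comp (F := T) (v := m) (w := a)
      (by rw [isTree_comp h.isTree]; trivial) hma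
    obtain ⟨h1, h2⟩ := h.reconstructs_leaf e hc hd hle hne hm hmy hleaf (Or.inl hcls)
    exact ⟨_, Finset.card_pair h1, h2⟩
  · push Not at htype
    simp only [IsThin, not_forall, not_le] at hb
    obtain ⟨m, hm, hcm, y, hmy, hcy⟩ := hb
    obtain ⟨y', -, hu⟩ := card_nbrs_eq_one_iff.1 hcm
    have hleaf : ∀ x y, T.Adj m x → T.Adj m y → x = y := fun x y hx hy =>
      (hu x hx).trans (hu y hy).symm
    have hmb : m ≠ b := by
      rintro rfl
      exact h.d_ne (hleaf _ _ h.adj_bd h.adj.symm)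
    have hleg : Leg (isolate (isolate T m) a) b (j + 1) := by
      rw [isolate_comm]
      refine (h.symm.leg_of_leg hd).isolate_leaf hmb (fun x y hx hy => hleaf x y hx.1 hy.1) ?_ ?_
      · intro hmb x hx
        rw [h.symm.side_ac_adj.1 hx, h.symm.side_ac_adj.1 hmb.symm]
      · intro z hz x₁ x₂ hx₁ hx₂
        obtain rfl := hleaf _ _ hz.1 hmy
        by_contra! hcon
        have hsub : {x₁, x₂, m} ⊆ nbrs T z := by
          intro x hx
          simp only [Finset.mem_insert, Finset.mem_singleton] at hx
          rw [mem_nbrs]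
          rcases hx with rfl | rfl | rfl
          · exact hx₁.1
          · exact hx₂.1
          · exact hz.1.symm
        have := Finset.card_le_card hsub
        rw [Finset.card_eq_three.2 ⟨x₁, x₂, m, hcon.1, hcon.2.1, hcon.2.2, rfl⟩] at this
        omega
    obtain ⟨h1, h2⟩ := h.reconstructs_leaf e hc hd hle hne hm hmy hleaf (Or.inr ⟨hleg, htype⟩)
    exact ⟨_, Finset.card_pair h1, h2⟩

theorem exists_leg_c (h : Balanced T a b c d) : ∃ i, Leg (isolate T a) c i := by
  obtain ⟨i, hi⟩ := h.leg_a
  cases i with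
  | zero =>
    obtain ⟨x, y, hne, hx, hy⟩ := hi
    exact absurd ((h.side_ac_adj.1 hx).trans (h.side_ac_adj.1 hy).symm) hne
  | succ i =>
    obtain ⟨x, hx, -, hl⟩ := hi
    obtain rfl := h.side_ac_adj.1 hx
    exact ⟨i, hl.of_mcls_eq h.cls_isolate_c⟩

theorem exists_reconstructs (h : Balanced T a b c d) :
    ∃ S : Finset (Sym2 V), S.card = 2 ∧ Reconstructs T S := by
  classical
  by_cases hab : cls (isolate T b) a = cls (isolate T a) b
  · exact ⟨_, Finset.card_pair fun e => h.c_ne.symm (Sym2.congr_right.1 e),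
      h.reconstructs_ab_ac (Or.inl hab)⟩
  by_cases hb : IsThin T (side T a b)
  · exact h.exists_reconstructs_of_isThin hb
  by_cases ha : IsThin T (side T b a)
  · exact h.symm.exists_reconstructs_of_isThin ha
  have hne : cls (isolate T a) c ≠ cls (isolate T b) d := by
    intro he
    apply hab
    rw [cls_eq_of_unique (isAcyclic_isolate h.acyc) (isAcyclic_isolate h.acyc)
      (h.side_ac_adj.2 rfl) (fun x hx => h.side_ac_adj.1 hx) (h.symm.side_ac_adj.2 rfl)
      (fun x hx => h.symm.side_ac_adj.1 hx), h.cls_isolate_c, h.symm.cls_isolate_c, he]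
  obtain ⟨i, hi⟩ := h.exists_leg_c
  obtain ⟨j, hj⟩ := h.symm.exists_leg_c
  -- The end-edge is cut on the side with the longer leg and the leaf is moved from the other side;
  -- in case of a tie either assignment will do.
  rcases le_total j i with hij | hij
  · exact h.exists_reconstructs_of_not_isThin hi hj hij hne ha hb
  · exact h.symm.exists_reconstructs_of_not_isThin hj hi hij hne.symm hb ha

theorem ern_eq (h : Balanced T a b c d) : ern T = 2 := by
  obtain ⟨i, hi⟩ := h.exists_leg_c
  obtain ⟨x, -, y₁, y₂, y₃, h₁, h₂, h₃, h₁₂, h₁₃, h₂₃⟩ := exists_three_of_leg (h.leg_of_leg hi)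
  exact ern_eq_two h.isTree h₁.1 h₂.1 h₃.1 h₁₂ h₁₃ h₂₃ h.exists_reconstructs

end Balanced

theorem exists_adj_iff_of_degree_eq_two [Fintype V] [DecidableRel T.Adj] (hab : T.Adj a b)
    (ha : T.degree a = 2) : ∃ c, c ≠ b ∧ ∀ x, T.Adj a x ↔ x = b ∨ x = c := by
  classical
  rw [← card_neighborFinset_eq_degree] at ha
  obtain ⟨c, hc⟩ : ∃ c, (T.neighborFinset a).erase b = {c} := by
    rw [← Finset.card_eq_one, Finset.card_erase_of_mem ((mem_neighborFinset _ _ _).2 hab), ha]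
  have hmem : ∀ x, x ∈ (T.neighborFinset a).erase b ↔ x = c := fun x => by
    rw [hc, Finset.mem_singleton]
  simp only [Finset.mem_erase, mem_neighborFinset] at hmem
  refine ⟨c, ((hmem c).2 rfl).1, fun x => ?_⟩
  by_cases hx : x = b
  · subst hx; simp [hab]
  · rw [← hmem x]; simp [hx]

end Reconstruction

end EdgeReconstruction


/-! ### The theorem -/

theorem theorem4 {V : Type*} [Fintype V] (T : SimpleGraph V) [DecidableRel T.Adj] (a b : V)
    (hT : EdgeReconstruction.IsBicentroidal T a b)
    (ha : T.degree a = 2) (hb : T.degree b = 2)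
    (hG : ¬ EdgeReconstruction.IsPseudopath (EdgeReconstruction.centroidalComponent T a b))
    (hH : ¬ EdgeReconstruction.IsPseudopath (EdgeReconstruction.centroidalComponent T b a)) :
    EdgeReconstruction.ern T = 2 := by
  have hab := EdgeReconstruction.adj_of_isBicentroidal hT
  obtain ⟨c, hc, hac⟩ := EdgeReconstruction.exists_adj_iff_of_degree_eq_two hab ha
  obtain ⟨d, hd, hbd⟩ := EdgeReconstruction.exists_adj_iff_of_degree_eq_two hab.symm hb
  exact EdgeReconstruction.Balanced.ern_eq ⟨hT.1, hab, hac, hbd, hc, hd,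
    EdgeReconstruction.ncard_side_eq_of_isBicentroidal hT,
    EdgeReconstruction.exists_leg_of_not_isPseudopath hT.1.isAcyclic hab hG,
    EdgeReconstruction.exists_leg_of_not_isPseudopath hT.1.isAcyclic hab.symm hH⟩
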